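/- Let $F$ be a totally real number field, $E/F$ a quadratic CM extension with nontrivial automorphism $\rho$, and $v$ a finite place of $F$. Write $F_v$ for the completion, $\mathcal O$ for its ring of integers, $\mathfrak p$ for the maximal ideal of $\mathcal O$, $q=\#(\mathcal O/\mathfrak p)$, $E_v=F_v\otimes_F E$ with conjugation $\overline{a\otimes x}=a\otimes\rho(x)$, and $\mathcal O_E$ for the integral closure of $\mathcal O$ in $E_v$. If $E_v$ is a field let $\mathfrak q$ be the maximal ideal of $\mathcal O_E$; then $E_v$ is called inert if $\mathfrak p\mathcal O_E=\mathfrak q$ and ramified if $\mathfrak p\mathcal O_E=\mathfrak q^2$. Otherwise $E_v\cong F_v\oplus F_v$ (split). Let $\mathfrak d^{-1}=\{x\in E_v:\mathrm{tr}_{E_v/F_v}(x\mathcal O_E)\subset\mathcal O\}$ be the inverse different, and let $\mathfrak f$ be the order at $v$ of the discriminant ideal of $E_v/F_v$. Let $\varpi$ be a prime element of $\mathcal O$ and, if $E_v$ is ramified, let $\varpi_E\in E_v^\times$ satisfy $N_{E_v/F_v}(\varpi_E)=\varpi$. Put $X^*={}^t\overline X$ and $A[X]=X^*AX$. Let $\mathrm{Her}_n$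 be the set of $A\in\mathrm{Mat}_n(E_v)$ with $A^*=A$, and let $\widehat{\mathrm{Her}}_n$ be the set of $A\in\mathrm{Her}_n$ such that $\mathrm{tr}(AB)\in F_v\cap\mathcal O_E$ for every $B\in\mathrm{Her}_n$ with entries in $\mathcal O_E$. Let $\mathrm{Her}_{n,*}=\mathfrak p\widehat{\mathrm{Her}}_n$ if $E_v$ is not ramified, and if $E_v$ is ramified let $\mathrm{Her}_{n,*}$ be the set of $(a_{ij})\in\mathrm{Her}_n$ with $a_{ij}\in\mathfrak q\mathfrak d^{-1}$ for $i\neq j$ and $a_{ii}\in\mathcal O$. Let $\mathrm{Her}_{n,*}^{nd}$ be the set of $B\in\mathrm{Her}_{n,*}$ with $\det B\neq0$. Let $\Theta_{2k}=1_{2k}$ if $E_v$ is not ramified, and if $E_v$ is ramified let $\Theta_{2k}$ be the orthogonal sum of $k$ copies of $\begin{pmatrix}0&\varpi_E^{-\mathfrak f}\\ \overline{\varpi_E}^{-\mathfrak f}&0\end{pmatrix}$. For $n\le m$, a matrix in $\mathrm{Mat}_{m,n}(\mathcal O_E)$ is called primitive if it consists of the first $n$ columns of an element of $\mathrm{GL}_m(\mathcal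 O_E)$. For Hermitian matrices $A$ and $B$ of sizes $m$ and $n$ and an integer $e\ge0$, let $N_e(A,B)$ be the number of classes in $\mathrm{Mat}_{m,n}(\mathcal O_E)/\mathfrak p^e\mathrm{Mat}_{m,n}(\mathcal O_E)$ all of whose members $X$ are primitive and satisfy $A[X]-B\in\mathfrak p^e\widehat{\mathrm{Her}}_n$. The primitive local density is $$\beta(A,B)=\lim_{e\to\infty}q^{e(-2mn+n^2)}N_e(A,B).$$ Let $n,k\ge0$ be integers with $2k\ge n$ and let $B\in\mathrm{Her}_{n,*}^{nd}$. Then the limit defining $\beta(\Theta_{2k},B)$ exists, and $$\beta(\Theta_{2k},B)=\begin{cases}\prod_{i=0}^{2n-1}\bigl(1-(-1)^iq^{-2k+i}\bigr)&\text{if }E_v\text{ is inert},\\ \prod_{i=0}^{n-1}\bigl(1-q^{-2k+2i}\bigr)&\text{if }E_v\text{ is ramified},\\ \prod_{i=0}^{2n-1}\bigl(1-q^{-2k+i}\bigr)&\text{if }E_v\text{ is split}.\end{cases}$$ -/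

import Mathlib

open Filter Topology
open scoped TensorProduct NumberField Matrix

section LocalHermitian

/-! In this section `O` is a discrete valuation ring with fraction field `K`, and `L` is a
quadratic etale `K`-algebra with nontrivial involution `σ`.  The theorem uses
`K = F_v`, `O = O_v` and `L = E_v = F_v ⊗ E`. -/

variable (O K L : Type*) [CommRing O] [IsLocalRing O] [Field K] [Algebra O K]
  [CommRing L] [Algebra K L] [Algebra O L] [IsScalarTower O K L]

/-- The ring `O_E`, the integral closure of `O` in `L`. -/
abbrev IntRing : Type _ := integralClosure O L

/-- The maximal ideal `𝔭` of `O`. -/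
abbrev primeP : Ideal O := IsLocalRing.maximalIdeal O

/-- The ideal `𝔮` of `O_E`: the Jacobson radical, which is the maximal ideal of `O_E` if `L` is a
field (`O_E` is then local, `O` being complete), and `𝔭 ⊕ 𝔭` if `L = K ⊕ K`. -/
def primeQ : Ideal (IntRing O L) := Ideal.jacobson ⊥

/-- The cardinality `q` of the residue field `O / 𝔭`. -/
noncomputable def residueCard : ℕ := Nat.card (IsLocalRing.ResidueField O)

/-- `L` is inert over `K`: a field in which `𝔭` remains prime. -/
def IsInertAlg : Prop :=
  IsField L ∧ ((primeP O).map (algebraMap O (IntRing O L))).IsMaximal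

/-- `L` is ramified over `K`: a field with `𝔭 O_E = 𝔮 ^ 2`. -/
def IsRamifiedAlg : Prop :=
  IsField L ∧ (primeP O).map (algebraMap O (IntRing O L)) = primeQ O L ^ 2

/-- `L` is split over `K`. -/
def IsSplitAlg : Prop := Nonempty (L ≃ₐ[K] K × K)

/-- The inverse different `𝔡⁻¹ = {x ∈ L : tr (x O_E) ⊆ O}`. -/
def invDifferent : Submodule (IntRing O L) L where
  carrier := {x | ∀ y : IntRing O L,
    Algebra.trace K L (x * (y : L)) ∈ Set.range (algebraMap O K)}
  zero_mem' := fun y => ⟨0, by simp⟩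
  add_mem' := by
    intro a b ha hb y
    obtain ⟨r, hr⟩ := ha y
    obtain ⟨s, hs⟩ := hb y
    exact ⟨r + s, by rw [add_mul, map_add, map_add, hr, hs]⟩
  smul_mem' := by
    intro c x hx y
    obtain ⟨r, hr⟩ := hx (c * y)
    refine ⟨r, ?_⟩
    rw [hr]
    congr 1
    rw [Algebra.smul_def]
    change x * ((c : L) * (y : L)) = (c : L) * x * (y : L)
    ring

/-- The discriminant ideal of `L / K` in `O`, generated by the `det (tr (b i * b j))` for all pairs
`b` of elements of `O_E` (here `L` has rank `2` over `K`). -/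
def discrIdeal : Ideal O :=
  Ideal.span {d : O | ∃ b : Fin 2 → IntRing O L,
    algebraMap O K d = Algebra.discr K (fun i => (b i : L))}

/-- `𝔣 = min {ord x : x ∈ 𝔇}`, the order of the discriminant ideal `𝔇`. -/
noncomputable def discrExp [IsDomain O] [IsDiscreteValuationRing O] : ℕ :=
  sInf {f : ℕ | ∃ x ∈ discrIdeal O K L, IsDiscreteValuationRing.addVal O x = (f : ℕ∞)}

variable {K L} (σ : L ≃ₐ[K] L)

/-- `X^*`, the conjugate transpose with respect to `σ`. -/
def starMat {m n : ℕ} (X : Matrix (Fin m) (Fin n) L) : Matrix (Fin n) (Fin m) L :=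
  (X.map σ)ᵀ

/-- `A[X] = X^* A X`. -/
def actMat {m n : ℕ} (A : Matrix (Fin m) (Fin m) L) (X : Matrix (Fin m) (Fin n) L) :
    Matrix (Fin n) (Fin n) L :=
  starMat σ X * A * X

/-- The set `Her_n(K)` of Hermitian matrices of size `n` with entries in `L`. -/
def Her (n : ℕ) : Set (Matrix (Fin n) (Fin n) L) := {A | starMat σ A = A}

/-- The `O`-module of semi-integral Hermitian matrices: those Hermitian `A` such that
`tr (A B) ∈ K ∩ O_E` for all Hermitian `B` with entries in `O_E`. -/
def semiIntHer (n : ℕ) : Submodule O (Matrix (Fin n) (Fin n) L) where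
  carrier := {A | A ∈ Her σ n ∧ ∀ B ∈ Her σ n, (∀ i j, B i j ∈ integralClosure O L) →
    Matrix.trace (A * B) ∈ Set.range (algebraMap K L) ∧
    Matrix.trace (A * B) ∈ integralClosure O L}
  zero_mem' := by
    refine ⟨?_, fun B _ _ => ?_⟩
    · ext i j
      simp [starMat]
    · rw [zero_mul, Matrix.trace_zero]
      exact ⟨⟨0, map_zero _⟩, zero_mem _⟩
  add_mem' := by
    rintro A A' ⟨hA, hA2⟩ ⟨hB, hB2⟩
    refine ⟨?_, fun B h1 h2 => ?_⟩
    · ext i j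
      have e1 := congrFun (congrFun hA i) j
      have e2 := congrFun (congrFun hB i) j
      simp only [starMat, Matrix.transpose_apply, Matrix.map_apply] at e1 e2
      simp [starMat, e1, e2]
    · obtain ⟨⟨x, hx⟩, h3⟩ := hA2 B h1 h2
      obtain ⟨⟨y, hy⟩, h4⟩ := hB2 B h1 h2
      rw [add_mul, Matrix.trace_add]
      exact ⟨⟨x + y, by rw [map_add, hx, hy]⟩, add_mem h3 h4⟩
  smul_mem' := by
    rintro c A ⟨hA, hA2⟩
    have hc : ∀ x : L, c • x = algebraMap K L (algebraMap O K c) * x := fun x => by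
      rw [← IsScalarTower.algebraMap_apply, Algebra.smul_def]
    refine ⟨?_, fun B h1 h2 => ?_⟩
    · ext i j
      have e1 := congrFun (congrFun hA i) j
      simp only [starMat, Matrix.transpose_apply, Matrix.map_apply] at e1
      simp only [starMat, Matrix.transpose_apply, Matrix.map_apply, Matrix.smul_apply, hc,
        map_mul, AlgEquiv.commutes, e1]
    · obtain ⟨⟨x, hx⟩, h3⟩ := hA2 B h1 h2
      rw [Matrix.smul_mul, Matrix.trace_smul]
      refine ⟨⟨algebraMap O K c * x, ?_⟩, Subalgebra.smul_mem _ h3 c⟩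
      rw [map_mul, hx, hc]

open Classical in
/-- The set `Her_{n,*}`: `𝔭` times the semi-integral matrices if `L` is not ramified over `K`;
Hermitian matrices with diagonal in `O` and off-diagonal entries in `𝔮 𝔡⁻¹` if it is. -/
def HerStar (n : ℕ) : Set (Matrix (Fin n) (Fin n) L) :=
  if IsRamifiedAlg O L then
    {A | A ∈ Her σ n ∧ (∀ i j, i ≠ j → A i j ∈ primeQ O L • invDifferent O K L) ∧
      ∀ i, A i i ∈ Set.range (algebraMap O L)}
  else
    {A | A ∈ primeP O • semiIntHer O σ n}

/-- The subset `Her_{n,*}^{nd}` of nondegenerate elements of `Her_{n,*}`. -/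
def HerStarND (n : ℕ) : Set (Matrix (Fin n) (Fin n) L) := {A ∈ HerStar O σ n | A.det ≠ 0}

open Classical in
/-- The matrix `Θ_{2k}`: the identity if `L` is not ramified over `K`; if it is, the orthogonal sum
of `k` copies of the `2 × 2` matrix with zero diagonal and off-diagonal entries `ϖ_E ^ (-𝔣)` (above
the diagonal) and its conjugate (below). -/
noncomputable def thetaMat [IsDomain O] [IsDiscreteValuationRing O] (ϖE : Lˣ) (k : ℕ) :
    Matrix (Fin (2 * k)) (Fin (2 * k)) L :=
  if IsRamifiedAlg O L then
    Matrix.of fun i j =>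
      if (i : ℕ) % 2 = 0 ∧ (j : ℕ) = i + 1 then ((ϖE ^ (-(discrExp O K L : ℤ)) : Lˣ) : L)
      else if (j : ℕ) % 2 = 0 ∧ (i : ℕ) = j + 1 then
        σ ((ϖE ^ (-(discrExp O K L : ℤ)) : Lˣ) : L)
      else 0
  else 1

variable (L) in
/-- The primitive `m × n` matrices over `O_E`: the first `n` columns of elements of `GL_m(O_E)`. -/
def primMat (m n : ℕ) : Set (Matrix (Fin m) (Fin n) (IntRing O L)) :=
  {X | ∃ (h : n ≤ m) (U : GL (Fin m) (IntRing O L)),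
    X = (U : Matrix (Fin m) (Fin m) (IntRing O L)).submatrix id (Fin.castLE h)}

/-- `𝒜_e(A, B; S) = {X ∈ S : A[X] - B ∈ 𝔭 ^ e Ĥer_n}` for a set `S` of matrices over `O_E`. -/
def solSet {m n : ℕ} (A : Matrix (Fin m) (Fin m) L) (B : Matrix (Fin n) (Fin n) L)
    (S : Set (Matrix (Fin m) (Fin n) (IntRing O L))) (e : ℕ) :
    Set (Matrix (Fin m) (Fin n) (IntRing O L)) :=
  {X ∈ S | actMat σ A (X.map (algebraMap (IntRing O L) L)) - B ∈ primeP O ^ e • semiIntHer O σ n}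

/-- The number of classes modulo `𝔭 ^ e` of matrices over `O_E` that are contained in
`𝒜_e(A, B; S)`. -/
noncomputable def solCount {m n : ℕ} (A : Matrix (Fin m) (Fin m) L) (B : Matrix (Fin n) (Fin n) L)
    (S : Set (Matrix (Fin m) (Fin n) (IntRing O L))) (e : ℕ) : ℕ :=
  Nat.card {c : Matrix (Fin m) (Fin n) (IntRing O L) ⧸
      (primeP O ^ e • (⊤ : Submodule O (Matrix (Fin m) (Fin n) (IntRing O L)))) //
    ∀ X, Submodule.Quotient.mk X = c → X ∈ solSet O σ A B S e}

/-- The normalized count `q ^ (e (-2mn + n ^ 2)) * #𝒜̄_e(A, B; S)`. -/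
noncomputable def densitySeq {m n : ℕ} (A : Matrix (Fin m) (Fin m) L)
    (B : Matrix (Fin n) (Fin n) L) (S : Set (Matrix (Fin m) (Fin n) (IntRing O L))) (e : ℕ) : ℝ :=
  (residueCard O : ℝ) ^ ((e : ℤ) * (-2 * (m : ℤ) * (n : ℤ) + (n : ℤ) ^ 2)) *
    (solCount O σ A B S e : ℝ)

/-- The primitive local density `β(A, B)`, the limit of the normalized counts of primitive
solutions. -/
noncomputable def primDensity {m n : ℕ} (A : Matrix (Fin m) (Fin m) L)
    (B : Matrix (Fin n) (Fin n) L) : ℝ :=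
  limUnder atTop (densitySeq O σ A B (primMat O L m n))

end LocalHermitian

section Place

variable (F E : Type*) [Field F] [NumberField F] [Field E] [Algebra F E]
  (v : IsDedekindDomain.HeightOneSpectrum (𝓞 F))

/-- The completion `F_v`. -/
abbrev LocF : Type _ := v.adicCompletion F

/-- The ring of integers `O_v` of `F_v`. -/
abbrev LocO : Type _ := v.adicCompletionIntegers F

/-- The algebra `E_v = F_v ⊗ E`. -/
abbrev LocE : Type _ := LocF F v ⊗[F] E

variable {E} in
/-- The conjugation `a ⊗ x ↦ a ⊗ ρ x` of `E_v`. -/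
noncomputable def locConj (ρ : E ≃ₐ[F] E) : LocE F E v ≃ₐ[LocF F v] LocE F E v :=
  Algebra.TensorProduct.congr AlgEquiv.refl ρ

end Place

/-!
Write `O_E` for the integral closure of `O` in `L = E_v` and `σ` for the conjugation. The argument
uses only that `O` is a discrete valuation ring with finite residue field, of cardinality `q`, and
that `O_E = O[θ]` with `θ ^ 2 = a θ - b` and `σ θ = a - θ` (`IsQuadGen`, `exists_isQuadGen`); no
completeness is needed. The discriminant `(θ - σ θ) ^ 2 = a ^ 2 - 4 b` separates the cases: it is not
a unit exactly if `L` is ramified, and then `θ` can be chosen with an Eisenstein polynomial, in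
particular `θ = ϖ_E` (`exists_eisenstein`, `isQuadGen_of_norm_eq`); if it is a unit, then `L` is split
or inert according to whether `t ^ 2 - a t + b` has a root in the residue field.

Multiplication by `θ - σ θ`, which generates the different, turns hermitian matrices into
skew-hermitian ones. The semi-integral matrices become the lattice of all `Z - Z^*` with `Z` over
`O_E`, the matrix `Θ` becomes an invertible matrix `T` of this lattice, and `Her_{n,*}` becomes the
lattice of all `t Z - (t Z)^*`, with `t` a prime element of `O` in the unramified case and `t = θ` in
the ramified one (`mem_smul_iff`, `exists_isScaled_of_mem_herStar`, `exists_isScaled_thetaMat`). So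
the counts are numbers of primitive solutions of `X^* T X ≡ C` modulo lattices of this kind
(`solCount_eq_primCount`), where `C` is congruent to `0` for the modulus `t`.

The derivative of `X ↦ X^* T X` at a primitive `X` is `Y ↦ X^* T Y - (X^* T Y)^*`. It maps
`t Mat(O_E)` onto the lattice of the `t Z - (t Z)^*`, because `X^* T` has a right inverse. Hence
solutions lift from one modulus to the next in a number given by lattice indices (`classCount_lift`),
and the normalized count is constant from the modulus `ϖ` on (`normalized_primCount`); in the ramified
case one more step leads down to the modulus `θ` (`primCount_eisenstein`). For these smallest moduli
`C` drops out, and the primitive solutions are the totally isotropic linearly independent `n`-tuples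
of a hermitian space over the field with `q ^ 2` elements (inert), the pairs of mutually orthogonal
linearly independent `n`-tuples over the field with `q` elements (split), or the totally isotropic
linearly independent `n`-tuples of a symplectic space over the field with `q` elements (ramified).
They are counted one vector at a time in `card_hermitian_frames`, `card_orthogonal_frames` and
`card_symplectic_frames`.
-/

/-! ### Counting frames over finite fields -/

/-- Counting `n`-tuples one entry at a time: if every admissible `n`-tuple has `c n` admissible
extensions, then there are `c 0 * ⋯ * c (n - 1)` admissible `n`-tuples. -/
lemma card_tuples_eq_prod {V : Type*} [Finite V] (P : ∀ n, (Fin n → V) → Prop)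
    (Q : ∀ n, (Fin n → V) → V → Prop) (c : ℕ → ℝ) (h0 : ∀ v, P 0 v)
    (hs : ∀ n (v : Fin n → V) x, P (n + 1) (Fin.snoc v x : Fin (n + 1) → V) ↔ P n v ∧ Q n v x)
    (hc : ∀ n v, P n v → (Nat.card {x // Q n v x} : ℝ) = c n) (n : ℕ) :
    (Nat.card {v // P n v} : ℝ) = ∏ i ∈ Finset.range n, c i := by
  induction n with
  | zero =>
    have : Unique {v // P 0 v} := ⟨⟨⟨Fin.elim0, h0 _⟩⟩, fun v => Subtype.ext (Subsingleton.elim _ _)⟩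
    simp
  | succ n ih =>
    classical
    let e : {v // P (n + 1) v} ≃ Σ v : {v // P n v}, {x // Q n v.1 x} :=
      { toFun := fun w =>
          have h := (hs n (Fin.init w.1) (w.1 (Fin.last n))).1 (by
            rw [Fin.snoc_init_self]; exact w.2)
          ⟨⟨Fin.init w.1, h.1⟩, ⟨w.1 (Fin.last n), h.2⟩⟩
        invFun := fun p => ⟨Fin.snoc p.1.1 p.2.1, (hs n _ _).2 ⟨p.1.2, p.2.2⟩⟩
        left_inv := fun w => Subtype.ext (Fin.snoc_init_self _)
        right_inv := by
          rintro ⟨⟨v, hv⟩, ⟨x, hx⟩⟩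
          have h1 : Fin.init (Fin.snoc v x : Fin (n + 1) → V) = v := Fin.init_snoc _ _
          have h2 : (Fin.snoc v x : Fin (n + 1) → V) (Fin.last n) = x := Fin.snoc_last _ _
          simp only [h2]
          congr! }
    have := Fintype.ofFinite {v // P n v}
    rw [Nat.card_congr e, Nat.card_sigma, Finset.prod_range_succ, ← ih]
    push_cast
    rw [Finset.sum_congr rfl (fun v _ => hc n v.1 v.2), Finset.sum_const, nsmul_eq_mul,
      Finset.card_univ, Nat.card_eq_fintype_card]

lemma forall_fin_snoc {V : Type*} {n : ℕ} (v : Fin n → V) (x : V) (p : V → Prop) :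
    (∀ i, p ((Fin.snoc v x : Fin (n + 1) → V) i)) ↔ (∀ i, p (v i)) ∧ p x := by
  rw [Fin.forall_fin_succ']
  simp

section Frames

variable {k : Type*} [Field k] {m : ℕ}

lemma card_span_eq_pow {V : Type*} [AddCommGroup V] [Module k V] [Finite V] {n : ℕ} {v : Fin n → V}
    (hv : LinearIndependent k v) :
    Nat.card (Submodule.span k (Set.range v)) = Nat.card k ^ n := by
  rw [Module.natCard_eq_pow_finrank (K := k), finrank_span_eq_card hv, Fintype.card_fin]

lemma card_mem_and_notMem {V : Type*} [Finite V] {S T : Set V} (h : T ⊆ S) :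
    (Nat.card {x // x ∈ S ∧ x ∉ T} : ℝ) = Nat.card S - Nat.card T := by
  have h1 : Nat.card {x // x ∈ S ∧ x ∉ T} = (S \ T).ncard := rfl
  have h2 := Set.ncard_sdiff_add_ncard_of_subset h (Set.toFinite S)
  rw [h1, Nat.card_coe_set_eq, Nat.card_coe_set_eq, ← h2]
  push_cast; ring

lemma card_linearIndependent_mem {V : Type*} [AddCommGroup V] [Module k V] [Finite V]
    (U : Submodule k V) (n : ℕ) :
    (Nat.card {v : Fin n → V // LinearIndependent k v ∧ ∀ i, v i ∈ U} : ℝ) =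
      ∏ i ∈ Finset.range n, ((Nat.card U : ℝ) - (Nat.card k : ℝ) ^ i) := by
  refine card_tuples_eq_prod (fun n (v : Fin n → V) => LinearIndependent k v ∧ ∀ i, v i ∈ U)
    (fun n v x => x ∈ (U : Set V) ∧ x ∉ (Submodule.span k (Set.range v) : Set V)) _
    (fun v => ⟨linearIndependent_empty_type, fun i => i.elim0⟩) (fun n v x => ?_)
    (fun n v hv => ?_) n
  · rw [linearIndependent_finSnoc, forall_fin_snoc v x (· ∈ U)]
    simp only [SetLike.mem_coe]
    tauto
  · rw [card_mem_and_notMem]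
    · have := card_span_eq_pow hv.1
      simp only [SetLike.coe_sort_coe, this]
      push_cast; rfl
    · exact Submodule.span_le.2 (by rintro _ ⟨i, rfl⟩; exact hv.2 i)

/-- The vectors orthogonal to each `v i` for the standard bilinear form. -/
def orthTo {n : ℕ} (v : Fin n → Fin m → k) : Submodule k (Fin m → k) :=
  LinearMap.ker (Matrix.of v).mulVecLin

lemma mem_orthTo {n : ℕ} (v : Fin n → Fin m → k) (x : Fin m → k) :
    x ∈ orthTo v ↔ ∀ i, v i ⬝ᵥ x = 0 := by
  rw [orthTo, LinearMap.mem_ker, Matrix.mulVecLin_apply, funext_iff]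
  rfl

lemma card_orthTo {n : ℕ} {v : Fin n → Fin m → k} (hv : LinearIndependent k v) :
    Nat.card (orthTo v) = Nat.card k ^ (m - n) := by
  have h1 := LinearMap.finrank_range_add_finrank_ker (Matrix.of v).mulVecLin
  have h2 : Module.finrank k (LinearMap.range (Matrix.of v).mulVecLin) = n := by
    have := LinearIndependent.rank_matrix (M := Matrix.of v) hv
    rw [Matrix.rank, Fintype.card_fin] at this
    exact this
  rw [h2, Module.finrank_fin_fun] at h1
  rw [Module.natCard_eq_pow_finrank (K := k), orthTo]
  congr 1
  omega

/-- The number of pairs of linearly independent `n`-tuples in `k ^ m` that are orthogonal to each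
other. -/
lemma card_orthogonal_frames [Finite k] (n : ℕ) :
    (Nat.card {p : (Fin n → Fin m → k) × (Fin n → Fin m → k) // LinearIndependent k p.1 ∧
      LinearIndependent k p.2 ∧ ∀ i j, p.1 i ⬝ᵥ p.2 j = 0} : ℝ) =
    (∏ i ∈ Finset.range n, ((Nat.card k : ℝ) ^ m - (Nat.card k : ℝ) ^ i)) *
      ∏ i ∈ Finset.range n, ((Nat.card k : ℝ) ^ (m - n) - (Nat.card k : ℝ) ^ i) := by
  let e : {p : (Fin n → Fin m → k) × (Fin n → Fin m → k) // LinearIndependent k p.1 ∧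
      LinearIndependent k p.2 ∧ ∀ i j, p.1 i ⬝ᵥ p.2 j = 0} ≃
      Σ v : {v : Fin n → Fin m → k // LinearIndependent k v ∧ ∀ i, v i ∈
        (⊤ : Submodule k (Fin m → k))},
        {w : Fin n → Fin m → k // LinearIndependent k w ∧ ∀ i, w i ∈ orthTo v.1} :=
    { toFun := fun p => ⟨⟨p.1.1, p.2.1, fun _ => trivial⟩, ⟨p.1.2, p.2.2.1, fun j =>
        (mem_orthTo _ _).2 fun i => p.2.2.2 i j⟩⟩
      invFun := fun p => ⟨(p.1.1, p.2.1), p.1.2.1, p.2.2.1, fun i j =>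
        (mem_orthTo _ _).1 (p.2.2.2 j) i⟩
      left_inv := fun _ => rfl
      right_inv := fun _ => rfl }
  have := Fintype.ofFinite {v : Fin n → Fin m → k // LinearIndependent k v ∧ ∀ i, v i ∈
        (⊤ : Submodule k (Fin m → k))}
  rw [Nat.card_congr e, Nat.card_sigma]
  push_cast
  rw [Finset.sum_congr rfl (fun v _ => card_linearIndependent_mem (orthTo v.1) n)]
  rw [Finset.sum_congr rfl (fun v _ => by rw [card_orthTo v.2.1]), Finset.sum_const, nsmul_eq_mul,
      Finset.card_univ, ← Nat.card_eq_fintype_card, card_linearIndependent_mem]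
  have : Nat.card (⊤ : Submodule k (Fin m → k)) = Nat.card k ^ m := by
    rw [Nat.card_congr Submodule.topEquiv.toEquiv]
    rw [Nat.card_fun, Nat.card_eq_fintype_card (α := Fin m), Fintype.card_fin]
  rw [this]
  push_cast; rfl

/-- The number of linearly independent totally isotropic `n`-tuples in a nondegenerate symplectic
space of dimension `m`. -/
lemma card_symplectic_frames [Finite k] (A : Matrix (Fin m) (Fin m) k) (hA : IsUnit A)
    (halt : ∀ x, x ⬝ᵥ A *ᵥ x = 0) (n : ℕ) :
    (Nat.card {v : Fin n → Fin m → k // LinearIndependent k v ∧ ∀ i j, v i ⬝ᵥ A *ᵥ v j = 0} : ℝ) =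
      ∏ i ∈ Finset.range n, ((Nat.card k : ℝ) ^ (m - i) - (Nat.card k : ℝ) ^ i) := by
  have hskew : ∀ x y, x ⬝ᵥ A *ᵥ y = 0 → y ⬝ᵥ A *ᵥ x = 0 := fun x y h => by
    have := halt (x + y)
    rw [Matrix.mulVec_add, dotProduct_add, add_dotProduct, add_dotProduct, halt, halt, h] at this
    simpa using this
  refine card_tuples_eq_prod
    (fun n (v : Fin n → Fin m → k) => LinearIndependent k v ∧ ∀ i j, v i ⬝ᵥ A *ᵥ v j = 0)
    (fun n v x => x ∈ (orthTo (fun i => v i ᵥ* A) : Set (Fin m → k)) ∧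
      x ∉ (Submodule.span k (Set.range v) : Set (Fin m → k))) _
    (fun v => ⟨linearIndependent_empty_type, fun i => i.elim0⟩) (fun n v x => ?_)
    (fun n v hv => ?_) n
  · rw [linearIndependent_finSnoc, SetLike.mem_coe, SetLike.mem_coe, mem_orthTo,
      forall_fin_snoc v x (fun a => ∀ j, a ⬝ᵥ A *ᵥ (Fin.snoc v x : Fin (n + 1) → Fin m → k) j = 0),
      forall_fin_snoc v x (fun b => x ⬝ᵥ A *ᵥ b = 0)]
    simp only [← Matrix.dotProduct_mulVec]
    simp only [fun i => forall_fin_snoc v x (fun b => v i ⬝ᵥ A *ᵥ b = 0), forall_and]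
    constructor
    · rintro ⟨⟨h1, h2⟩, ⟨h3, h4⟩, -⟩
      exact ⟨⟨h1, h3⟩, h4, h2⟩
    · rintro ⟨⟨h1, h3⟩, h4, h2⟩
      exact ⟨⟨h1, h2⟩, ⟨h3, h4⟩, fun i => hskew _ _ (h4 i), halt x⟩
  · rw [card_mem_and_notMem]
    · have h1 := card_span_eq_pow hv.1
      have h2 : LinearIndependent k (fun i => v i ᵥ* A) := by
        have := hv.1.map' A.vecMulLinear (LinearMap.ker_eq_bot.2
          (Matrix.vecMul_injective_iff_isUnit.2 hA))
        exact this
      have h3 := card_orthTo h2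
      simp only [SetLike.coe_sort_coe, h1, h3]
      push_cast; rfl
    · refine Submodule.span_le.2 ?_
      rintro _ ⟨i, rfl⟩
      refine (mem_orthTo _ _).2 fun j => ?_
      rw [← Matrix.dotProduct_mulVec]
      exact hv.2 j i

end Frames

/-! ### Isotropic frames of a hermitian space over a finite field -/

section Hermitian

lemma card_fiber_of_surjective {G H : Type*} [AddGroup G] [AddGroup H] [Finite G] [Finite H]
    (f : G →+ H) (hf : Function.Surjective f) (t : H) :
    (Nat.card {x // f x = t} : ℝ) = Nat.card G / Nat.card H := by
  classical
  have := Fintype.ofFinite G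
  have := Fintype.ofFinite H
  have h : Nat.card G = Nat.card H * Nat.card {x // f x = t} := by
    rw [Nat.card_congr (Equiv.sigmaFiberEquiv f).symm, Nat.card_sigma,
      Finset.sum_congr rfl (g := fun _ => Nat.card {x // f x = t}) (fun y _ => ?_)]
    · rw [Finset.sum_const, smul_eq_mul, Finset.card_univ, Nat.card_eq_fintype_card (α := H)]
    · have h := AddMonoidHom.card_fiber_eq_of_mem_range f (hf y) (hf t)
      simpa [Nat.card_eq_fintype_card, Fintype.card_subtype] using h
  have : (Nat.card H : ℝ) ≠ 0 := by exact_mod_cast Nat.card_pos.ne'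
  rw [h]
  push_cast
  field_simp

variable {k κ : Type*} [Field k] [Field κ] [Algebra k κ] [Finite κ]

lemma card_quadratic_field (h2 : Module.finrank k κ = 2) :
    Nat.card κ = Nat.card k ^ 2 := by
  rw [Module.natCard_eq_pow_finrank (K := k), h2]

lemma card_norm_fiber [Finite k] (h2 : Module.finrank k κ = 2) {t : k} (ht : t ≠ 0) :
    (Nat.card {c : κ // Algebra.norm k c = t} : ℝ) = Nat.card k + 1 := by
  classical
  have := Fintype.ofFinite k
  have := Fintype.ofFinite κ
  have hs := FiniteField.unitsMap_norm_surjective k κ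
  set f : κˣ →* kˣ := Units.map (Algebra.norm k)
  have h1 : ∀ x : κˣ, (f x : k) = Algebra.norm k (x : κ) := fun x => rfl
  let e : {c : κ // Algebra.norm k c = t} ≃ {c : κˣ // f c = Units.mk0 t ht} :=
    { toFun := fun c => ⟨Units.mk0 c.1 (fun h => ht (by
          have := FiniteDimensional.of_finrank_eq_succ h2
          rw [← c.2, h, Algebra.norm_zero])),
        Units.ext c.2⟩
      invFun := fun c => ⟨c.1, by rw [← h1, c.2]; rfl⟩
      left_inv := fun c => rfl
      right_inv := fun c => Subtype.ext (Units.ext rfl) }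
  have h := card_fiber_of_surjective (MonoidHom.toAdditive f) hs (Additive.ofMul (Units.mk0 t ht))
  have h' : (Nat.card {c : κˣ // f c = Units.mk0 t ht} : ℝ) =
    Nat.card κˣ / Nat.card kˣ := h
  rw [Nat.card_congr e, h', Nat.card_units, Nat.card_units, card_quadratic_field h2]
  have hq : 2 ≤ Nat.card k := Finite.one_lt_card
  rw [Nat.cast_sub (by nlinarith), Nat.cast_sub (by omega)]
  have : (2 : ℝ) ≤ Nat.card k := by exact_mod_cast hq
  rw [div_eq_iff (by push_cast; linarith)]
  push_cast; ring

/-- The number of isotropic vectors of the hermitian form `∑ N(x i)`, by splitting off one coordinate: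
the norm takes the value `0` once and every other value `q + 1` times. -/
lemma card_isotropic [Finite k] (h2 : Module.finrank k κ = 2) (m : ℕ) :
    (Nat.card k : ℝ) * Nat.card {x : Fin m → κ // ∑ i, Algebra.norm k (x i) = 0} =
      (Nat.card k : ℝ) ^ (2 * m) + (Nat.card k - 1) * (-(Nat.card k : ℝ)) ^ m := by
  classical
  have := Fintype.ofFinite κ
  induction m with
  | zero =>
    have : Nat.card {x : Fin 0 → κ // ∑ i, Algebra.norm k (x i) = 0} = 1 := by
      have : Unique {x : Fin 0 → κ // ∑ i, Algebra.norm k (x i) = 0} :=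
        ⟨⟨⟨Fin.elim0, by simp⟩⟩, fun v => Subtype.ext (Subsingleton.elim _ _)⟩
      simp
    rw [this]; simp
  | succ m ih =>
    let e : {x : Fin (m + 1) → κ // ∑ i, Algebra.norm k (x i) = 0} ≃
        Σ z : Fin m → κ, {c : κ // Algebra.norm k c = -∑ i, Algebra.norm k (z i)} :=
      { toFun := fun x => ⟨Fin.tail x.1, x.1 0, by
          have := x.2
          rw [Fin.sum_univ_succ] at this
          exact eq_neg_of_add_eq_zero_left this⟩
        invFun := fun p => ⟨Fin.cons p.2.1 p.1, by
          rw [Fin.sum_univ_succ]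
          simp [p.2.2]⟩
        left_inv := fun x => Subtype.ext (Fin.cons_self_tail _)
        right_inv := fun p => rfl }
    have hf : ∀ z : Fin m → κ,
        (Nat.card {c : κ // Algebra.norm k c = -∑ i, Algebra.norm k (z i)} : ℝ) =
        (Nat.card k + 1) - if ∑ i, Algebra.norm k (z i) = 0 then (Nat.card k : ℝ) else 0 := by
      intro z
      split_ifs with h
      · have : Unique {c : κ // Algebra.norm k c = -∑ i, Algebra.norm k (z i)} :=
          ⟨⟨⟨0, by rw [h]; simp⟩⟩, fun c => Subtype.ext (by
            exact Algebra.norm_eq_zero_iff.1 (c.2.trans (by rw [h, neg_zero])))⟩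
        simp
      · rw [card_norm_fiber h2 (neg_ne_zero.2 h), sub_zero]
    rw [Nat.card_congr e, Nat.card_sigma]
    push_cast
    rw [Finset.sum_congr rfl (fun z _ => hf z), Finset.sum_sub_distrib, Finset.sum_const,
      ← Finset.sum_filter, Finset.sum_const, nsmul_eq_mul, nsmul_eq_mul, Finset.card_univ,
      ← Fintype.card_subtype, ← Nat.card_eq_fintype_card, ← Nat.card_eq_fintype_card,
      Nat.card_fun, card_quadratic_field h2, Nat.card_eq_fintype_card (α := Fin m),
      Fintype.card_fin, mul_sub, mul_comm _ (Nat.card k : ℝ), ih]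
    push_cast
    ring

variable (s : κ ≃ₐ[k] κ)

section
variable (h2 : Module.finrank k κ = 2) (hs : s ≠ 1)
include h2 hs

lemma univ_algEquiv_eq [Fintype (κ ≃ₐ[k] κ)]
    [DecidableEq (κ ≃ₐ[k] κ)] :
    (Finset.univ : Finset (κ ≃ₐ[k] κ)) = {1, s} := by
  have : FiniteDimensional k κ := Module.finite_of_finrank_pos (by omega)
  symm
  apply Finset.eq_of_subset_of_card_le (Finset.subset_univ _)
  rw [Finset.card_pair hs.symm, Finset.card_univ]
  rw [← h2]
  convert AlgEquiv.card_le (F := k) (K := κ)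

lemma algebraMap_norm_eq [Finite k] (x : κ) : algebraMap k κ (Algebra.norm k x) = s x * x := by
  classical
  have : FiniteDimensional k κ := Module.finite_of_finrank_pos (by omega)
  rw [Algebra.norm_eq_prod_automorphisms, univ_algEquiv_eq s h2 hs, Finset.prod_pair hs.symm,
    AlgEquiv.one_apply, mul_comm]

lemma algebraMap_trace_eq [Finite k] (x : κ) :
    algebraMap k κ (Algebra.trace k κ x) = x + s x := by
  classical
  have : FiniteDimensional k κ := Module.finite_of_finrank_pos (by omega)
  rw [trace_eq_sum_automorphisms, univ_algEquiv_eq s h2 hs, Finset.sum_pair hs.symm,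
    AlgEquiv.one_apply]

lemma involutive_of_ne_one [Finite k] (x : κ) : s (s x) = x := by
  have h := algebraMap_trace_eq s h2 hs x
  have h' := congrArg s h
  rw [AlgEquiv.commutes, h, map_add] at h'
  linear_combination -h'

lemma algebraMap_sum_norm [Finite k] {m : ℕ} (x : Fin m → κ) :
    algebraMap k κ (∑ i, Algebra.norm k (x i)) = (s ∘ x) ⬝ᵥ x := by
  rw [map_sum]
  exact Finset.sum_congr rfl fun i _ => algebraMap_norm_eq s h2 hs _

lemma sum_norm_add [Finite k] {m : ℕ} (x y : Fin m → κ) :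
    ∑ i, Algebra.norm k ((x + y) i) = ∑ i, Algebra.norm k (x i) + ∑ i, Algebra.norm k (y i) +
      Algebra.trace k κ ((s ∘ y) ⬝ᵥ x) := by
  apply (algebraMap k κ).injective
  rw [map_add, map_add, algebraMap_sum_norm s h2 hs, algebraMap_sum_norm s h2 hs,
    algebraMap_sum_norm s h2 hs, algebraMap_trace_eq s h2 hs]
  simp only [dotProduct, ← Finset.sum_add_distrib, map_sum]
  refine Finset.sum_congr rfl fun i _ => ?_
  simp only [Function.comp, Pi.add_apply, map_add, map_mul, involutive_of_ne_one s h2 hs]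
  ring

omit hs in
lemma trace_surjective_of_finrank_eq_two [Finite k] :
    Function.Surjective (Algebra.trace k κ) := by
  have : FiniteDimensional k κ := Module.finite_of_finrank_pos (by omega)
  exact Algebra.trace_surjective k κ

/-- The number of isotropic vectors orthogonal to a totally isotropic frame `v`.  The pairs `(x, w)`
with `w` in the span `W` of `v` and `x + w` isotropic are counted in two ways: for fixed `w` there
are as many as isotropic vectors; for fixed `x` the value of the form at `x + w` does not depend on
`w` if `x` is orthogonal to `W`, and is equidistributed over `k` if it is not. -/
lemma card_isotropic_orthTo [Finite k] {m n : ℕ} (v : Fin n → Fin m → κ)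
    (hv : LinearIndependent κ v) (hiso : ∀ i j, (s ∘ v i) ⬝ᵥ v j = 0) :
    (Nat.card k : ℝ) * Nat.card {x : Fin m → κ // x ∈ orthTo (fun i => s ∘ v i) ∧
      ∑ i, Algebra.norm k (x i) = 0} =
      (Nat.card k : ℝ) ^ (2 * (m - n)) + (Nat.card k - 1) * (-(Nat.card k : ℝ)) ^ m := by
  classical
  have := Fintype.ofFinite κ
  set q : ℝ := (Nat.card k : ℝ) with hq
  have hq0 : q ≠ 0 := by
    rw [hq]; exact_mod_cast Nat.card_pos.ne'
  set W : (Fin n → κ) → Fin m → κ := fun l => ∑ i, l i • v i with hW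
  have hWW : ∀ l, ∑ i, Algebra.norm k (W l i) = 0 := fun l => by
    apply (algebraMap k κ).injective
    rw [algebraMap_sum_norm s h2 hs, map_zero]
    have : s ∘ W l = ∑ i, s (l i) • (s ∘ v i) := by
      ext j; simp [hW]
    rw [this, sum_dotProduct]
    refine Finset.sum_eq_zero fun i _ => ?_
    rw [smul_dotProduct, dotProduct_sum, Finset.sum_eq_zero, smul_zero]
    intro j _
    rw [dotProduct_smul, hiso, smul_zero]
  have hxW : ∀ x l, (s ∘ W l) ⬝ᵥ x = ∑ i, s (l i) * ((s ∘ v i) ⬝ᵥ x) := fun x l => by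
    have : s ∘ W l = ∑ i, s (l i) • (s ∘ v i) := by
      ext j; simp [hW]
    rw [this, sum_dotProduct]
    simp only [smul_dotProduct, smul_eq_mul]
  have hk : (Nat.card (Fin n → κ) : ℝ) = q ^ (2 * n) := by
    rw [Nat.card_fun, card_quadratic_field h2, Nat.card_eq_fintype_card (α := Fin n),
      Fintype.card_fin, pow_mul]; push_cast; rfl
  have hkm : (Fintype.card (Fin m → κ) : ℝ) = q ^ (2 * m) := by
    rw [← Nat.card_eq_fintype_card, Nat.card_fun, card_quadratic_field h2,
      Nat.card_eq_fintype_card (α := Fin m), Fintype.card_fin, pow_mul]; push_cast; rfl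
  have c1 : (Nat.card {p : (Fin n → κ) × (Fin m → κ) //
      ∑ i, Algebra.norm k ((p.2 + W p.1) i) = 0} : ℝ) =
      q ^ (2 * n) * Nat.card {x : Fin m → κ // ∑ i, Algebra.norm k (x i) = 0} := by
    let e : {p : (Fin n → κ) × (Fin m → κ) // ∑ i, Algebra.norm k ((p.2 + W p.1) i) = 0} ≃
        (Fin n → κ) × {x : Fin m → κ // ∑ i, Algebra.norm k (x i) = 0} :=
      { toFun := fun p => (p.1.1, ⟨p.1.2 + W p.1.1, p.2⟩)
        invFun := fun p => ⟨(p.1, p.2.1 - W p.1), by simpa using p.2.2⟩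
        left_inv := fun p => Subtype.ext (Prod.ext rfl (by simp))
        right_inv := fun p => Prod.ext rfl (Subtype.ext (by simp)) }
    rw [Nat.card_congr e, Nat.card_prod, Nat.cast_mul, hk]
  have hfib : ∀ x : Fin m → κ,
      (Nat.card {l : Fin n → κ // ∑ i, Algebra.norm k ((x + W l) i) = 0} : ℝ) =
      q ^ (2 * n) / q * (1 - if x ∈ orthTo (fun i => s ∘ v i) then 1 else 0) +
      q ^ (2 * n) * (if x ∈ orthTo (fun i => s ∘ v i) ∧ ∑ i, Algebra.norm k (x i) = 0
        then 1 else 0) := by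
    intro x
    simp only [sum_norm_add s h2 hs, hWW, add_zero, hxW]
    by_cases hx : x ∈ orthTo (fun i => s ∘ v i)
    · have hx' := (mem_orthTo _ _).1 hx
      simp only [hx', mul_zero, Finset.sum_const_zero, map_zero, add_zero, hx, true_and, if_true,
        sub_self, zero_add]
      split_ifs with h
      · simp only [h]
        rw [Nat.card_congr (Equiv.subtypeUnivEquiv fun _ => trivial), hk, mul_one]
      · simp [h]
    · simp only [hx, false_and, if_false, sub_zero, mul_one, mul_zero, add_zero]
      have hx' : ∃ i, (s ∘ v i) ⬝ᵥ x ≠ 0 := by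
        by_contra hc
        push Not at hc
        exact hx ((mem_orthTo _ _).2 hc)
      obtain ⟨i, hi⟩ := hx'
      let f : (Fin n → κ) →+ k :=
        { toFun := fun l => Algebra.trace k κ (∑ i, s (l i) * ((s ∘ v i) ⬝ᵥ x))
          map_zero' := by simp
          map_add' := fun a b => by
            simp only [Pi.add_apply, map_add, add_mul, Finset.sum_add_distrib] }
      have hf : Function.Surjective f := fun t => by
        obtain ⟨c, hc⟩ := trace_surjective_of_finrank_eq_two (κ := κ) h2 t
        refine ⟨Pi.single i (s (c / ((s ∘ v i) ⬝ᵥ x))), ?_⟩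
        change Algebra.trace k κ (∑ j, _) = t
        rw [Finset.sum_eq_single i]
        · rw [Pi.single_eq_same, involutive_of_ne_one s h2 hs, div_mul_cancel₀ _ hi, hc]
        · intro j _ hj
          rw [Pi.single_eq_of_ne hj, map_zero, zero_mul]
        · simp
      have := card_fiber_of_surjective f hf (-∑ i, Algebra.norm k (x i))
      rw [hk] at this
      rw [← this]
      congr 1
      refine Nat.card_congr (Equiv.subtypeEquivRight fun l => ?_)
      rw [eq_neg_iff_add_eq_zero, add_comm]
      rfl
  have c2 : (Nat.card {p : (Fin n → κ) × (Fin m → κ) //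
      ∑ i, Algebra.norm k ((p.2 + W p.1) i) = 0} : ℝ) =
      q ^ (2 * n) / q * (q ^ (2 * m) - q ^ (2 * (m - n))) + q ^ (2 * n) *
      Nat.card {x : Fin m → κ // x ∈ orthTo (fun i => s ∘ v i) ∧
        ∑ i, Algebra.norm k (x i) = 0} := by
    let e : {p : (Fin n → κ) × (Fin m → κ) // ∑ i, Algebra.norm k ((p.2 + W p.1) i) = 0} ≃
        Σ x : Fin m → κ, {l : Fin n → κ // ∑ i, Algebra.norm k ((x + W l) i) = 0} :=
      { toFun := fun p => ⟨p.1.2, p.1.1, p.2⟩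
        invFun := fun p => ⟨(p.2.1, p.1), p.2.2⟩
        left_inv := fun p => rfl
        right_inv := fun p => rfl }
    have hsv : LinearIndependent κ (fun i => s ∘ v i) := by
      have := hv.map_of_injective_injective (R' := κ) (s.symm : κ → κ) (M' := Fin m → κ)
        (AddMonoidHom.compLeft (s : κ →+ κ) (Fin m))
        (fun a ha => by simpa using ha)
        (fun f hf => by
          ext j
          have := congrFun hf j
          simpa using this)
        (fun r f => by ext j; simp)
      exact this
    have ho := card_orthTo hsv
    rw [card_quadratic_field h2, Nat.card_eq_fintype_card] at ho
    rw [Nat.card_congr e, Nat.card_sigma]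
    push_cast
    rw [Finset.sum_congr rfl (fun x _ => hfib x), Finset.sum_add_distrib, ← Finset.mul_sum,
      ← Finset.mul_sum, Finset.sum_sub_distrib, Finset.sum_boole, Finset.sum_boole,
      ← Fintype.card_subtype, ← Fintype.card_subtype, Finset.sum_const, Finset.card_univ,
      nsmul_eq_mul, hkm, mul_one, Nat.card_eq_fintype_card, pow_mul q 2 (m - n)]
    congr 3
    have ho' : (Fintype.card (orthTo (fun i => s ∘ v i)) : ℝ) = (q ^ 2) ^ (m - n) := by
      rw [ho]; push_cast; rfl
    rw [← ho']
  have c0 := card_isotropic (κ := κ) h2 m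
  rw [c2] at c1
  have hqn : q ^ (2 * n) ≠ 0 := pow_ne_zero _ hq0
  have h3 : q ^ (2 * n) * (q ^ (2 * m) - q ^ (2 * (m - n)) + q *
      Nat.card {x : Fin m → κ // x ∈ orthTo (fun i => s ∘ v i) ∧
        ∑ i, Algebra.norm k (x i) = 0}) = q ^ (2 * n) *
      (q * Nat.card {x : Fin m → κ // ∑ i, Algebra.norm k (x i) = 0}) := by
    linear_combination q * c1 - mul_div_cancel₀ (q ^ (2 * n)) hq0 *
      (q ^ (2 * m) - q ^ (2 * (m - n)))
  have h4 := mul_left_cancel₀ hqn h3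
  rw [c0] at h4
  linear_combination h4

/-- The number of linearly independent totally isotropic `n`-tuples in the standard hermitian space
of dimension `m`. -/
lemma card_hermitian_frames [Finite k] (m n : ℕ) :
    (Nat.card {v : Fin n → Fin m → κ // LinearIndependent κ v ∧
      ∀ i j, (s ∘ v i) ⬝ᵥ v j = 0} : ℝ) =
      ∏ i ∈ Finset.range n, (((Nat.card k : ℝ) ^ (2 * (m - i)) +
        (Nat.card k - 1) * (-(Nat.card k : ℝ)) ^ m) / Nat.card k - (Nat.card k : ℝ) ^ (2 * i)) := by
  have hq0 : (Nat.card k : ℝ) ≠ 0 := by exact_mod_cast Nat.card_pos.ne'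
  have hsym : ∀ x y : Fin m → κ, (s ∘ x) ⬝ᵥ y = 0 → (s ∘ y) ⬝ᵥ x = 0 := fun x y h => by
    have := congrArg s h
    simp only [dotProduct, map_sum, map_mul, map_zero, Function.comp,
      involutive_of_ne_one s h2 hs] at this ⊢
    rw [← this]
    exact Finset.sum_congr rfl fun i _ => mul_comm _ _
  have hN : ∀ x : Fin m → κ, (s ∘ x) ⬝ᵥ x = 0 ↔ ∑ i, Algebra.norm k (x i) = 0 := fun x => by
    rw [← algebraMap_sum_norm s h2 hs, map_eq_zero_iff _ (algebraMap k κ).injective]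
  refine card_tuples_eq_prod
    (fun n (v : Fin n → Fin m → κ) => LinearIndependent κ v ∧ ∀ i j, (s ∘ v i) ⬝ᵥ v j = 0)
    (fun n v x => x ∈ {x | x ∈ orthTo (fun i => s ∘ v i) ∧ ∑ i, Algebra.norm k (x i) = 0} ∧
      x ∉ (Submodule.span κ (Set.range v) : Set (Fin m → κ))) _
    (fun v => ⟨linearIndependent_empty_type, fun i => i.elim0⟩) (fun n v x => ?_)
    (fun n v hv => ?_) n
  · rw [linearIndependent_finSnoc, SetLike.mem_coe, Set.mem_ofPred_eq, mem_orthTo, ← hN,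
      forall_fin_snoc v x (fun a => ∀ j, (s ∘ a) ⬝ᵥ (Fin.snoc v x : Fin (n + 1) → Fin m → κ) j = 0),
      forall_fin_snoc v x (fun b => (s ∘ x) ⬝ᵥ b = 0)]
    simp only [fun i => forall_fin_snoc v x (fun b => (s ∘ v i) ⬝ᵥ b = 0), forall_and]
    constructor
    · rintro ⟨⟨h1, h2⟩, ⟨h3, h4⟩, -, h5⟩
      exact ⟨⟨h1, h3⟩, ⟨h4, h5⟩, h2⟩
    · rintro ⟨⟨h1, h3⟩, ⟨h4, h5⟩, h2⟩
      exact ⟨⟨h1, h2⟩, ⟨h3, h4⟩, fun i => hsym _ _ (h4 i), h5⟩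
  · rw [card_mem_and_notMem]
    · have h1 := card_span_eq_pow hv.1
      have h3 := card_isotropic_orthTo s h2 hs v hv.1 hv.2
      have h4 : Nat.card {x | x ∈ orthTo (fun i => s ∘ v i) ∧ ∑ i, Algebra.norm k (x i) = 0} =
        Nat.card {x // x ∈ orthTo (fun i => s ∘ v i) ∧ ∑ i, Algebra.norm k (x i) = 0} := rfl
      rw [mul_comm, ← eq_div_iff hq0] at h3
      simp only [SetLike.coe_sort_coe, h1, h4, h3, card_quadratic_field h2]
      push_cast
      ring
    · intro x hx
      have hx' : ∀ y, (∀ i, (s ∘ v i) ⬝ᵥ y = 0) → (s ∘ y) ⬝ᵥ x = 0 := by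
        intro y hy
        refine hsym _ _ ?_
        have : (Submodule.span κ (Set.range v)) ≤ orthTo (fun _ : Fin 1 => s ∘ y) := by
          refine Submodule.span_le.2 ?_
          rintro _ ⟨i, rfl⟩
          exact (mem_orthTo _ _).2 fun _ => hsym _ _ (hy i)
        exact hsym _ _ ((mem_orthTo _ _).1 (this hx) 0)
      have h1 : ∀ i, (s ∘ v i) ⬝ᵥ x = 0 := fun i => hx' _ fun j => hv.2 j i
      exact ⟨(mem_orthTo _ _).2 h1, (hN x).1 (hx' x h1)⟩

end

/-- The count of `card_hermitian_frames` for an involution of a finite field with `q ^ 2`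
elements. -/
lemma card_hermitian_frames_of_involution {κ : Type*} [Field κ] [Finite κ] (s : κ ≃+* κ)
    (hs : ∀ x, s (s x) = x) (hs1 : ∃ x, s x ≠ x) {q : ℕ} (hq : Nat.card κ = q ^ 2) (m n : ℕ) :
    (Nat.card {v : Fin n → Fin m → κ // LinearIndependent κ v ∧
      ∀ i j, (s ∘ v i) ⬝ᵥ v j = 0} : ℝ) =
      ∏ i ∈ Finset.range n, (((q : ℝ) ^ (2 * (m - i)) +
        (q - 1) * (-(q : ℝ)) ^ m) / q - (q : ℝ) ^ (2 * i)) := by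
  obtain ⟨y, hy⟩ := hs1
  have hs' : s ≠ 1 := fun h => hy (by rw [h]; rfl)
  have hord : orderOf s = 2 := orderOf_eq_prime (RingEquiv.ext fun x => by
    rw [pow_two]; exact hs x) hs'
  let G := Subgroup.zpowers s
  have : Finite G := Nat.finite_of_card_ne_zero (by
    rw [Nat.card_zpowers, hord]; norm_num)
  have := Fintype.ofFinite G
  let k := FixedPoints.subfield G κ
  have h2 : Module.finrank k κ = 2 := by
    rw [FixedPoints.finrank_eq_card, ← Nat.card_eq_fintype_card, Nat.card_zpowers, hord]
  let s' : κ ≃ₐ[k] κ := AlgEquiv.ofRingEquiv (f := s) (fun r => by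
    exact r.2 ⟨s, Subgroup.mem_zpowers s⟩)
  have hs'' : s' ≠ 1 := fun h => hy (by
    have := congrArg (fun f : κ ≃ₐ[k] κ => f y) h
    exact this)
  have hk : Nat.card k = q := by
    have := card_quadratic_field h2
    rw [hq] at this
    exact (Nat.pow_left_injective two_ne_zero this).symm
  have := card_hermitian_frames s' h2 hs'' m n
  rw [hk] at this
  exact this

end Hermitian

/-! ### Primitive matrices -/

section Primitive

/-- A matrix is primitive if it consists of the first columns of an invertible matrix. -/
def IsPrimitiveMatrix {A : Type*} [CommRing A] {m n : ℕ} (X : Matrix (Fin m) (Fin n) A) : Prop :=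
  ∃ (h : n ≤ m) (U : Matrix (Fin m) (Fin m) A), IsUnit U.det ∧ X = U.submatrix id (Fin.castLE h)

lemma mem_primMat_iff {O L : Type*} [CommRing O] [CommRing L] [Algebra O L] {m n : ℕ}
    (X : Matrix (Fin m) (Fin n) (IntRing O L)) : X ∈ primMat O L m n ↔ IsPrimitiveMatrix X := by
  constructor
  · rintro ⟨h, U, hU⟩
    exact ⟨h, U, (Matrix.isUnit_iff_isUnit_det _).1 U.isUnit, hU⟩
  · rintro ⟨h, U, hU, hX⟩
    obtain ⟨V, rfl⟩ := (Matrix.isUnit_iff_isUnit_det _).2 hU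
    exact ⟨h, V, hX⟩

variable {A B : Type*} [CommRing A] [CommRing B] {m n : ℕ}

lemma IsPrimitiveMatrix.map (f : A →+* B) {X : Matrix (Fin m) (Fin n) A}
    (hX : IsPrimitiveMatrix X) : IsPrimitiveMatrix (X.map f) := by
  obtain ⟨h, U, hU, rfl⟩ := hX
  refine ⟨h, U.map f, ?_, rfl⟩
  rw [← RingHom.mapMatrix_apply, ← RingHom.map_det]
  exact hU.map f

/-- Primitivity can be tested after a surjective local homomorphism: lift the remaining columns
arbitrarily. -/
lemma isPrimitiveMatrix_map_iff (f : A →+* B) [IsLocalHom f] (hf : Function.Surjective f)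
    (X : Matrix (Fin m) (Fin n) A) : IsPrimitiveMatrix (X.map f) ↔ IsPrimitiveMatrix X := by
  refine ⟨?_, fun h => h.map f⟩
  rintro ⟨h, U, hU, hX⟩
  choose g hg using hf
  let V : Matrix (Fin m) (Fin m) A := Matrix.of fun i j =>
    if hj : (j : ℕ) < n then X i ⟨j, hj⟩ else g (U i j)
  have hV : V.map f = U := by
    ext i j
    simp only [V, Matrix.map_apply, Matrix.of_apply]
    split_ifs with hj
    · have := congrFun (congrFun hX i) ⟨j, hj⟩
      exact this
    · exact hg _
  refine ⟨h, V, ?_, ?_⟩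
  · rw [← hV, ← RingHom.mapMatrix_apply, ← RingHom.map_det] at hU
    exact isUnit_of_map_unit f _ hU
  · ext i j
    simp [V]

lemma IsPrimitiveMatrix.exists_left_inverse {X : Matrix (Fin m) (Fin n) A}
    (hX : IsPrimitiveMatrix X) : ∃ Y : Matrix (Fin n) (Fin m) A, Y * X = 1 := by
  obtain ⟨h, U, hU, rfl⟩ := hX
  refine ⟨U⁻¹.submatrix (Fin.castLE h) id, ?_⟩
  rw [← Matrix.submatrix_mul U⁻¹ U (Fin.castLE h) id (Fin.castLE h) Function.bijective_id,
    Matrix.nonsing_inv_mul U hU, Matrix.submatrix_one _ (Fin.castLE_injective h)]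

lemma isPrimitiveMatrix_prod_iff (X : Matrix (Fin m) (Fin n) (A × B)) :
    IsPrimitiveMatrix X ↔ IsPrimitiveMatrix (X.map Prod.fst) ∧
      IsPrimitiveMatrix (X.map Prod.snd) := by
  constructor
  · exact fun h => ⟨h.map (RingHom.fst A B), h.map (RingHom.snd A B)⟩
  · rintro ⟨⟨h, U, hU, hX⟩, ⟨h', V, hV, hY⟩⟩
    let Z : Matrix (Fin m) (Fin m) (A × B) := Matrix.of fun i j => (U i j, V i j)
    refine ⟨h, Z, ?_, ?_⟩
    · rw [Prod.isUnit_iff]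
      have h1 : Z.det.1 = U.det := RingHom.map_det (RingHom.fst A B) Z
      have h2 : Z.det.2 = V.det := RingHom.map_det (RingHom.snd A B) Z
      rw [h1, h2]
      exact ⟨hU, hV⟩
    · ext i j
      · exact congrFun (congrFun hX i) j
      · exact congrFun (congrFun hY i) j

lemma isPrimitiveMatrix_iff_linearIndependent {k : Type*} [Field k]
    (X : Matrix (Fin m) (Fin n) k) : IsPrimitiveMatrix X ↔ LinearIndependent k Xᵀ := by
  constructor
  · rintro ⟨h, U, hU, rfl⟩
    have := Matrix.linearIndependent_cols_iff_isUnit.2 ((Matrix.isUnit_iff_isUnit_det _).2 hU)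
    exact this.comp _ (Fin.castLE_injective h)
  · intro hX
    have hnm : n ≤ m := by
      have := hX.fintype_card_le_finrank
      simpa using this
    obtain ⟨d, rfl⟩ := Nat.exists_eq_add_of_le hnm
    induction d generalizing n with
    | zero =>
      exact ⟨hnm, X, (Matrix.isUnit_iff_isUnit_det _).1
        (Matrix.linearIndependent_cols_iff_isUnit.1 hX), rfl⟩
    | succ d ih =>
      obtain ⟨x, hx⟩ := exists_linearIndependent_snoc_of_lt_finrank (v := Xᵀ) hX (by simp)
      have key : ∀ (m : ℕ) (hm : n + 1 + d = m) (X : Matrix (Fin m) (Fin (n + 1)) k),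
          LinearIndependent k Xᵀ → IsPrimitiveMatrix X := by
        rintro m rfl Y hY
        exact ih Y hY (by omega)
      obtain ⟨h, U, hU, hXU⟩ := key (n + (d + 1)) (by omega)
        (Matrix.of (Fin.snoc Xᵀ x : Fin (n + 1) → Fin (n + (d + 1)) → k))ᵀ hx
      refine ⟨hnm, U, hU, ?_⟩
      ext i j
      have h1 : (Fin.snoc Xᵀ x : Fin (n + 1) → Fin (n + (d + 1)) → k) j.castSucc = Xᵀ j :=
        Fin.snoc_castSucc (α := fun _ => Fin (n + (d + 1)) → k) _ _ _
      exact (congrFun h1 i).symm.trans (congrFun (congrFun hXU i) j.castSucc)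

end Primitive

/-! ### Counting classes in invariant sets -/

section Classes

/-- The number of cosets of `H` that are contained in `A`. -/
noncomputable def classCount {G : Type*} [AddCommGroup G] (H : AddSubgroup G) (A : Set G) : ℕ :=
  Nat.card {c : G ⧸ H // ∀ x : G, (x : G ⧸ H) = c → x ∈ A}

lemma classCount_eq_card {G T : Type*} [AddCommGroup G] [AddCommGroup T] {H : AddSubgroup G}
    (g : G →+ T) (hg : Function.Surjective g) (hH : ∀ x, g x = 0 ↔ x ∈ H) (A : Set G) (P : T → Prop)
    (hA : ∀ x, x ∈ A ↔ P (g x)) : classCount H A = Nat.card {t // P t} := by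
  have hker : g.ker = H := AddSubgroup.ext hH
  subst hker
  let e := QuotientAddGroup.quotientKerEquivOfSurjective g hg
  refine Nat.card_congr (e.toEquiv.subtypeEquiv fun c => ?_)
  induction c using QuotientAddGroup.induction_on with
  | H x =>
    have hex : e.toEquiv (x : G ⧸ g.ker) = g x := rfl
    rw [hex]
    constructor
    · intro h
      exact (hA x).1 (h x rfl)
    · intro h y hy
      rw [hA]
      have : g y = g x := congrArg e hy
      rwa [this]

/-- Passing from `H` to a smaller group `H'` in a count of approximate solutions of an equation.
`f` is approximately affine along `H`: modulo `T'` it changes by a homomorphism `φ x` that maps `H`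
onto `S`.  So every class modulo `H` of solutions modulo `S` contains `[H : H'] / [S : T']` classes
modulo `H'` of solutions modulo `T'`. -/
lemma classCount_mul_relIndex {G V : Type*} [AddCommGroup G] [AddCommGroup V]
    {H H' : AddSubgroup G} {S T' : AddSubgroup V} (hH : H' ≤ H) (hS : T' ≤ S)
    [Finite (G ⧸ H')] (hfin : T'.relIndex S ≠ 0)
    (P : G → Prop) (f : G → V) (φ : G → G →+ V)
    (hP : ∀ x, ∀ h ∈ H, P x → P (x + h))
    (hf : ∀ x, ∀ h ∈ H, f (x + h) - f x - φ x h ∈ T')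
    (hφS : ∀ x, ∀ h ∈ H, φ x h ∈ S) (hφT : ∀ x, ∀ h ∈ H', φ x h ∈ T')
    (hsurj : ∀ x, P x → ∀ s ∈ S, ∃ h ∈ H, φ x h - s ∈ T') :
    classCount H' {x | P x ∧ f x ∈ T'} * T'.relIndex S =
      classCount H {x | P x ∧ f x ∈ S} * H'.relIndex H := by
  classical
  let H0 : AddSubgroup H := H'.addSubgroupOf H
  let S0 : AddSubgroup S := T'.addSubgroupOf S
  have hfS : Finite (S ⧸ S0) := Nat.finite_of_card_ne_zero hfin
  let ι : H ⧸ H0 →+ G ⧸ H' := QuotientAddGroup.map H0 H' H.subtype (fun x hx => hx)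
  have hι : Function.Injective ι := by
    rw [injective_iff_map_eq_zero]
    intro c
    induction c using QuotientAddGroup.induction_on with
    | H x =>
      intro hc
      have : ((x : G) : G ⧸ H') = 0 := hc
      rw [QuotientAddGroup.eq_zero_iff] at this ⊢
      exact this
  have : Finite (H ⧸ H0) := Finite.of_injective ι hι
  -- the homomorphism induced by `φ x`
  let Φ : G → (H ⧸ H0 →+ S ⧸ S0) := fun x =>
    QuotientAddGroup.map H0 S0
      (((φ x).comp H.subtype).codRestrict S fun h => hφS x h h.2)
      (fun h hh => hφT x h hh)
  have hΦ : ∀ x, P x → Function.Surjective (Φ x) := by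
    intro x hx c
    induction c using QuotientAddGroup.induction_on with
    | H s =>
      obtain ⟨h, hh, hs⟩ := hsurj x hx s s.2
      refine ⟨((⟨h, hh⟩ : H) : H ⧸ H0), ?_⟩
      refine QuotientAddGroup.eq.2 ?_
      change -(φ x h) + (s : V) ∈ T'
      rw [← neg_mem_iff]
      convert hs using 1
      abel
  have hfH : ∀ x, ∀ h ∈ H, f (x + h) ∈ S ↔ f x ∈ S := by
    intro x h hh
    have h1 : f (x + h) = (f (x + h) - f x - φ x h + φ x h) + f x := by abel
    rw [h1, add_mem_cancel_left (add_mem (hS (hf x h hh)) (hφS x h hh))]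
  have hfH' : ∀ x, ∀ h ∈ H', f (x + h) ∈ T' ↔ f x ∈ T' := by
    intro x h hh
    have h1 : f (x + h) = (f (x + h) - f x - φ x h + φ x h) + f x := by abel
    rw [h1, add_mem_cancel_left (add_mem (hf x h (hH hh)) (hφT x h hh))]
  have hPi : ∀ x, ∀ h ∈ H, P (x + h) ↔ P x := fun x h hh => ⟨fun hx => by
    simpa using hP _ _ (neg_mem hh) hx, hP x h hh⟩
  -- the map on classes, and its fibres
  let C := {c : G ⧸ H // ∀ x : G, (x : G ⧸ H) = c → x ∈ {x | P x ∧ f x ∈ S}}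
  let C' := {c : G ⧸ H' // ∀ x : G, (x : G ⧸ H') = c → x ∈ {x | P x ∧ f x ∈ T'}}
  have hmem : ∀ x : G, (∀ y : G, (y : G ⧸ H) = x → y ∈ {x | P x ∧ f x ∈ S}) ↔ P x ∧ f x ∈ S := by
    refine fun x => ⟨fun h => h x rfl, fun h y hy => ?_⟩
    have hxy : -x + y ∈ H := QuotientAddGroup.eq.1 hy.symm
    have : y = x + (-x + y) := by abel
    rw [this]
    exact ⟨(hPi _ _ hxy).2 h.1, (hfH _ _ hxy).2 h.2⟩
  have hmem' : ∀ x : G,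
      (∀ y : G, (y : G ⧸ H') = x → y ∈ {x | P x ∧ f x ∈ T'}) ↔ P x ∧ f x ∈ T' := by
    refine fun x => ⟨fun h => h x rfl, fun h y hy => ?_⟩
    have hxy : -x + y ∈ H' := QuotientAddGroup.eq.1 hy.symm
    have : y = x + (-x + y) := by abel
    rw [this]
    exact ⟨(hPi _ _ (hH hxy)).2 h.1, (hfH' _ _ hxy).2 h.2⟩
  let p : G ⧸ H' →+ G ⧸ H := QuotientAddGroup.map H' H (AddMonoidHom.id G) hH
  have hp : Function.Surjective p := fun c => by
    induction c using QuotientAddGroup.induction_on with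
    | H x => exact ⟨(x : G ⧸ H'), rfl⟩
  have : Finite (G ⧸ H) := Finite.of_surjective p hp
  let r : C' → C := fun c => ⟨p c.1, by
    obtain ⟨c, hc⟩ := c
    induction c using QuotientAddGroup.induction_on with
    | H x =>
      have := (hmem' x).1 hc
      exact (hmem x).2 ⟨this.1, hS this.2⟩⟩
  have hfib : ∀ c : C, (Nat.card {c' : C' // r c' = c}) * Nat.card (S ⧸ S0) =
      Nat.card (H ⧸ H0) := by
    rintro ⟨c, hc⟩
    induction c using QuotientAddGroup.induction_on with
    | H x =>
      obtain ⟨hx, hfx⟩ := (hmem x).1 hc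
      have hcard := card_fiber_of_surjective (Φ x) (hΦ x hx)
        (((⟨-f x, neg_mem hfx⟩ : S) : S ⧸ S0))
      have key : ∀ h : H, Φ x (h : H ⧸ H0) = ((⟨-f x, neg_mem hfx⟩ : S) : S ⧸ S0) ↔
          f (x + h) ∈ T' := by
        intro h
        have : Φ x (h : H ⧸ H0) = ((⟨φ x h, hφS x h h.2⟩ : S) : S ⧸ S0) := rfl
        rw [this, QuotientAddGroup.eq]
        change -(φ x h) + -f x ∈ T' ↔ _
        rw [← neg_mem_iff]
        have h1 : f (x + h) = (f (x + h) - f x - φ x h) + -(-(φ x h) + -f x) := by abel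
        rw [h1, add_mem_cancel_left (hf x h h.2)]
      let e : {d : H ⧸ H0 // Φ x d = ((⟨-f x, neg_mem hfx⟩ : S) : S ⧸ S0)} ≃
          {c' : C' // r c' = ⟨(x : G ⧸ H), hc⟩} := by
        refine Equiv.ofBijective (fun d => ⟨⟨(x : G ⧸ H') + ι d.1, ?_⟩, ?_⟩) ⟨?_, ?_⟩
        · obtain ⟨d, hd⟩ := d
          induction d using QuotientAddGroup.induction_on with
          | H h => exact (hmem' (x + h)).2 ⟨(hPi _ _ h.2).2 hx, (key h).1 hd⟩
        · obtain ⟨d, hd⟩ := d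
          refine Subtype.ext ?_
          induction d using QuotientAddGroup.induction_on with
          | H h =>
            change ((x + h : G) : G ⧸ H) = x
            rw [QuotientAddGroup.eq]
            have : -(x + (h : G)) + x = -h := by abel
            rw [this]
            exact neg_mem h.2
        · intro d d' hdd
          have h1 := congrArg (fun z => z.1.1) hdd
          exact Subtype.ext (hι (add_left_cancel h1))
        · rintro ⟨⟨c', hc'⟩, hr⟩
          induction c' using QuotientAddGroup.induction_on with
          | H y =>
            have h1 : (y : G ⧸ H) = x := congrArg Subtype.val hr
            have h2 : -x + y ∈ H := QuotientAddGroup.eq.1 h1.symm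
            refine ⟨⟨((⟨-x + y, h2⟩ : H) : H ⧸ H0), ?_⟩, ?_⟩
            · rw [key]
              simpa using ((hmem' y).1 hc').2
            · refine Subtype.ext (Subtype.ext ?_)
              change ((x + (-x + y) : G) : G ⧸ H') = y
              rw [add_neg_cancel_left]
      rw [Nat.card_congr e] at hcard
      have h0 : (Nat.card (S ⧸ S0) : ℝ) ≠ 0 := by exact_mod_cast Nat.card_pos.ne'
      rw [eq_div_iff h0] at hcard
      exact_mod_cast hcard
  have := Fintype.ofFinite C
  have e1 : Nat.card C' = ∑ c : C, Nat.card {c' : C' // r c' = c} := by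
    rw [Nat.card_congr (Equiv.sigmaFiberEquiv r).symm, Nat.card_sigma]
  change Nat.card C' * Nat.card (S ⧸ S0) = Nat.card C * Nat.card (H ⧸ H0)
  rw [e1, Finset.sum_mul, Finset.sum_congr rfl (fun c _ => hfib c), Finset.sum_const,
    Finset.card_univ, smul_eq_mul, Nat.card_eq_fintype_card (α := C)]

end Classes

/-! ### Integral generators of quadratic algebras -/

section Generator

set_option linter.unusedSectionVars false

variable {O K L : Type*} [CommRing O] [IsDomain O] [IsDiscreteValuationRing O] [Field K]
  [Algebra O K] [IsFractionRing O K]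
  [CommRing L] [Algebra K L] [Algebra O L] [IsScalarTower O K L]

/-- `θ` generates the integral closure of `O` in the quadratic `K`-algebra `L` with involution `σ`:
`1, θ` is a `K`-basis of `L` and an `O`-basis of the integral closure, `θ` is a root of
`t ^ 2 - a t + b`, the other root is `σ θ`, and the discriminant of this polynomial is not `0`. -/
structure IsQuadGen (σ : L ≃ₐ[K] L) (θ : L) (a b : O) : Prop where
  sq : θ * θ = algebraMap O L a * θ - algebraMap O L b
  conj : σ θ = algebraMap O L a - θ
  repr : ∀ x : L, ∃ u v : K, x = algebraMap K L u + algebraMap K L v * θ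
  indep : ∀ u v : K, algebraMap K L u + algebraMap K L v * θ = 0 → u = 0 ∧ v = 0
  int : ∀ u v : K, algebraMap K L u + algebraMap K L v * θ ∈ integralClosure O L →
    u ∈ Set.range (algebraMap O K) ∧ v ∈ Set.range (algebraMap O K)
  disc : a ^ 2 - 4 * b ≠ 0

lemma sigma_mem_integralClosure (σ : L ≃ₐ[K] L) {x : L} (hx : x ∈ integralClosure O L) :
    σ x ∈ integralClosure O L :=
  IsIntegral.map (σ.toAlgHom.restrictScalars O) hx

lemma mem_range_of_algebraMap_mem [Nontrivial L] {u : K}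
    (h : algebraMap K L u ∈ integralClosure O L) : u ∈ Set.range (algebraMap O K) := by
  have h1 : IsIntegral O (algebraMap K L u) := h
  rw [isIntegral_algebraMap_iff (algebraMap K L).injective] at h1
  exact IsIntegrallyClosed.isIntegral_iff.1 h1

lemma algebraMap_mem_integralClosure (r : O) : algebraMap O L r ∈ integralClosure O L :=
  isIntegral_algebraMap

/-- The integral closure is generated by one element: `2 d v` is integral for every integral element
`u + v ω`, so these `v` form a fractional ideal of `O`, and an integral `u + v ω` whose `v` generates
this ideal can be taken as `θ`. -/
theorem exists_isQuadGen (σ : L ≃ₐ[K] L) (ω : L) (d : K) (h2 : (2 : K) ≠ 0) (hd : d ≠ 0)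
    (hω : ω * ω = algebraMap K L d) (hσ : σ ω = -ω)
    (hrepr : ∀ x : L, ∃ u v : K, x = algebraMap K L u + algebraMap K L v * ω)
    (hindep : ∀ u v : K, algebraMap K L u + algebraMap K L v * ω = 0 → u = 0 ∧ v = 0) :
    ∃ (θ : L) (a b : O), IsQuadGen σ θ a b := by
  -- after scaling, `ω` is integral
  wlog hdO : ∃ d' : O, algebraMap O K d' = d generalizing ω d
  · obtain ⟨⟨n, c⟩, hc⟩ := IsLocalization.surj (nonZeroDivisors O) d
    have hc0 : algebraMap O K c ≠ 0 := IsFractionRing.to_map_ne_zero_of_mem_nonZeroDivisors c.2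
    refine this (algebraMap K L (algebraMap O K c) * ω) (algebraMap O K c ^ 2 * d)
      (mul_ne_zero (pow_ne_zero _ hc0) hd) ?_ ?_ ?_ ?_ ⟨c * n, ?_⟩
    · rw [map_mul, ← hω, map_pow]; ring
    · rw [map_mul, AlgEquiv.commutes, hσ]; ring
    · intro x
      obtain ⟨u, v, rfl⟩ := hrepr x
      refine ⟨u, v / algebraMap O K c, ?_⟩
      rw [← mul_assoc, ← map_mul, div_mul_cancel₀ _ hc0]
    · intro u v h
      rw [← mul_assoc, ← map_mul] at h
      obtain ⟨h1, h2⟩ := hindep _ _ h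
      exact ⟨h1, (mul_eq_zero.1 h2).resolve_right hc0⟩
    · rw [map_mul, ← hc]; ring
  obtain ⟨d, rfl⟩ := hdO
  have hnt : Nontrivial L := by
    refine ⟨⟨0, 1, fun h => ?_⟩⟩
    have := hindep 1 0 (by rw [map_one, map_zero, zero_mul, add_zero, h])
    exact one_ne_zero this.1
  have hωint : ω ∈ integralClosure O L := by
    have : IsIntegral O (ω ^ 2) := by
      rw [pow_two, hω, ← IsScalarTower.algebraMap_apply]
      exact isIntegral_algebraMap
    exact this.of_pow two_pos
  set D : K := 2 * algebraMap O K d with hD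
  have hD0 : D ≠ 0 := mul_ne_zero h2 hd
  have hbound : ∀ u v : K, algebraMap K L u + algebraMap K L v * ω ∈ integralClosure O L →
      ∃ w : O, algebraMap O K w = D * v := by
    intro u v h
    apply mem_range_of_algebraMap_mem (L := L)
    have h1 := (integralClosure O L).mul_mem
      ((integralClosure O L).sub_mem h (sigma_mem_integralClosure σ h)) hωint
    convert h1 using 1
    simp only [map_add, map_mul, AlgEquiv.commutes, hσ, hD]
    rw [← hω]
    simp only [map_ofNat]
    ring
  let I : Ideal O :=
    { carrier := {w | ∃ u : K, algebraMap K L u + algebraMap K L (algebraMap O K w / D) * ω ∈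
        integralClosure O L}
      zero_mem' := ⟨0, by simp⟩
      add_mem' := by
        rintro w w' ⟨u, hu⟩ ⟨u', hu'⟩
        refine ⟨u + u', ?_⟩
        convert (integralClosure O L).add_mem hu hu' using 1
        rw [map_add, map_add, add_div, map_add]; ring
      smul_mem' := by
        rintro c w ⟨u, hu⟩
        refine ⟨algebraMap O K c * u, ?_⟩
        convert (integralClosure O L).mul_mem
          (algebraMap_mem_integralClosure (L := L) c) hu using 1
        rw [smul_eq_mul, map_mul, map_mul, mul_div_assoc, map_mul,
          ← IsScalarTower.algebraMap_apply O K L]; ring }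
  obtain ⟨g, hg⟩ := IsPrincipalIdealRing.principal I
  have hgI : g ∈ I := by rw [hg]; exact Submodule.mem_span_singleton_self g
  have hg0 : g ≠ 0 := by
    rintro rfl
    have h2d : 2 * d ∈ I := ⟨0, by
      have : algebraMap O K (2 * d) = D := by rw [hD, map_mul, map_ofNat]
      rw [this, div_self hD0]; simpa using hωint⟩
    rw [hg] at h2d
    have : 2 * d = 0 := by simpa using h2d
    apply hD0
    rw [hD, ← map_ofNat (algebraMap O K) 2, ← map_mul, this, map_zero]
  obtain ⟨u0, hu0⟩ := hgI
  have hgK : algebraMap O K g ≠ 0 := fun h => hg0 (IsFractionRing.injective O K (by simpa using h))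
  set v0 : K := algebraMap O K g / D with hv0
  have hv00 : v0 ≠ 0 := div_ne_zero hgK hD0
  set θ : L := algebraMap K L u0 + algebraMap K L v0 * ω with hθ
  have hσθ : σ θ = algebraMap K L u0 - algebraMap K L v0 * ω := by
    rw [hθ, map_add, map_mul, AlgEquiv.commutes, AlgEquiv.commutes, hσ]; ring
  obtain ⟨a, ha⟩ : ∃ a : O, algebraMap O K a = 2 * u0 := by
    apply mem_range_of_algebraMap_mem (L := L)
    convert (integralClosure O L).add_mem hu0 (sigma_mem_integralClosure σ hu0) using 1
    rw [hσθ, hθ, map_mul, map_ofNat]; ring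
  obtain ⟨b, hb⟩ : ∃ b : O, algebraMap O K b = u0 ^ 2 - v0 ^ 2 * algebraMap O K d := by
    apply mem_range_of_algebraMap_mem (L := L)
    convert (integralClosure O L).mul_mem hu0 (sigma_mem_integralClosure σ hu0) using 1
    rw [hσθ, hθ, map_sub, map_mul, ← hω]; simp only [map_pow]; ring
  refine ⟨θ, a, b, ?_, ?_, ?_, ?_, ?_, ?_⟩
  · rw [IsScalarTower.algebraMap_apply O K L, IsScalarTower.algebraMap_apply O K L b, ha, hb, hθ,
      map_sub, map_mul _ (v0 ^ 2), ← hω]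
    simp only [map_mul, map_pow, map_ofNat]
    ring
  · rw [hσθ, IsScalarTower.algebraMap_apply O K L, ha, hθ, map_mul, map_ofNat]; ring
  · intro x
    obtain ⟨u, v, rfl⟩ := hrepr x
    refine ⟨u - v / v0 * u0, v / v0, ?_⟩
    have : algebraMap K L v = algebraMap K L (v / v0) * algebraMap K L v0 := by
      rw [← map_mul, div_mul_cancel₀ _ hv00]
    rw [hθ, map_sub, map_mul, this]; ring
  · intro u v h
    have h1 : algebraMap K L (u + v * u0) + algebraMap K L (v * v0) * ω = 0 := by
      rw [← h, hθ]; simp only [map_add, map_mul]; ring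
    obtain ⟨h3, h4⟩ := hindep _ _ h1
    have hv := (mul_eq_zero.1 h4).resolve_right hv00
    exact ⟨by simpa [hv] using h3, hv⟩
  · intro u v h
    have h1 : algebraMap K L (u + v * u0) + algebraMap K L (v * v0) * ω ∈ integralClosure O L := by
      convert h using 1
      rw [hθ]; simp only [map_add, map_mul]; ring
    obtain ⟨w, hw⟩ := hbound _ _ h1
    have hwI : w ∈ I := ⟨u + v * u0, by
      rw [hw, mul_div_cancel_left₀ _ hD0]; exact h1⟩
    rw [hg] at hwI
    obtain ⟨r, hr⟩ := Submodule.mem_span_singleton.1 hwI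
    have hv : v = algebraMap O K r := by
      rw [← hr, smul_eq_mul, map_mul, hv0] at hw
      field_simp at hw
      exact hw.symm
    refine ⟨mem_range_of_algebraMap_mem (L := L) ?_, ⟨r, hv.symm⟩⟩
    have h5 := (integralClosure O L).sub_mem h ((integralClosure O L).mul_mem
      (algebraMap_mem_integralClosure (L := L) r) hu0)
    convert h5 using 1
    rw [hv, ← IsScalarTower.algebraMap_apply O K L]; ring
  · intro h
    have h1 := congrArg (algebraMap O K) h
    simp only [map_sub, map_pow, map_mul, map_ofNat, map_zero, ha, hb] at h1
    have h3 : (2 : K) ^ 2 * v0 ^ 2 * algebraMap O K d = 0 := by linear_combination h1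
    exact mul_ne_zero (mul_ne_zero (pow_ne_zero _ h2) (pow_ne_zero _ hv00)) hd h3

namespace IsQuadGen

variable {σ : L ≃ₐ[K] L} {θ : L} {a b : O} (h : IsQuadGen σ θ a b)
include h

lemma nontrivial : Nontrivial L :=
  ⟨⟨0, 1, fun h0 => one_ne_zero
    (h.indep 1 0 (by rw [map_one, map_zero, zero_mul, add_zero, h0])).1⟩⟩

lemma theta_mem : θ ∈ integralClosure O L := by
  refine ⟨Polynomial.X ^ 2 - Polynomial.C a * Polynomial.X + Polynomial.C b, ?_, ?_⟩
  · monicity!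
  · simp only [Polynomial.eval₂_add, Polynomial.eval₂_sub, Polynomial.eval₂_mul,
      Polynomial.eval₂_C, Polynomial.eval₂_X, pow_two, h.sq]
    ring

lemma involutive (x : L) : σ (σ x) = x := by
  obtain ⟨u, v, rfl⟩ := h.repr x
  simp only [map_add, map_mul, AlgEquiv.commutes, h.conj, map_sub]
  rw [IsScalarTower.algebraMap_apply O K L, AlgEquiv.commutes]
  ring

lemma coord_unique {u v u' v' : K} (heq : algebraMap K L u + algebraMap K L v * θ =
    algebraMap K L u' + algebraMap K L v' * θ) : u = u' ∧ v = v' := by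
  have := h.indep (u - u') (v - v') (by
    rw [map_sub, map_sub]; linear_combination heq)
  exact ⟨sub_eq_zero.1 this.1, sub_eq_zero.1 this.2⟩

lemma coord_unique_int {u v u' v' : O} (heq : algebraMap O L u + algebraMap O L v * θ =
    algebraMap O L u' + algebraMap O L v' * θ) : u = u' ∧ v = v' := by
  simp only [IsScalarTower.algebraMap_apply O K L] at heq
  have := h.coord_unique heq
  exact ⟨IsFractionRing.injective O K this.1, IsFractionRing.injective O K this.2⟩

lemma exists_coord {x : L} (hx : x ∈ integralClosure O L) :
    ∃ u v : O, x = algebraMap O L u + algebraMap O L v * θ := by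
  obtain ⟨u, v, rfl⟩ := h.repr x
  obtain ⟨⟨u, rfl⟩, ⟨v, rfl⟩⟩ := h.int u v hx
  exact ⟨u, v, by simp only [IsScalarTower.algebraMap_apply O K L]⟩

lemma mem_of_coord (u v : O) :
    algebraMap O L u + algebraMap O L v * θ ∈ integralClosure O L :=
  add_mem (algebraMap_mem_integralClosure u)
    (mul_mem (algebraMap_mem_integralClosure v) h.theta_mem)

lemma trace_norm (x : L) : algebraMap K L (Algebra.trace K L x) = x + σ x ∧
    algebraMap K L (Algebra.norm K x) = x * σ x := by
  obtain ⟨u, v, rfl⟩ := h.repr x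
  let B : Module.Basis (Fin 2) K L := Module.Basis.mk (v := ![1, θ])
    (by
      rw [LinearIndependent.pair_iff]
      intro s t hst
      refine h.indep s t ?_
      rw [← hst, Algebra.smul_def, Algebra.smul_def, mul_one])
    (by
      intro x _
      obtain ⟨u, v, rfl⟩ := h.repr x
      rw [Submodule.mem_span_range_iff_exists_fun]
      exact ⟨![u, v], by simp [Algebra.smul_def]⟩)
  have hB0 : B 0 = 1 := by simp [B]
  have hB1 : B 1 = θ := by simp [B]
  have hrep : ∀ s t : K, B.repr (algebraMap K L s + algebraMap K L t * θ) =
      Finsupp.single 0 s + Finsupp.single 1 t := by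
    intro s t
    have : algebraMap K L s + algebraMap K L t * θ = s • B 0 + t • B 1 := by
      rw [hB0, hB1, Algebra.smul_def, Algebra.smul_def, mul_one]
    rw [this, map_add, map_smul, map_smul, B.repr_self, B.repr_self]
    simp
  set x := algebraMap K L u + algebraMap K L v * θ with hx
  have hxθ : x * θ = algebraMap K L (-(v * algebraMap O K b)) +
      algebraMap K L (u + v * algebraMap O K a) * θ := by
    rw [hx]
    simp only [map_add, map_mul, map_neg, ← IsScalarTower.algebraMap_apply O K L]
    linear_combination algebraMap K L v * h.sq
  have hM : Algebra.leftMulMatrix B x =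
      !![u, -(v * algebraMap O K b); v, u + v * algebraMap O K a] := by
    ext i j
    rw [Algebra.leftMulMatrix_eq_repr_mul]
    fin_cases j
    · simp only [Fin.zero_eta, hB0, mul_one]
      rw [hx, hrep]
      fin_cases i <;> simp
    · simp only [Fin.mk_one, hB1, hxθ]
      rw [hrep]
      fin_cases i <;> simp
  rw [Algebra.trace_eq_matrix_trace B, Algebra.norm_eq_matrix_det B, hM, Matrix.trace_fin_two,
    Matrix.det_fin_two]
  simp only [hx, map_add, map_mul, AlgEquiv.commutes, h.conj, Matrix.of_apply, Matrix.cons_val,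
    map_sub, map_neg, ← IsScalarTower.algebraMap_apply O K L]
  constructor
  · ring
  · linear_combination (algebraMap K L v) ^ 2 * h.sq

lemma algebraMap_trace (x : L) : algebraMap K L (Algebra.trace K L x) = x + σ x :=
  (h.trace_norm x).1

lemma algebraMap_norm (x : L) : algebraMap K L (Algebra.norm K x) = x * σ x :=
  (h.trace_norm x).2

lemma delta_sq : (θ - σ θ) * (θ - σ θ) = algebraMap O L (a ^ 2 - 4 * b) := by
  rw [h.conj]
  simp only [map_sub, map_mul, map_pow, map_ofNat]
  linear_combination 4 * h.sq

lemma isUnit_delta : IsUnit (θ - σ θ) := by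
  have h1 : IsUnit (algebraMap O L (a ^ 2 - 4 * b)) := by
    rw [IsScalarTower.algebraMap_apply O K L]
    refine IsUnit.map _ (isUnit_iff_ne_zero.2 fun h0 => h.disc ?_)
    exact IsFractionRing.injective O K (by simpa using h0)
  rw [← h.delta_sq] at h1
  exact isUnit_of_mul_isUnit_left h1

lemma sigma_delta : σ (θ - σ θ) = -(θ - σ θ) := by
  rw [h.conj, map_sub, map_sub, IsScalarTower.algebraMap_apply O K L, AlgEquiv.commutes, h.conj,
    IsScalarTower.algebraMap_apply O K L]
  ring

/-- An element of `L` fixed by `σ` lies in `K`; this holds in every characteristic. -/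
lemma mem_range_of_sigma_eq {x : L} (hx : σ x = x) : x ∈ Set.range (algebraMap K L) := by
  obtain ⟨u, v, rfl⟩ := h.repr x
  simp only [map_add, map_mul, AlgEquiv.commutes] at hx
  have h1 : algebraMap K L v * (θ - σ θ) = 0 := by linear_combination -hx
  have h2 := h.isUnit_delta.mul_left_eq_zero.1 h1
  exact ⟨u, by rw [h2]; ring⟩

/-- The dual lattice of `O_E` for the trace form is generated by the inverse of `θ - σ θ`. -/
lemma mul_delta_mem_iff (x : L) : x * (θ - σ θ) ∈ integralClosure O L ↔
    ∀ y ∈ integralClosure O L, x * y + σ (x * y) ∈ integralClosure O L := by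
  constructor
  · intro hx y hy
    obtain ⟨u, v, huv⟩ := h.exists_coord (mul_mem hx hy)
    have h1 : (x * y + σ (x * y)) * (θ - σ θ) = algebraMap O L v * (θ - σ θ) := by
      have h2 := congrArg σ huv
      rw [map_mul, map_mul, h.sigma_delta] at h2
      rw [map_add, map_mul, IsScalarTower.algebraMap_apply O K L, AlgEquiv.commutes,
        IsScalarTower.algebraMap_apply O K L v, AlgEquiv.commutes] at h2
      simp only [IsScalarTower.algebraMap_apply O K L] at huv ⊢
      rw [map_mul]
      linear_combination huv - h2
    rw [h.isUnit_delta.mul_left_inj.1 h1]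
    exact algebraMap_mem_integralClosure _
  · intro hx
    have h1 := hx 1 (one_mem _)
    have h2 := hx θ h.theta_mem
    have h3 : x * (θ - σ θ) = (x * θ + σ (x * θ)) - (x * 1 + σ (x * 1)) * σ θ := by
      rw [map_mul, mul_one]; ring
    rw [h3]
    exact sub_mem h2 (mul_mem h1 (sigma_mem_integralClosure σ h.theta_mem))

lemma mem_invDifferent_iff (x : L) :
    x ∈ invDifferent O K L ↔ x * (θ - σ θ) ∈ integralClosure O L := by
  have := h.nontrivial
  rw [h.mul_delta_mem_iff]
  change (∀ y : IntRing O L, _) ↔ _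
  rw [Subtype.forall]
  refine forall₂_congr fun y hy => ?_
  rw [← h.algebraMap_trace]
  constructor
  · rintro ⟨r, hr⟩
    rw [← hr, ← IsScalarTower.algebraMap_apply O K L]
    exact algebraMap_mem_integralClosure _
  · exact fun h' => mem_range_of_algebraMap_mem h'

end IsQuadGen

end Generator

/-! ### Reduction of the ring of integers -/

section Reduction

set_option linter.unusedSectionVars false

variable {O K L : Type*} [CommRing O] [IsDomain O] [IsDiscreteValuationRing O] [Field K]
  [Algebra O K] [IsFractionRing O K]
  [CommRing L] [Algebra K L] [Algebra O L] [IsScalarTower O K L]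

/-- The involution of `O_E` induced by `σ`. -/
def sigmaInt (σ : L ≃ₐ[K] L) : IntRing O L →+* IntRing O L :=
  ((σ : L →+* L).comp (algebraMap (IntRing O L) L)).codRestrict (integralClosure O L)
    fun x => sigma_mem_integralClosure σ x.2

lemma sigmaInt_algebraMap (σ : L ≃ₐ[K] L) (r : O) :
    sigmaInt σ (algebraMap O (IntRing O L) r) = algebraMap O (IntRing O L) r := by
  refine Subtype.ext ?_
  change σ (algebraMap O L r) = algebraMap O L r
  rw [IsScalarTower.algebraMap_apply O K L, AlgEquiv.commutes]

namespace IsQuadGen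

variable {σ : L ≃ₐ[K] L} {θ : L} {a b : O} (h : IsQuadGen σ θ a b)
include h

/-- `θ` as an element of `O_E`. -/
def gen : IntRing O L := ⟨θ, h.theta_mem⟩

lemma exists_coord_int (x : IntRing O L) : ∃ p : O × O,
    x = algebraMap O _ p.1 + algebraMap O _ p.2 * h.gen := by
  obtain ⟨u, v, huv⟩ := h.exists_coord x.2
  exact ⟨(u, v), Subtype.ext huv⟩

/-- The coordinates with respect to the `O`-basis `1, θ` of `O_E`. -/
noncomputable def coord (x : IntRing O L) : O × O := (h.exists_coord_int x).choose

lemma eq_coord (x : IntRing O L) :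
    x = algebraMap O _ (h.coord x).1 + algebraMap O _ (h.coord x).2 * h.gen :=
  (h.exists_coord_int x).choose_spec

lemma coord_eq (u v : O) : h.coord (algebraMap O _ u + algebraMap O _ v * h.gen) = (u, v) := by
  have h1 := congrArg (algebraMap (IntRing O L) L)
    (h.eq_coord (algebraMap O _ u + algebraMap O _ v * h.gen))
  have h2 := h.coord_unique_int (u := u) (v := v) h1
  exact Prod.ext h2.1.symm h2.2.symm

lemma gen_sq : h.gen * h.gen = algebraMap O _ a * h.gen - algebraMap O _ b := Subtype.ext h.sq

lemma sigmaInt_gen : sigmaInt σ h.gen = algebraMap O _ a - h.gen := Subtype.ext h.conj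

lemma sigmaInt_sigmaInt (x : IntRing O L) : sigmaInt σ (sigmaInt σ x) = x :=
  Subtype.ext (h.involutive x)

/-- The ring homomorphism out of `O_E = O[θ]` that sends `θ` to a root `r` of `t ^ 2 - a t + b`. -/
noncomputable def lift {B : Type*} [CommRing B] (φ : O →+* B) (r : B)
    (hr : r * r = φ a * r - φ b) : IntRing O L →+* B where
  toFun x := φ (h.coord x).1 + φ (h.coord x).2 * r
  map_zero' := by
    have := h.coord_eq 0 0
    rw [map_zero, zero_mul, add_zero] at this
    rw [this]; simp
  map_one' := by
    have := h.coord_eq 1 0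
    rw [map_zero, map_one, zero_mul, add_zero] at this
    rw [this]; simp
  map_add' x y := by
    have h1 := h.coord_eq ((h.coord x).1 + (h.coord y).1) ((h.coord x).2 + (h.coord y).2)
    have h2 : algebraMap O (IntRing O L) ((h.coord x).1 + (h.coord y).1) +
      algebraMap O _ ((h.coord x).2 + (h.coord y).2) * h.gen = x + y := by
      conv_rhs => rw [h.eq_coord x, h.eq_coord y]
      rw [map_add, map_add]; ring
    rw [h2] at h1
    rw [h1]
    simp only [map_add]; ring
  map_mul' x y := by
    have h1 := h.coord_eq ((h.coord x).1 * (h.coord y).1 - (h.coord x).2 * (h.coord y).2 * b)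
      ((h.coord x).1 * (h.coord y).2 + (h.coord x).2 * (h.coord y).1 +
        (h.coord x).2 * (h.coord y).2 * a)
    have h2 : algebraMap O (IntRing O L) ((h.coord x).1 * (h.coord y).1 -
      (h.coord x).2 * (h.coord y).2 * b) + algebraMap O _ ((h.coord x).1 * (h.coord y).2 +
      (h.coord x).2 * (h.coord y).1 + (h.coord x).2 * (h.coord y).2 * a) * h.gen = x * y := by
      conv_rhs => rw [h.eq_coord x, h.eq_coord y]
      simp only [map_add, map_mul, map_sub]
      linear_combination (-(algebraMap O (IntRing O L) (h.coord x).2) *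
        algebraMap O (IntRing O L) (h.coord y).2) * h.gen_sq
    rw [h2] at h1
    rw [h1]
    simp only [map_add, map_mul, map_sub]
    linear_combination (-(φ (h.coord x).2) * φ (h.coord y).2) * hr

lemma lift_apply {B : Type*} [CommRing B] (φ : O →+* B) (r : B) (hr : r * r = φ a * r - φ b)
    (x : IntRing O L) : h.lift φ r hr x = φ (h.coord x).1 + φ (h.coord x).2 * r := rfl

lemma lift_algebraMap {B : Type*} [CommRing B] (φ : O →+* B) (r : B)
    (hr : r * r = φ a * r - φ b) (u : O) : h.lift φ r hr (algebraMap O _ u) = φ u := by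
  have := h.coord_eq u 0
  rw [map_zero, zero_mul, add_zero] at this
  rw [lift_apply, this]; simp

lemma lift_gen {B : Type*} [CommRing B] (φ : O →+* B) (r : B)
    (hr : r * r = φ a * r - φ b) : h.lift φ r hr h.gen = r := by
  have := h.coord_eq 0 1
  rw [map_zero, map_one, one_mul, zero_add] at this
  rw [lift_apply, this]; simp

/-- The norm form in coordinates. -/
lemma mul_sigmaInt (x : IntRing O L) : x * sigmaInt σ x = algebraMap O _
    ((h.coord x).1 ^ 2 + (h.coord x).1 * (h.coord x).2 * a + (h.coord x).2 ^ 2 * b) := by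
  conv_lhs => rw [h.eq_coord x]
  simp only [map_add, map_mul, sigmaInt_algebraMap, h.sigmaInt_gen, map_pow]
  linear_combination (-(algebraMap O (IntRing O L) (h.coord x).2) ^ 2) * h.gen_sq

lemma isUnit_of_norm {x : IntRing O L} {w : O} (hw : x * sigmaInt σ x = algebraMap O _ w)
    (hu : IsUnit w) : IsUnit x := by
  have := hu.map (algebraMap O (IntRing O L))
  rw [← hw] at this
  exact isUnit_of_mul_isUnit_left this

lemma algebraMap_int_injective : Function.Injective (algebraMap O (IntRing O L)) := by
  intro u v huv
  have h1 := h.coord_eq u 0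
  have h2 := h.coord_eq v 0
  rw [map_zero, zero_mul, add_zero] at h1 h2
  rw [huv, h2] at h1
  exact (congrArg Prod.fst h1).symm

lemma mem_map_ideal_iff (I : Ideal O) (x : IntRing O L) :
    x ∈ I.map (algebraMap O (IntRing O L)) ↔ (h.coord x).1 ∈ I ∧ (h.coord x).2 ∈ I := by
  constructor
  · intro hx
    obtain ⟨ϖ, hϖ⟩ := IsPrincipalIdealRing.principal I
    rw [hϖ, ← Ideal.span, Ideal.map_span, Set.image_singleton, Ideal.mem_span_singleton] at hx
    obtain ⟨y, rfl⟩ := hx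
    have h1 := h.coord_eq (ϖ * (h.coord y).1) (ϖ * (h.coord y).2)
    have h2 : algebraMap O (IntRing O L) (ϖ * (h.coord y).1) +
        algebraMap O _ (ϖ * (h.coord y).2) * h.gen = algebraMap O _ ϖ * y := by
      conv_rhs => rw [h.eq_coord y]
      simp only [map_mul]; ring
    rw [h2] at h1
    have hmem : ϖ ∈ I := by rw [hϖ]; exact Submodule.mem_span_singleton_self ϖ
    rw [h1]
    exact ⟨I.mul_mem_right _ hmem, I.mul_mem_right _ hmem⟩
  · rintro ⟨h1, h2⟩
    rw [h.eq_coord x]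
    exact add_mem (Ideal.mem_map_of_mem _ h1) (Ideal.mul_mem_right _ _ (Ideal.mem_map_of_mem _ h2))

/-- Change of the generator. -/
lemma change (u : O) {v : O} (hv : IsUnit v) :
    IsQuadGen σ (algebraMap O L u + algebraMap O L v * θ) (2 * u + v * a)
      (u ^ 2 + u * v * a + v ^ 2 * b) := by
  obtain ⟨v, rfl⟩ := hv
  have hvv : algebraMap O K (↑v⁻¹ : O) * algebraMap O K (v : O) = 1 := by
    rw [← map_mul, Units.inv_mul, map_one]
  have hvL : algebraMap O L (↑v⁻¹ : O) * algebraMap O L (v : O) = 1 := by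
    rw [← map_mul, Units.inv_mul, map_one]
  refine ⟨?_, ?_, fun x => ?_, fun s t hst => ?_, fun s t hst => ?_, ?_⟩
  · simp only [map_add, map_mul, map_pow, map_ofNat]
    linear_combination (algebraMap O L v) ^ 2 * h.sq
  · simp only [map_add, map_mul, map_ofNat, h.conj]
    rw [IsScalarTower.algebraMap_apply O K L, AlgEquiv.commutes,
      IsScalarTower.algebraMap_apply O K L v, AlgEquiv.commutes]
    ring
  · obtain ⟨s, t, rfl⟩ := h.repr x
    refine ⟨s - t * algebraMap O K (↑v⁻¹ : O) * algebraMap O K u,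
      t * algebraMap O K (↑v⁻¹ : O), ?_⟩
    simp only [map_sub, map_mul, ← IsScalarTower.algebraMap_apply O K L]
    linear_combination -(algebraMap K L t * θ) * hvL
  · have := h.indep (s + t * algebraMap O K u) (t * algebraMap O K v) (by
      rw [← hst]
      simp only [map_add, map_mul, ← IsScalarTower.algebraMap_apply O K L]; ring)
    have ht : t = 0 := by
      linear_combination (algebraMap O K (↑v⁻¹ : O)) * this.2 - t * hvv
    exact ⟨by simpa [ht] using this.1, ht⟩
  · obtain ⟨⟨s', hs⟩, ⟨t', ht⟩⟩ := h.int (s + t * algebraMap O K u) (t * algebraMap O K v) (by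
      convert hst using 1
      simp only [map_add, map_mul, ← IsScalarTower.algebraMap_apply O K L]; ring)
    have ht' : algebraMap O K (t' * (↑v⁻¹ : O)) = t := by
      rw [map_mul, ht]; linear_combination t * hvv
    refine ⟨⟨s' - t' * (↑v⁻¹ : O) * u, ?_⟩, ⟨_, ht'⟩⟩
    rw [map_sub, map_mul, ht', hs]; ring
  · intro h0
    have : (v : O) ^ 2 * (a ^ 2 - 4 * b) = 0 := by linear_combination h0
    exact h.disc (by simpa using this)

/-! ### The ramified case -/

/-- If the discriminant is not a unit, then there is a generator with an Eisenstein polynomial: the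
reduction of `t ^ 2 - a t + b` has a double root, which can be moved to `0`, and then `b` is a prime
element because `O_E` is integrally closed. -/
lemma exists_eisenstein [Finite (IsLocalRing.ResidueField O)]
    (hD : a ^ 2 - 4 * b ∈ IsLocalRing.maximalIdeal O) :
    ∃ (θ' : L) (a' b' : O), IsQuadGen σ θ' a' b' ∧ a' ∈ IsLocalRing.maximalIdeal O ∧
      Irreducible b' := by
  obtain ⟨ϖ, hϖ⟩ := IsDiscreteValuationRing.exists_irreducible O
  have hm := hϖ.maximalIdeal_eq
  let φ := IsLocalRing.residue O
  have hφ : ∀ x, φ x = 0 ↔ x ∈ IsLocalRing.maximalIdeal O := IsLocalRing.residue_eq_zero_iff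
  have hD' : φ a ^ 2 - 4 * φ b = 0 := by
    have := (hφ _).2 hD
    simpa only [map_sub, map_mul, map_pow, map_ofNat] using this
  obtain ⟨r, hr1, hr2⟩ : ∃ r, 2 * r = φ a ∧ r ^ 2 = φ b := by
    by_cases h2 : (2 : IsLocalRing.ResidueField O) = 0
    · have ha : φ a = 0 := by
        have h4 : (4 : IsLocalRing.ResidueField O) = 2 * 2 := by norm_num
        rw [h4, h2, zero_mul, zero_mul, sub_zero] at hD'
        exact pow_eq_zero_iff two_ne_zero |>.1 hD'
      have : CharP (IsLocalRing.ResidueField O) 2 := CharTwo.of_one_ne_zero_of_two_eq_zero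
        one_ne_zero h2
      obtain ⟨r, hr⟩ := surjective_frobenius (IsLocalRing.ResidueField O) 2 (φ b)
      exact ⟨r, by rw [h2, ha, zero_mul], hr⟩
    · refine ⟨φ a / 2, mul_div_cancel₀ _ h2, ?_⟩
      field_simp
      linear_combination hD'
  obtain ⟨c, rfl⟩ := IsLocalRing.residue_surjective r
  have h' := h.change (-c) isUnit_one
  have ha' : 2 * -c + 1 * a ∈ IsLocalRing.maximalIdeal O := by
    rw [← hφ]
    simp only [map_add, map_mul, map_neg, map_one, map_ofNat]
    linear_combination -hr1
  have hb' : (-c) ^ 2 + -c * 1 * a + 1 ^ 2 * b ∈ IsLocalRing.maximalIdeal O := by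
    rw [← hφ]
    simp only [map_add, map_mul, map_neg, map_one, map_pow]
    linear_combination φ c * hr1 - hr2
  refine ⟨_, _, _, h', ha', ?_⟩
  set θ' := algebraMap O L (-c) + algebraMap O L 1 * θ
  set a' := 2 * -c + 1 * a
  set b' := (-c) ^ 2 + -c * 1 * a + 1 ^ 2 * b
  rw [hm, Ideal.mem_span_singleton] at ha' hb'
  obtain ⟨a1, ha1⟩ := ha'
  obtain ⟨b1, hb1⟩ := hb'
  rw [hb1]
  refine (irreducible_mul_isUnit ?_).2 hϖ
  by_contra hb1u
  have : b1 ∈ IsLocalRing.maximalIdeal O := hb1u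
  rw [hm, Ideal.mem_span_singleton] at this
  obtain ⟨b2, hb2⟩ := this
  have hϖ0 : algebraMap O K ϖ ≠ 0 := fun h0 => hϖ.ne_zero
    (IsFractionRing.injective O K (by simpa using h0))
  have hcc : algebraMap K L (algebraMap O K ϖ)⁻¹ * algebraMap O L ϖ = 1 := by
    rw [IsScalarTower.algebraMap_apply O K L, ← map_mul, inv_mul_cancel₀ hϖ0, map_one]
  have hmem : algebraMap K L 0 + algebraMap K L (algebraMap O K ϖ)⁻¹ * θ' ∈
      integralClosure O L := by
    refine ⟨Polynomial.X ^ 2 - Polynomial.C a1 * Polynomial.X + Polynomial.C b2, ?_, ?_⟩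
    · monicity!
    · simp only [Polynomial.eval₂_add, Polynomial.eval₂_sub, Polynomial.eval₂_mul,
        Polynomial.eval₂_C, Polynomial.eval₂_X, pow_two, map_zero, zero_add]
      have h3 := h'.sq
      rw [hb1, hb2, ha1] at h3
      simp only [map_mul] at h3
      set y := algebraMap K L (algebraMap O K ϖ)⁻¹
      set p := algebraMap O L ϖ
      have hyp : y * p = 1 := hcc
      linear_combination y ^ 2 * h3 + (algebraMap O L a1 * (y * θ') -
        algebraMap O L b2 * (y * p + 1)) * hyp
  obtain ⟨-, ⟨w, hw⟩⟩ := h'.int _ _ hmem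
  apply hϖ.not_isUnit
  refine IsUnit.of_mul_eq_one w (IsFractionRing.injective O K ?_)
  rw [map_mul, hw, map_one, mul_inv_cancel₀ hϖ0]

section Eisenstein

variable (ha : a ∈ IsLocalRing.maximalIdeal O) (hb : Irreducible b)
include ha hb

lemma isUnit_iff_of_eisenstein (x : IntRing O L) :
    IsUnit x ↔ (h.coord x).1 ∉ IsLocalRing.maximalIdeal O := by
  have hbm : b ∈ IsLocalRing.maximalIdeal O := hb.not_isUnit
  constructor
  · intro hx hu
    have h1 : IsUnit (h.lift (IsLocalRing.residue O) 0 (by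
      rw [(IsLocalRing.residue_eq_zero_iff b).2 hbm]; simp) x) := hx.map _
    rw [lift_apply, mul_zero, add_zero, (IsLocalRing.residue_eq_zero_iff _).2 hu] at h1
    exact not_isUnit_zero h1
  · intro hu
    refine h.isUnit_of_norm (h.mul_sigmaInt x) ?_
    by_contra hn
    apply hu
    have h1 : (h.coord x).1 ^ 2 + (h.coord x).1 * (h.coord x).2 * a + (h.coord x).2 ^ 2 * b ∈
      IsLocalRing.maximalIdeal O := hn
    rw [add_assoc] at h1
    have h2 := (Ideal.add_mem_iff_left _ (add_mem (Ideal.mul_mem_left _ _ ha)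
      (Ideal.mul_mem_left _ ((h.coord x).2 ^ 2) hbm))).1 h1
    exact Ideal.IsPrime.mem_of_pow_mem inferInstance _ h2

lemma isLocalRing_of_eisenstein : IsLocalRing (IntRing O L) := by
  have hnt : Nontrivial (IntRing O L) := by
    have := h.nontrivial
    infer_instance
  refine IsLocalRing.of_nonunits_add fun x y hx hy => ?_
  simp only [mem_nonunits_iff, h.isUnit_iff_of_eisenstein ha hb, not_not] at hx hy ⊢
  have h1 := h.coord_eq ((h.coord x).1 + (h.coord y).1) ((h.coord x).2 + (h.coord y).2)
  have h2 : algebraMap O (IntRing O L) ((h.coord x).1 + (h.coord y).1) +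
    algebraMap O _ ((h.coord x).2 + (h.coord y).2) * h.gen = x + y := by
    conv_rhs => rw [h.eq_coord x, h.eq_coord y]
    rw [map_add, map_add]; ring
  rw [h2] at h1
  rw [h1]
  exact add_mem hx hy

lemma mem_primeQ_of_eisenstein (x : IntRing O L) :
    x ∈ primeQ O L ↔ (h.coord x).1 ∈ IsLocalRing.maximalIdeal O := by
  have := h.isLocalRing_of_eisenstein ha hb
  rw [primeQ, IsLocalRing.jacobson_eq_maximalIdeal _ bot_ne_top, IsLocalRing.mem_maximalIdeal,
    mem_nonunits_iff, h.isUnit_iff_of_eisenstein ha hb, not_not]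

/-- The conjugate of a prime element `θ` of `O_E` is `θ` times a unit. -/
lemma exists_sigmaInt_gen_eq : ∃ w : IntRing O L, IsUnit w ∧ sigmaInt σ h.gen = h.gen * w := by
  have hm := hb.maximalIdeal_eq
  have ha' := ha
  rw [hm, Ideal.mem_span_singleton] at ha'
  obtain ⟨a1, rfl⟩ := ha'
  refine ⟨algebraMap O _ (b * a1 * a1 - 1) + algebraMap O _ (-a1) * h.gen, ?_, ?_⟩
  · rw [h.isUnit_iff_of_eisenstein ha hb, h.coord_eq]
    intro h1
    have h2 : (1 : O) ∈ IsLocalRing.maximalIdeal O := by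
      have := sub_mem (Ideal.mul_mem_right a1 _ ha) h1
      rwa [sub_sub_cancel] at this
    exact h2 isUnit_one
  · rw [h.sigmaInt_gen]
    have hsq := h.gen_sq
    simp only [map_mul, map_sub, map_one, map_neg] at hsq ⊢
    linear_combination algebraMap O (IntRing O L) a1 * hsq

lemma primeQ_eq_span_of_eisenstein : primeQ O L = Ideal.span {h.gen} := by
  have hm := hb.maximalIdeal_eq
  ext x
  rw [h.mem_primeQ_of_eisenstein ha hb, Ideal.mem_span_singleton]
  constructor
  · intro hx
    rw [hm, Ideal.mem_span_singleton] at hx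
    obtain ⟨u1, hu1⟩ := hx
    rw [h.eq_coord x, hu1, map_mul]
    have hbb : algebraMap O (IntRing O L) b = h.gen * sigmaInt σ h.gen := by
      rw [h.sigmaInt_gen]; linear_combination h.gen_sq
    rw [hbb]
    exact dvd_add (Dvd.intro _ (by rw [mul_assoc])) (Dvd.intro_left _ rfl)
  · rintro ⟨y, rfl⟩
    by_contra hc
    have h1 := (h.isUnit_iff_of_eisenstein ha hb _).2 hc
    have h2 := isUnit_of_mul_isUnit_left h1
    rw [h.isUnit_iff_of_eisenstein ha hb] at h2
    have h3 := h.coord_eq 0 1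
    rw [map_zero, map_one, one_mul, zero_add] at h3
    rw [h3] at h2
    exact h2 (zero_mem _)

lemma not_dvd_norm_of_eisenstein {u v : O}
    (huv : ¬ (u ∈ IsLocalRing.maximalIdeal O ∧ v ∈ IsLocalRing.maximalIdeal O)) :
    ¬ b * b ∣ u ^ 2 + u * v * a + v ^ 2 * b := by
  have hbm : b ∈ IsLocalRing.maximalIdeal O := hb.not_isUnit
  rintro ⟨c, hc⟩
  have hu : u ∈ IsLocalRing.maximalIdeal O := by
    refine Ideal.IsPrime.mem_of_pow_mem inferInstance 2 ?_
    have : u ^ 2 = b * (b * c) - (u * v * a + v ^ 2 * b) := by linear_combination hc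
    rw [this]
    exact sub_mem (Ideal.mul_mem_right _ _ hbm)
      (add_mem (Ideal.mul_mem_left _ _ ha) (Ideal.mul_mem_left _ _ hbm))
  apply huv
  refine ⟨hu, ?_⟩
  have ha' := ha
  rw [hb.maximalIdeal_eq, Ideal.mem_span_singleton] at hu ha'
  obtain ⟨u, rfl⟩ := hu
  obtain ⟨a1, rfl⟩ := ha'
  have h1 : b * (b * (u ^ 2 + u * v * a1 - c) + v ^ 2) = 0 := by linear_combination hc
  have h2 := (mul_eq_zero.1 h1).resolve_left hb.ne_zero
  refine Ideal.IsPrime.mem_of_pow_mem inferInstance 2 ?_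
  have : v ^ 2 = -(b * (u ^ 2 + u * v * a1 - c)) := by linear_combination h2
  rw [this]
  exact neg_mem (Ideal.mul_mem_right _ _ hbm)

omit ha hb in
lemma exists_primitive_coord {x : L} (hx : x ≠ 0) : ∃ (c : K) (u v : O), c ≠ 0 ∧
    ¬ (u ∈ IsLocalRing.maximalIdeal O ∧ v ∈ IsLocalRing.maximalIdeal O) ∧
    x = algebraMap K L c * (algebraMap O L u + algebraMap O L v * θ) := by
  obtain ⟨s, t, rfl⟩ := h.repr x
  have h1m : (1 : O) ∉ IsLocalRing.maximalIdeal O := fun h1 => h1 isUnit_one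
  rcases eq_or_ne t 0 with rfl | ht
  · refine ⟨s, 1, 0, fun h0 => hx (by rw [h0, map_zero, zero_mul, add_zero]),
      fun hc => h1m hc.1, by simp⟩
  · rcases ValuationRing.isInteger_or_isInteger O (s / t) with ⟨w, hw⟩ | ⟨w, hw⟩
    · refine ⟨t, w, 1, ht, fun hc => h1m hc.2, ?_⟩
      rw [IsScalarTower.algebraMap_apply O K L w, hw, mul_add, ← map_mul, mul_div_cancel₀ _ ht,
        map_one, one_mul]
    · rcases eq_or_ne s 0 with rfl | hs
      · exact ⟨t, 0, 1, ht, fun hc => h1m hc.2, by simp⟩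
      · refine ⟨s, 1, w, hs, fun hc => h1m hc.1, ?_⟩
        rw [inv_div] at hw
        rw [IsScalarTower.algebraMap_apply O K L w, hw, mul_add, ← mul_assoc, ← map_mul,
          mul_div_cancel₀ _ hs, map_one, mul_one]

omit ha hb in
lemma norm_coord (u v : O) : algebraMap O L (u ^ 2 + u * v * a + v ^ 2 * b) =
    (algebraMap O L u + algebraMap O L v * θ) * (algebraMap O L u + algebraMap O L v * σ θ) := by
  rw [h.conj]
  simp only [map_add, map_mul, map_pow]
  linear_combination (algebraMap O L v) ^ 2 * h.sq

lemma isField_of_eisenstein : IsField L := by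
  have hnt := h.nontrivial
  refine ⟨exists_pair_ne L, mul_comm, fun {x} hx => ?_⟩
  obtain ⟨c, u, v, hc, huv, rfl⟩ := h.exists_primitive_coord hx
  have h1 : IsUnit (algebraMap O L (u ^ 2 + u * v * a + v ^ 2 * b)) := by
    rw [IsScalarTower.algebraMap_apply O K L]
    refine IsUnit.map _ (isUnit_iff_ne_zero.2 fun h0 =>
      h.not_dvd_norm_of_eisenstein ha hb huv ?_)
    have := IsFractionRing.injective O K (h0.trans (map_zero _).symm)
    rw [this]
    exact dvd_zero _
  rw [h.norm_coord] at h1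
  obtain ⟨y, hy⟩ := ((IsUnit.map (algebraMap K L) (isUnit_iff_ne_zero.2 hc)).mul
    (isUnit_of_mul_isUnit_left h1)).exists_right_inv
  exact ⟨y, hy⟩

lemma isRamifiedAlg_of_eisenstein : IsRamifiedAlg O L := by
  refine ⟨h.isField_of_eisenstein ha hb, ?_⟩
  rw [h.primeQ_eq_span_of_eisenstein ha hb, Ideal.span_singleton_pow, primeP, hb.maximalIdeal_eq,
    Ideal.map_span, Set.image_singleton]
  obtain ⟨w, hw, hw'⟩ := h.exists_sigmaInt_gen_eq ha hb
  have hbb : algebraMap O (IntRing O L) b = h.gen ^ 2 * w := by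
    have : h.gen * sigmaInt σ h.gen = algebraMap O _ b := by
      rw [h.sigmaInt_gen]; linear_combination -h.gen_sq
    rw [← this, hw']; ring
  rw [hbb, Ideal.span_singleton_mul_right_unit hw]

/-- An element of `L` whose norm is a prime element of `O` generates `O_E`. -/
lemma isQuadGen_of_norm_eq {ϖ : O} (hϖ : Irreducible ϖ) {y : L}
    (hy : Algebra.norm K y = algebraMap O K ϖ) :
    ∃ a' ∈ IsLocalRing.maximalIdeal O, IsQuadGen σ y a' ϖ := by
  have hnt := h.nontrivial
  have hbm : b ∈ IsLocalRing.maximalIdeal O := hb.not_isUnit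
  have hN := h.algebraMap_norm y
  rw [hy, ← IsScalarTower.algebraMap_apply] at hN
  -- `y` is integral, since otherwise its norm would not be integral
  have hint : y ∈ integralClosure O L := by
    have hy0 : y ≠ 0 := by
      rintro rfl
      rw [map_zero, mul_zero, IsScalarTower.algebraMap_apply O K L] at hN
      have := (algebraMap K L).injective (hN.trans (map_zero _).symm)
      exact hϖ.ne_zero (IsFractionRing.injective O K (this.trans (map_zero _).symm))
    obtain ⟨c, u, v, hc, huv, rfl⟩ := h.exists_primitive_coord hy0
    rcases ValuationRing.isInteger_or_isInteger O c with ⟨w, rfl⟩ | ⟨w, hw⟩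
    · rw [← IsScalarTower.algebraMap_apply]
      exact mul_mem (algebraMap_mem_integralClosure w) (h.mem_of_coord u v)
    · have hwc : algebraMap O L w * algebraMap K L c = 1 := by
        rw [IsScalarTower.algebraMap_apply O K L, hw, ← map_mul, inv_mul_cancel₀ hc, map_one]
      by_cases hwu : IsUnit w
      · obtain ⟨w', hw'⟩ := hwu.exists_right_inv
        have : algebraMap K L c = algebraMap O L w' := by
          have h3 := congrArg (algebraMap O L) hw'
          rw [map_mul, map_one] at h3
          linear_combination algebraMap O L w' * hwc - algebraMap K L c * h3
        rw [this]
        exact mul_mem (algebraMap_mem_integralClosure w') (h.mem_of_coord u v)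
      · exfalso
        have h3 : algebraMap O L (w ^ 2 * ϖ) =
            algebraMap O L (u ^ 2 + u * v * a + v ^ 2 * b) := by
          rw [h.norm_coord, map_mul, hN]
          simp only [map_mul, map_add, map_pow, AlgEquiv.commutes,
            IsScalarTower.algebraMap_apply O K L]
          simp only [IsScalarTower.algebraMap_apply O K L] at hwc
          set z := (algebraMap K L) (algebraMap O K u) + (algebraMap K L) (algebraMap O K v) * θ
          set z' := (algebraMap K L) (algebraMap O K u) + (algebraMap K L) (algebraMap O K v) * σ θ
          linear_combination (algebraMap K L (algebraMap O K w) * algebraMap K L c + 1) *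
            z * z' * hwc
        rw [IsScalarTower.algebraMap_apply O K L, IsScalarTower.algebraMap_apply O K L] at h3
        have h4 := IsFractionRing.injective O K ((algebraMap K L).injective h3)
        have hw' : w ∈ IsLocalRing.maximalIdeal O := hwu
        rw [hb.maximalIdeal_eq, Ideal.mem_span_singleton] at hw'
        apply h.not_dvd_norm_of_eisenstein ha hb huv
        rw [← h4]
        exact Dvd.dvd.mul_right (by rw [pow_two]; exact mul_dvd_mul hw' hw') _
  obtain ⟨u, v, rfl⟩ := h.exists_coord hint
  have hNϖ : u ^ 2 + u * v * a + v ^ 2 * b = ϖ := by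
    have h1 := h.mul_sigmaInt ⟨_, hint⟩
    have h2 : h.coord ⟨_, hint⟩ = (u, v) := h.coord_eq u v
    rw [h2] at h1
    apply h.algebraMap_int_injective
    rw [← h1]
    exact Subtype.ext hN.symm
  have hϖm : ϖ ∈ IsLocalRing.maximalIdeal O := hϖ.not_isUnit
  have hu : u ∈ IsLocalRing.maximalIdeal O := by
    refine Ideal.IsPrime.mem_of_pow_mem inferInstance 2 ?_
    have : u ^ 2 = ϖ - (u * v * a + v ^ 2 * b) := by linear_combination hNϖ
    rw [this]
    exact sub_mem hϖm (add_mem (Ideal.mul_mem_left _ _ ha) (Ideal.mul_mem_left _ _ hbm))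
  have hv : IsUnit v := by
    by_contra hv
    have hv' : v ∈ IsLocalRing.maximalIdeal O := hv
    rw [hϖ.maximalIdeal_eq, Ideal.mem_span_singleton] at hu hv'
    obtain ⟨u, rfl⟩ := hu
    obtain ⟨v, rfl⟩ := hv'
    refine hϖ.not_isUnit (IsUnit.of_mul_eq_one (u ^ 2 + u * v * a + v ^ 2 * b) ?_)
    refine mul_left_cancel₀ hϖ.ne_zero ?_
    linear_combination hNϖ
  refine ⟨2 * u + v * a, add_mem (Ideal.mul_mem_left _ _ hu) (Ideal.mul_mem_left _ _ ha), ?_⟩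
  rw [← hNϖ]
  exact h.change u hv

end Eisenstein

end IsQuadGen

end Reduction

/-! ### Lifting approximate solutions -/

section Lifting

variable {R : Type*} [CommRing R] (s : R →+* R)

/-- The conjugate transpose with respect to the ring homomorphism `s`. -/
def conjT {m n : ℕ} (X : Matrix (Fin m) (Fin n) R) : Matrix (Fin n) (Fin m) R := (X.map s)ᵀ

lemma conjT_mul {l m n : ℕ} (X : Matrix (Fin l) (Fin m) R) (Y : Matrix (Fin m) (Fin n) R) :
    conjT s (X * Y) = conjT s Y * conjT s X := by
  rw [conjT, Matrix.map_mul, Matrix.transpose_mul]; rfl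

lemma conjT_add {m n : ℕ} (X Y : Matrix (Fin m) (Fin n) R) :
    conjT s (X + Y) = conjT s X + conjT s Y := by
  ext; simp [conjT]

lemma conjT_sub {m n : ℕ} (X Y : Matrix (Fin m) (Fin n) R) :
    conjT s (X - Y) = conjT s X - conjT s Y := by
  ext; simp [conjT]

lemma conjT_smul {m n : ℕ} (t : R) (X : Matrix (Fin m) (Fin n) R) :
    conjT s (t • X) = s t • conjT s X := by
  ext; simp [conjT]

lemma conjT_conjT (hs : ∀ x, s (s x) = x) {m n : ℕ} (X : Matrix (Fin m) (Fin n) R) :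
    conjT s (conjT s X) = X := by
  ext; simp [conjT, hs]

/-- The matrices all of whose entries are multiples of `t`. -/
def multSub (t : R) (m n : ℕ) : AddSubgroup (Matrix (Fin m) (Fin n) R) :=
  (DistribSMul.toAddMonoidHom (Matrix (Fin m) (Fin n) R) t).range

lemma mem_multSub {t : R} {m n : ℕ} {X : Matrix (Fin m) (Fin n) R} :
    X ∈ multSub t m n ↔ ∃ Y, t • Y = X := Iff.rfl

/-- The skew-hermitian matrices `t Z - (t Z)^*`. -/
def skewSub (t : R) (n : ℕ) : AddSubgroup (Matrix (Fin n) (Fin n) R) :=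
  AddMonoidHom.range
    { toFun := fun Z => t • Z - conjT s (t • Z)
      map_zero' := by ext; simp [conjT]
      map_add' := fun Z W => by rw [smul_add, conjT_add]; abel }

lemma multSub_le {t t' : R} (ht : t ∣ t') (m n : ℕ) : multSub t' m n ≤ multSub t m n := by
  obtain ⟨c, rfl⟩ := ht
  rintro _ ⟨Y, rfl⟩
  exact ⟨c • Y, by simp [mul_smul]⟩

lemma skewSub_le {t t' : R} (ht : t ∣ t') (n : ℕ) : skewSub s t' n ≤ skewSub s t n := by
  obtain ⟨c, rfl⟩ := ht
  rintro _ ⟨Y, rfl⟩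
  exact ⟨c • Y, by simp [mul_smul]⟩

lemma IsPrimitiveMatrix.add_mem_multSub {t : R} (ht : t ∈ Ideal.jacobson (⊥ : Ideal R)) {m n : ℕ}
    {X h : Matrix (Fin m) (Fin n) R} (hX : IsPrimitiveMatrix X) (hh : h ∈ multSub t m n) :
    IsPrimitiveMatrix (X + h) := by
  obtain ⟨Y, rfl⟩ := hh
  have hle : Ideal.span {t} ≤ Ideal.jacobson (⊥ : Ideal R) := by
    rwa [Ideal.span_singleton_le_iff_mem]
  have : IsLocalHom (Ideal.Quotient.mk (Ideal.span {t})) := isLocalHom_of_le_jacobson_bot _ hle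
  rw [← isPrimitiveMatrix_map_iff (Ideal.Quotient.mk (Ideal.span {t}))
    Ideal.Quotient.mk_surjective] at hX ⊢
  convert hX using 1
  ext i j
  simp only [Matrix.map_apply]
  rw [Ideal.Quotient.eq, Ideal.mem_span_singleton]
  exact ⟨Y i j, by simp⟩

/-- The defect of the equation `X^* T X = C`. -/
def formDefect {m n : ℕ} (T : Matrix (Fin m) (Fin m) R) (C : Matrix (Fin n) (Fin n) R)
    (X : Matrix (Fin m) (Fin n) R) : Matrix (Fin n) (Fin n) R := conjT s X * T * X - C

/-- The linear part of the equation `X^* T X = C` at `X`. -/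
def formLinear {m n : ℕ} (T : Matrix (Fin m) (Fin m) R) (X : Matrix (Fin m) (Fin n) R) :
    Matrix (Fin m) (Fin n) R →+ Matrix (Fin n) (Fin n) R where
  toFun Y := conjT s X * T * Y - conjT s (conjT s X * T * Y)
  map_zero' := by ext; simp [conjT]
  map_add' Y Z := by rw [Matrix.mul_add, conjT_add]; abel

/-- Lifting primitive solutions of the skew-hermitian equation `X^* T X = C` from the modulus `t` to
the modulus `t'`, where `T` is invertible, `t ∣ t'` and `t'` divides the norm of `t`.  The linear part
at a primitive `X` is onto because `X^*` has a right inverse. -/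
theorem classCount_lift (hs : ∀ x, s (s x) = x) {m n : ℕ} {T : Matrix (Fin m) (Fin m) R}
    (hT : IsUnit T) (hT1 : T ∈ skewSub s 1 m) (C : Matrix (Fin n) (Fin n) R) {t t' r : R}
    (ht : t ∈ Ideal.jacobson (⊥ : Ideal R)) (htt' : t ∣ t') (hst' : s t' = t') (hsr : s r = r)
    (hr : s t * t = t' * r) [Finite (Matrix (Fin m) (Fin n) R ⧸ multSub t' m n)]
    (hfin : (skewSub s t' n).relIndex (skewSub s t n) ≠ 0) :
    classCount (multSub t' m n) {X | IsPrimitiveMatrix X ∧ formDefect s T C X ∈ skewSub s t' n} *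
      (skewSub s t' n).relIndex (skewSub s t n) =
    classCount (multSub t m n) {X | IsPrimitiveMatrix X ∧ formDefect s T C X ∈ skewSub s t n} *
      (multSub t' m n).relIndex (multSub t m n) := by
  obtain ⟨Z0, hZ0⟩ := hT1
  have hZ0' : Z0 - conjT s Z0 = T := by simpa using hZ0
  have hTs : conjT s T = -T := by
    rw [← hZ0', conjT_sub, conjT_conjT s hs]; abel
  have hφ : ∀ (u : R) (X : Matrix (Fin m) (Fin n) R), ∀ h ∈ multSub u m n,
      formLinear s T X h ∈ skewSub s u n := by
    rintro u X _ ⟨Y, rfl⟩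
    refine ⟨conjT s X * T * Y, ?_⟩
    simp [formLinear]
  refine classCount_mul_relIndex (multSub_le htt' m n) (skewSub_le s htt' n) hfin
    IsPrimitiveMatrix (formDefect s T C) (formLinear s T)
    (fun X h hh hX => hX.add_mem_multSub ht hh) ?_ (hφ t) (hφ t') ?_
  · rintro X _ ⟨Y, rfl⟩
    refine ⟨r • (conjT s Y * Z0 * Y), ?_⟩
    have h1 : formDefect s T C (X + t • Y) - formDefect s T C X - formLinear s T X (t • Y) =
        (s t * t) • (conjT s Y * T * Y) := by
      change (_ - C) - (_ - C) - (_ - _) = _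
      rw [conjT_mul, conjT_mul, conjT_conjT s hs, hTs, conjT_add, conjT_smul]
      simp only [Matrix.mul_add, Matrix.add_mul, Matrix.smul_mul, Matrix.mul_smul, Matrix.mul_neg,
        Matrix.neg_mul, mul_smul, ← Matrix.mul_assoc, smul_add]
      rw [smul_comm t (s t)]
      abel
    refine Eq.trans ?_ h1.symm
    change t' • r • _ - conjT s (t' • r • _) = _
    rw [hr, conjT_smul, conjT_smul, hst', hsr, conjT_mul, conjT_mul, conjT_conjT s hs, ← hZ0',
      mul_smul, ← smul_sub, ← smul_sub, Matrix.mul_sub, Matrix.sub_mul]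
    simp only [Matrix.mul_assoc]
  · rintro X hX _ ⟨Z, rfl⟩
    obtain ⟨Y, hY⟩ := hX.exists_left_inverse
    obtain ⟨V, hV⟩ := hT.exists_right_inv
    refine ⟨t • (V * conjT s Y * Z), ⟨_, rfl⟩, ?_⟩
    have h1 : conjT s X * T * (V * conjT s Y * Z) = Z := by
      have h2 : conjT s X * conjT s Y = 1 := by
        rw [← conjT_mul, hY]
        ext i j
        simp [conjT, Matrix.one_apply, eq_comm]
      calc conjT s X * T * (V * conjT s Y * Z)
          = conjT s X * (T * V) * conjT s Y * Z := by simp only [Matrix.mul_assoc]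
        _ = Z := by rw [hV, Matrix.mul_one, h2, Matrix.one_mul]
    have h3 : formLinear s T X (t • (V * conjT s Y * Z)) = t • Z - conjT s (t • Z) := by
      change conjT s X * T * (t • (V * conjT s Y * Z)) -
        conjT s (conjT s X * T * (t • (V * conjT s Y * Z))) = _
      rw [Matrix.mul_smul, h1]
    rw [h3]
    change (t • Z - conjT s (t • Z)) - (t • Z - conjT s (t • Z)) ∈ _
    rw [sub_self]
    exact zero_mem _

lemma multSub_one (m n : ℕ) : multSub (1 : R) m n = ⊤ :=
  top_unique fun X _ => ⟨X, one_smul _ _⟩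

lemma smul_matrix_injective {t : R} (ht : t ∈ nonZeroDivisors R) (m n : ℕ) :
    Function.Injective (DistribSMul.toAddMonoidHom (Matrix (Fin m) (Fin n) R) t) := by
  intro X Y hXY
  ext i j
  have := congrFun (congrFun hXY i) j
  exact mul_cancel_left_mem_nonZeroDivisors ht |>.1 this

lemma relIndex_multSub_mul {t u : R} (hu : u ∈ nonZeroDivisors R) (m n : ℕ) :
    (multSub (u * t) m n).relIndex (multSub u m n) = (multSub t m n).index := by
  have h1 : multSub (u * t) m n =
      (multSub t m n).map (DistribSMul.toAddMonoidHom (Matrix (Fin m) (Fin n) R) u) := by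
    ext X
    constructor
    · rintro ⟨Y, rfl⟩
      exact ⟨t • Y, ⟨Y, rfl⟩, by simp [mul_smul]⟩
    · rintro ⟨_, ⟨Y, rfl⟩, rfl⟩
      exact ⟨Y, by simp [mul_smul]⟩
  have h2 : multSub u m n =
      (⊤ : AddSubgroup (Matrix (Fin m) (Fin n) R)).map
        (DistribSMul.toAddMonoidHom (Matrix (Fin m) (Fin n) R) u) := by
    rw [← AddMonoidHom.range_eq_map]; rfl
  rw [h1, h2, AddSubgroup.relIndex_map_map_of_injective _ _ (smul_matrix_injective hu m n),
    AddSubgroup.relIndex_top_right]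

lemma relIndex_skewSub_mul {t u : R} (hu : u ∈ nonZeroDivisors R) (hsu : s u = u) (n : ℕ) :
    (skewSub s (u * t) n).relIndex (skewSub s u n) =
      (skewSub s t n).relIndex (skewSub s 1 n) := by
  have h1 : ∀ t, skewSub s (u * t) n =
      (skewSub s t n).map (DistribSMul.toAddMonoidHom (Matrix (Fin n) (Fin n) R) u) := by
    intro t
    ext X
    constructor
    · rintro ⟨Y, rfl⟩
      refine ⟨_, ⟨Y, rfl⟩, ?_⟩
      simp [mul_smul, conjT_smul, hsu, smul_sub]
    · rintro ⟨_, ⟨Y, rfl⟩, rfl⟩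
      refine ⟨Y, ?_⟩
      simp [mul_smul, conjT_smul, hsu, smul_sub]
  rw [h1 t]
  conv_lhs => rw [← mul_one u, h1 1, mul_one]
  exact AddSubgroup.relIndex_map_map_of_injective _ _ (smul_matrix_injective hu n n)

end Lifting

/-! ### Indices of lattices -/

section Indices

set_option linter.unusedSectionVars false

lemma index_eq_card_of_surjective {G T : Type*} [AddCommGroup G] [AddCommGroup T]
    {H : AddSubgroup G} (g : G →+ T) (hg : Function.Surjective g) (hH : ∀ x, g x = 0 ↔ x ∈ H) :
    H.index = Nat.card T := by
  have hker : g.ker = H := AddSubgroup.ext hH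
  rw [← hker, AddSubgroup.index_ker, AddMonoidHom.range_eq_top.2 hg]
  exact Nat.card_congr AddSubgroup.topEquiv.toEquiv

lemma index_multSub {R A : Type*} [CommRing R] [AddCommGroup A] (t : R) (g : R →+ A)
    (hg : Function.Surjective g) (hker : ∀ x, g x = 0 ↔ t ∣ x) (m n : ℕ) :
    (multSub t m n).index = Nat.card A ^ (m * n) := by
  rw [index_eq_card_of_surjective (T := Fin m → Fin n → A)
    ({ toFun := fun X i j => g (X i j)
       map_zero' := by ext; simp
       map_add' := fun X Y => by ext; simp } : Matrix (Fin m) (Fin n) R →+ _)]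
  · rw [Nat.card_fun, Nat.card_fun]
    simp only [Nat.card_eq_fintype_card (α := Fin _), Fintype.card_fin]
    rw [← pow_mul, mul_comm]
  · intro Y
    choose f hf using hg
    exact ⟨fun i j => f (Y i j), by ext i j; exact hf _⟩
  · intro X
    constructor
    · intro hX
      have h1 : ∀ i j, ∃ y, X i j = t * y := fun i j =>
        (hker _).1 (congrFun (congrFun hX i) j)
      choose Y hY using h1
      exact ⟨Y, by ext i j; exact (hY i j).symm⟩
    · rintro ⟨Y, rfl⟩
      ext i j
      exact (hker _).2 ⟨Y i j, rfl⟩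

/-- For `t` dividing `s t`, the lattice of the `t Z - (t Z)^*` is cut out by one condition per entry on
and above the diagonal. -/
lemma mem_skewSub_iff {R : Type*} [CommRing R] (s : R →+* R) (hs : ∀ x, s (s x) = x) {t : R}
    (ht : t ∣ s t) {n : ℕ} (C : Matrix (Fin n) (Fin n) R) :
    C ∈ skewSub s t n ↔ (∀ i j, s (C j i) = -C i j) ∧ (∀ i j, i < j → t ∣ C i j) ∧
      ∀ i, ∃ z, C i i = t * z - s (t * z) := by
  constructor
  · rintro ⟨Z, rfl⟩
    refine ⟨fun i j => ?_, fun i j hij => ?_, fun i => ⟨Z i i, rfl⟩⟩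
    · change s (t * Z j i - s (t * Z i j)) = -(t * Z i j - s (t * Z j i))
      rw [map_sub, hs]; ring
    · change t ∣ t * Z i j - s (t * Z j i)
      rw [map_mul]
      exact dvd_sub (Dvd.intro _ rfl) (Dvd.dvd.mul_right ht _)
  · rintro ⟨h1, h2, h3⟩
    choose f hf using h2
    choose g hg using h3
    refine ⟨Matrix.of fun i j => if hij : i < j then f i j hij else if i = j then g i else 0, ?_⟩
    ext i j
    change t * (if hij : i < j then f i j hij else if i = j then g i else 0) -
      s (t * (if hij : j < i then f j i hij else if j = i then g j else 0)) = C i j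
    rcases lt_trichotomy i j with hij | rfl | hij
    · rw [dif_pos hij, dif_neg hij.not_gt, if_neg hij.ne', mul_zero, map_zero, sub_zero, hf]
    · simp [hg, map_mul]
    · rw [dif_neg hij.not_gt, if_neg hij.ne', dif_pos hij, mul_zero, zero_sub, ← hf, h1, neg_neg]

variable {O K L : Type*} [CommRing O] [IsDomain O] [IsDiscreteValuationRing O] [Field K]
  [Algebra O K] [IsFractionRing O K]
  [CommRing L] [Algebra K L] [Algebra O L] [IsScalarTower O K L]

namespace IsQuadGen

variable {σ : L ≃ₐ[K] L} {θ : L} {a b : O} (h : IsQuadGen σ θ a b)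
include h

lemma coord_add (x y : IntRing O L) : h.coord (x + y) = h.coord x + h.coord y := by
  have h1 := h.coord_eq ((h.coord x).1 + (h.coord y).1) ((h.coord x).2 + (h.coord y).2)
  have h2 : algebraMap O (IntRing O L) ((h.coord x).1 + (h.coord y).1) +
    algebraMap O _ ((h.coord x).2 + (h.coord y).2) * h.gen = x + y := by
    conv_rhs => rw [h.eq_coord x, h.eq_coord y]
    rw [map_add, map_add]; ring
  rw [h2] at h1
  exact h1

lemma dvd_iff {ϖ : O} (hϖ : Irreducible ϖ) (x : IntRing O L) :
    algebraMap O _ ϖ ∣ x ↔ (h.coord x).1 ∈ IsLocalRing.maximalIdeal O ∧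
      (h.coord x).2 ∈ IsLocalRing.maximalIdeal O := by
  rw [← h.mem_map_ideal_iff, hϖ.maximalIdeal_eq, Ideal.map_span, Set.image_singleton,
    Ideal.mem_span_singleton]

lemma gen_dvd_iff (ha : a ∈ IsLocalRing.maximalIdeal O) (hb : Irreducible b) (x : IntRing O L) :
    h.gen ∣ x ↔ (h.coord x).1 ∈ IsLocalRing.maximalIdeal O := by
  rw [← h.mem_primeQ_of_eisenstein ha hb, h.primeQ_eq_span_of_eisenstein ha hb,
    Ideal.mem_span_singleton]

lemma exists_reduction {ϖ : O} (hϖ : Irreducible ϖ) :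
    ∃ g : IntRing O L →+ IsLocalRing.ResidueField O × IsLocalRing.ResidueField O,
      Function.Surjective g ∧ ∀ x, g x = 0 ↔ algebraMap O _ ϖ ∣ x := by
  refine ⟨{ toFun := fun x => (IsLocalRing.residue O (h.coord x).1,
              IsLocalRing.residue O (h.coord x).2)
            map_zero' := ?_
            map_add' := fun x y => by simp [h.coord_add] }, fun y => ?_, fun x => ?_⟩
  · have := h.coord_eq 0 0
    rw [map_zero, zero_mul, add_zero] at this
    simp [this]
  · obtain ⟨u, hu⟩ := IsLocalRing.residue_surjective y.1
    obtain ⟨v, hv⟩ := IsLocalRing.residue_surjective y.2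
    refine ⟨algebraMap O _ u + algebraMap O _ v * h.gen, ?_⟩
    change (_, _) = _
    rw [h.coord_eq, hu, hv]
  · rw [h.dvd_iff hϖ]
    change (_, _) = _ ↔ _
    rw [Prod.mk_eq_zero, IsLocalRing.residue_eq_zero_iff, IsLocalRing.residue_eq_zero_iff]

lemma index_multSub_prime {ϖ : O} (hϖ : Irreducible ϖ) (m n : ℕ) :
    (multSub (algebraMap O (IntRing O L) ϖ) m n).index = residueCard O ^ (2 * (m * n)) := by
  obtain ⟨g, hg, hker⟩ := h.exists_reduction hϖ
  rw [index_multSub _ g hg hker, Nat.card_prod, pow_mul _ 2, ← pow_two]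
  rfl

omit h in
lemma zero_isRoot (hb : Irreducible b) : (0 : IsLocalRing.ResidueField O) * 0 =
    IsLocalRing.residue O a * 0 - IsLocalRing.residue O b := by
  rw [(IsLocalRing.residue_eq_zero_iff b).2 hb.not_isUnit]; simp

/-- Reduction modulo the prime element `θ` of `O_E`, if `θ` has an Eisenstein polynomial. -/
noncomputable def reduceGen (hb : Irreducible b) : IntRing O L →+* IsLocalRing.ResidueField O :=
  h.lift (IsLocalRing.residue O) 0 (zero_isRoot hb)

lemma reduceGen_eq (hb : Irreducible b) (x : IntRing O L) :
    h.reduceGen hb x = IsLocalRing.residue O (h.coord x).1 := by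
  rw [reduceGen, lift_apply, mul_zero, add_zero]

lemma reduceGen_algebraMap (hb : Irreducible b) (u : O) :
    h.reduceGen hb (algebraMap O _ u) = IsLocalRing.residue O u := h.lift_algebraMap _ _ _ u

lemma reduceGen_surjective (hb : Irreducible b) : Function.Surjective (h.reduceGen hb) := by
  intro y
  obtain ⟨u, hu⟩ := IsLocalRing.residue_surjective y
  exact ⟨algebraMap O _ u, (h.reduceGen_algebraMap hb u).trans hu⟩

lemma reduceGen_eq_zero_iff (ha : a ∈ IsLocalRing.maximalIdeal O) (hb : Irreducible b)
    (x : IntRing O L) : h.reduceGen hb x = 0 ↔ h.gen ∣ x := by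
  rw [h.gen_dvd_iff ha hb, reduceGen_eq, IsLocalRing.residue_eq_zero_iff]

lemma index_multSub_gen (ha : a ∈ IsLocalRing.maximalIdeal O) (hb : Irreducible b) (m n : ℕ) :
    (multSub h.gen m n).index = residueCard O ^ (m * n) :=
  index_multSub _ (h.reduceGen hb).toAddMonoidHom (h.reduceGen_surjective hb)
    (h.reduceGen_eq_zero_iff ha hb) m n

/-- The square root `θ - σ θ` of the discriminant, as an element of `O_E`. -/
def delta : IntRing O L := h.gen - sigmaInt σ h.gen

lemma sub_sigmaInt (z : IntRing O L) :
    z - sigmaInt σ z = algebraMap O _ (h.coord z).2 * h.delta := by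
  conv_lhs => rw [h.eq_coord z]
  rw [map_add, map_mul, sigmaInt_algebraMap, sigmaInt_algebraMap, delta]; ring

lemma mul_delta_cancel {x y : IntRing O L} (hxy : x * h.delta = y * h.delta) : x = y := by
  apply Subtype.ext
  have h1 := congrArg (algebraMap (IntRing O L) L) hxy
  exact h.isUnit_delta.mul_left_inj.1 h1

lemma sigmaInt_delta : sigmaInt σ h.delta = -h.delta := by
  rw [delta, map_sub, h.sigmaInt_sigmaInt]; ring

/-- The coordinates of the lattice of skew-hermitian matrices `Z - Z^*`: the entries above the
diagonal are arbitrary, and those on the diagonal are multiples of `θ - σ θ`. -/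
def skewParam (n : ℕ) : (Fin n → Fin n → O) →+ Matrix (Fin n) (Fin n) (IntRing O L) where
  toFun c := Matrix.of fun i j =>
    if i < j then algebraMap O _ (c i j) + algebraMap O _ (c j i) * h.gen
    else if i = j then algebraMap O _ (c i i) * h.delta
    else -sigmaInt σ (algebraMap O _ (c j i) + algebraMap O _ (c i j) * h.gen)
  map_zero' := by ext i j; simp
  map_add' c d := by
    refine Matrix.ext fun i j => ?_
    simp only [Matrix.of_apply, Matrix.add_apply, Pi.add_apply]
    split_ifs <;> simp only [map_mul, map_add] <;> ring

lemma skewParam_of_lt {n : ℕ} (c : Fin n → Fin n → O) {i j : Fin n} (hij : i < j) :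
    h.skewParam n c i j = algebraMap O _ (c i j) + algebraMap O _ (c j i) * h.gen := if_pos hij

lemma skewParam_self {n : ℕ} (c : Fin n → Fin n → O) (i : Fin n) :
    h.skewParam n c i i = algebraMap O _ (c i i) * h.delta := by
  simp [skewParam]

lemma skewParam_skew {n : ℕ} (c : Fin n → Fin n → O) (i j : Fin n) :
    sigmaInt σ (h.skewParam n c j i) = -h.skewParam n c i j := by
  rcases lt_trichotomy i j with hij | rfl | hij
  · simp [skewParam, hij, hij.not_gt, hij.ne', map_neg, h.sigmaInt_sigmaInt,
      sigmaInt_algebraMap]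
  · rw [h.skewParam_self, map_mul, sigmaInt_algebraMap, h.sigmaInt_delta]; ring
  · simp [skewParam, hij, hij.not_gt, hij.ne']

lemma skewParam_injective (n : ℕ) : Function.Injective (h.skewParam n) := by
  intro c d hcd
  have h1 : ∀ i j, i < j → c i j = d i j ∧ c j i = d j i := by
    intro i j hij
    have h2 := congrFun (congrFun hcd i) j
    rw [h.skewParam_of_lt _ hij, h.skewParam_of_lt _ hij] at h2
    have h3 := congrArg h.coord h2
    rw [h.coord_eq, h.coord_eq] at h3
    exact ⟨congrArg Prod.fst h3, congrArg Prod.snd h3⟩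
  ext i j
  rcases lt_trichotomy i j with hij | rfl | hij
  · exact (h1 i j hij).1
  · have h2 := congrFun (congrFun hcd i) i
    rw [h.skewParam_self, h.skewParam_self] at h2
    exact h.algebraMap_int_injective (h.mul_delta_cancel h2)
  · exact (h1 j i hij).2

/-- The functions whose values at the indices in `P` lie in the maximal ideal. -/
def coordSub (O : Type*) [CommRing O] [IsLocalRing O] (n : ℕ) (P : Fin n → Fin n → Prop) :
    AddSubgroup (Fin n → Fin n → O) where
  carrier := {c | ∀ i j, P i j → c i j ∈ IsLocalRing.maximalIdeal O}
  zero_mem' := fun _ _ _ => zero_mem _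
  add_mem' := fun hc hd i j hij => add_mem (hc i j hij) (hd i j hij)
  neg_mem' := fun hc i j hij => neg_mem (hc i j hij)

omit h in
lemma index_coordSub (n : ℕ) (P : Fin n → Fin n → Prop) :
    (coordSub O n P).index = residueCard O ^ Nat.card {p : Fin n × Fin n // P p.1 p.2} := by
  classical
  rw [index_eq_card_of_surjective
    (T := {p : Fin n × Fin n // P p.1 p.2} → IsLocalRing.ResidueField O)
    ({ toFun := fun c p => IsLocalRing.residue O (c p.1.1 p.1.2)
       map_zero' := by ext; simp
       map_add' := fun c d => by ext; simp } : (Fin n → Fin n → O) →+ _)]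
  · rw [Nat.card_fun]; rfl
  · intro Y
    choose f hf using fun p => IsLocalRing.residue_surjective (Y p)
    refine ⟨fun i j => if hij : P i j then f ⟨(i, j), hij⟩ else 0, ?_⟩
    ext ⟨⟨i, j⟩, hij⟩
    change IsLocalRing.residue O (if hij : P i j then f ⟨(i, j), hij⟩ else 0) = _
    rw [dif_pos hij, hf]
  · intro c
    constructor
    · intro hc i j hij
      rw [← IsLocalRing.residue_eq_zero_iff]
      exact congrFun hc ⟨(i, j), hij⟩
    · intro hc
      ext p
      exact (IsLocalRing.residue_eq_zero_iff _).2 (hc _ _ p.2)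

/-- If divisibility by `t` is a condition on each coordinate separately, then the lattice of the
`t Z - (t Z)^*` consists of the skew-hermitian matrices whose coordinates at the indices in `P` lie in
the maximal ideal. -/
lemma skewSub_eq_map {t : IntRing O L} (ht : t ∣ sigmaInt σ t) {n : ℕ}
    (P : Fin n → Fin n → Prop)
    (h1 : ∀ i j, i < j → ∀ u v : O, t ∣ algebraMap O _ u + algebraMap O _ v * h.gen ↔
      (P i j → u ∈ IsLocalRing.maximalIdeal O) ∧ (P j i → v ∈ IsLocalRing.maximalIdeal O))
    (h2 : ∀ i, ∀ v : O, (∃ z, v = (h.coord (t * z)).2) ↔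
      (P i i → v ∈ IsLocalRing.maximalIdeal O)) :
    skewSub (sigmaInt σ) t n = (coordSub O n P).map (h.skewParam n) := by
  ext C
  rw [mem_skewSub_iff _ h.sigmaInt_sigmaInt ht]
  constructor
  · rintro ⟨c1, c2, c3⟩
    choose z hz using c3
    let c : Fin n → Fin n → O := fun i j =>
      if i < j then (h.coord (C i j)).1 else if i = j then (h.coord (t * z i)).2
      else (h.coord (C j i)).2
    have hlt : ∀ i j, i < j → c i j = (h.coord (C i j)).1 := fun i j hij => if_pos hij
    have hgt : ∀ i j, i < j → c j i = (h.coord (C i j)).2 := fun i j hij => by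
      simp [c, hij.not_gt, hij.ne']
    have hself : ∀ i, c i i = (h.coord (t * z i)).2 := fun i => by simp [c]
    have hup : ∀ i j, i < j → h.skewParam n c i j = C i j := fun i j hij => by
      rw [h.skewParam_of_lt _ hij, hlt i j hij, hgt i j hij, ← h.eq_coord]
    refine ⟨c, fun i j hij => ?_, ?_⟩
    · rcases lt_trichotomy i j with hlt' | rfl | hgt'
      · have := c2 i j hlt'
        rw [h.eq_coord (C i j), h1 i j hlt'] at this
        rw [hlt i j hlt']
        exact this.1 hij
      · rw [hself]
        exact (h2 i _).1 ⟨z i, rfl⟩ hij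
      · have := c2 j i hgt'
        rw [h.eq_coord (C j i), h1 j i hgt'] at this
        rw [hgt j i hgt']
        exact this.2 hij
    · refine Matrix.ext fun i j => ?_
      rcases lt_trichotomy i j with hij | rfl | hij
      · exact hup i j hij
      · rw [h.skewParam_self, hself, ← h.sub_sigmaInt, hz]
      · have h3 := h.skewParam_skew c i j
        rw [hup j i hij, c1] at h3
        exact (neg_injective h3).symm
  · rintro ⟨c, hc, rfl⟩
    refine ⟨h.skewParam_skew c, fun i j hij => ?_, fun i => ?_⟩
    · rw [h.skewParam_of_lt _ hij, h1 i j hij]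
      exact ⟨hc i j, hc j i⟩
    · obtain ⟨z, hz⟩ := (h2 i (c i i)).2 (hc i i)
      exact ⟨z, by rw [h.sub_sigmaInt, h.skewParam_self, hz]⟩

lemma skewSub_one_eq_map (n : ℕ) :
    skewSub (sigmaInt σ) (1 : IntRing O L) n = (⊤ : AddSubgroup _).map (h.skewParam n) := by
  have : (⊤ : AddSubgroup (Fin n → Fin n → O)) = coordSub O n (fun _ _ => False) :=
    (top_unique fun c _ i j hij => hij.elim).symm
  rw [this]
  refine h.skewSub_eq_map (one_dvd _) _ (fun i j _ u v => by simp) (fun i v => ?_)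
  simp only [one_mul, false_imp_iff, iff_true]
  exact ⟨algebraMap O _ 0 + algebraMap O _ v * h.gen, by rw [h.coord_eq]⟩

lemma coord_algebraMap_mul (u : O) (z : IntRing O L) :
    h.coord (algebraMap O _ u * z) = (u * (h.coord z).1, u * (h.coord z).2) := by
  rw [← h.coord_eq]
  congr 1
  conv_lhs => rw [h.eq_coord z]
  simp only [map_mul]; ring

lemma skewSub_prime_eq_map {ϖ : O} (hϖ : Irreducible ϖ) (n : ℕ) :
    skewSub (sigmaInt σ) (algebraMap O (IntRing O L) ϖ) n =
      (coordSub O n (fun _ _ => True)).map (h.skewParam n) := by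
  refine h.skewSub_eq_map (by rw [sigmaInt_algebraMap]) _ (fun i j _ u v => ?_) (fun i v => ?_)
  · rw [h.dvd_iff hϖ, h.coord_eq]; simp
  · simp only [h.coord_algebraMap_mul, true_imp_iff, hϖ.maximalIdeal_eq, Ideal.mem_span_singleton]
    constructor
    · rintro ⟨z, rfl⟩
      exact ⟨_, rfl⟩
    · rintro ⟨w, rfl⟩
      exact ⟨algebraMap O _ 0 + algebraMap O _ w * h.gen, by rw [h.coord_eq]⟩

lemma skewSub_gen_eq_map (ha : a ∈ IsLocalRing.maximalIdeal O) (hb : Irreducible b) (n : ℕ) :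
    skewSub (sigmaInt σ) h.gen n = (coordSub O n (fun i j => i < j)).map (h.skewParam n) := by
  refine h.skewSub_eq_map ?_ _ (fun i j hij u v => ?_) (fun i v => ?_)
  · obtain ⟨w, -, hw⟩ := h.exists_sigmaInt_gen_eq ha hb
    exact ⟨w, hw⟩
  · rw [h.gen_dvd_iff ha hb, h.coord_eq]; simp [hij, hij.not_gt]
  · simp only [lt_irrefl, false_imp_iff, iff_true]
    refine ⟨algebraMap O _ v, ?_⟩
    rw [mul_comm, h.coord_algebraMap_mul]
    have := h.coord_eq 0 1
    rw [map_zero, map_one, one_mul, zero_add] at this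
    rw [this, mul_one]

lemma relIndex_skewSub_prime {ϖ : O} (hϖ : Irreducible ϖ) (n : ℕ) :
    (skewSub (sigmaInt σ) (algebraMap O (IntRing O L) ϖ) n).relIndex
      (skewSub (sigmaInt σ) (1 : IntRing O L) n) = residueCard O ^ (n ^ 2) := by
  rw [h.skewSub_prime_eq_map hϖ, h.skewSub_one_eq_map,
    AddSubgroup.relIndex_map_map_of_injective _ _ (h.skewParam_injective n),
    AddSubgroup.relIndex_top_right, index_coordSub]
  congr 1
  rw [Nat.card_congr (Equiv.subtypeUnivEquiv fun _ => trivial), Nat.card_prod,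
    Nat.card_eq_fintype_card, Fintype.card_fin, pow_two]

omit h in
lemma card_fin_lt (n : ℕ) :
    Nat.card {p : Fin n × Fin n // p.1 < p.2} = ∑ i ∈ Finset.range n, i := by
  let e : {p : Fin n × Fin n // p.1 < p.2} ≃ Σ j : Fin n, Fin (j : ℕ) :=
    { toFun := fun p => ⟨p.1.2, ⟨p.1.1, p.2⟩⟩
      invFun := fun p => ⟨(⟨p.2, p.2.2.trans p.1.2⟩, p.1), p.2.2⟩
      left_inv := fun p => rfl
      right_inv := fun p => rfl }
  rw [Nat.card_congr e, Nat.card_sigma, Finset.sum_range]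
  simp

lemma relIndex_skewSub_gen (ha : a ∈ IsLocalRing.maximalIdeal O) (hb : Irreducible b) (n : ℕ) :
    (skewSub (sigmaInt σ) h.gen n).relIndex (skewSub (sigmaInt σ) (1 : IntRing O L) n) =
      residueCard O ^ (∑ i ∈ Finset.range n, i) := by
  rw [h.skewSub_gen_eq_map ha hb, h.skewSub_one_eq_map,
    AddSubgroup.relIndex_map_map_of_injective _ _ (h.skewParam_injective n),
    AddSubgroup.relIndex_top_right, index_coordSub, card_fin_lt]

end IsQuadGen

end Indices

/-! ### Solutions modulo powers of a prime element -/

section Powers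

set_option linter.unusedSectionVars false

variable {O K L : Type*} [CommRing O] [IsDomain O] [IsDiscreteValuationRing O] [Field K]
  [Algebra O K] [IsFractionRing O K]
  [CommRing L] [Algebra K L] [Algebra O L] [IsScalarTower O K L]

/-- The number of classes modulo `t` of primitive solutions of `X^* T X = C`, the equation being
understood modulo the lattice of the `t Z - (t Z)^*`. -/
noncomputable def primCount {R : Type*} [CommRing R] (s : R →+* R) {m n : ℕ}
    (T : Matrix (Fin m) (Fin m) R) (C : Matrix (Fin n) (Fin n) R) (t : R) : ℕ :=
  classCount (multSub t m n) {X | IsPrimitiveMatrix X ∧ formDefect s T C X ∈ skewSub s t n}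

namespace IsQuadGen

variable {σ : L ≃ₐ[K] L} {θ : L} {a b : O} (h : IsQuadGen σ θ a b)
include h

lemma algebraMap_mem_nonZeroDivisors {u : O} (hu : u ≠ 0) :
    algebraMap O (IntRing O L) u ∈ nonZeroDivisors (IntRing O L) := by
  rw [mem_nonZeroDivisors_iff_right]
  intro x hx
  have h1 := h.coord_algebraMap_mul u x
  have h0 := h.coord_eq 0 0
  rw [map_zero, zero_mul, add_zero] at h0
  rw [mul_comm, hx, h0] at h1
  have h2 := congrArg Prod.fst h1
  have h3 := congrArg Prod.snd h1
  rw [h.eq_coord x, (mul_eq_zero.1 h2.symm).resolve_left hu,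
    (mul_eq_zero.1 h3.symm).resolve_left hu]
  simp

/-- `1 + u y` has norm congruent to `1` modulo `𝔭`, so it is a unit. -/
lemma algebraMap_mem_jacobson {u : O} (hu : u ∈ IsLocalRing.maximalIdeal O) :
    algebraMap O (IntRing O L) u ∈ Ideal.jacobson (⊥ : Ideal (IntRing O L)) := by
  rw [Ideal.mem_jacobson_bot]
  intro y
  refine h.isUnit_of_norm (h.mul_sigmaInt _) ?_
  have h1 : algebraMap O (IntRing O L) u * y + 1 =
      algebraMap O _ (u * (h.coord y).1 + 1) + algebraMap O _ (u * (h.coord y).2) * h.gen := by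
    conv_lhs => rw [h.eq_coord y]
    simp only [map_add, map_mul, map_one]; ring
  rw [h1, h.coord_eq]
  dsimp only
  by_contra hc
  have h2 : (1 : O) ∈ IsLocalRing.maximalIdeal O := by
    have h3 : (u * (h.coord y).1 + 1) ^ 2 + (u * (h.coord y).1 + 1) * (u * (h.coord y).2) * a +
      (u * (h.coord y).2) ^ 2 * b ∈ IsLocalRing.maximalIdeal O := hc
    have h4 : (1 : O) = ((u * (h.coord y).1 + 1) ^ 2 + (u * (h.coord y).1 + 1) *
      (u * (h.coord y).2) * a + (u * (h.coord y).2) ^ 2 * b) - u * ((u * (h.coord y).1 + 2) *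
      (h.coord y).1 + (u * (h.coord y).1 + 1) * (h.coord y).2 * a +
      u * (h.coord y).2 ^ 2 * b) := by ring
    rw [h4]
    exact sub_mem h3 (Ideal.mul_mem_right _ _ hu)
  exact h2 isUnit_one

variable [Finite (IsLocalRing.ResidueField O)]

omit h in
lemma residueCard_pos : 0 < residueCard O := Nat.card_pos

lemma finite_quotient_multSub {ϖ : O} (hϖ : Irreducible ϖ) (m n e : ℕ) :
    Finite (Matrix (Fin m) (Fin n) (IntRing O L) ⧸
      multSub (algebraMap O (IntRing O L) ϖ ^ e) m n) := by
  apply Nat.finite_of_card_ne_zero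
  change (multSub (algebraMap O (IntRing O L) ϖ ^ e) m n).index ≠ 0
  induction e with
  | zero => rw [pow_zero, multSub_one, AddSubgroup.index_top]; exact one_ne_zero
  | succ e ih =>
    have hu : algebraMap O (IntRing O L) ϖ ^ e ∈ nonZeroDivisors (IntRing O L) := by
      rw [← map_pow]; exact h.algebraMap_mem_nonZeroDivisors (pow_ne_zero _ hϖ.ne_zero)
    have h1 := AddSubgroup.relIndex_mul_index (multSub_le
      (pow_dvd_pow (algebraMap O (IntRing O L) ϖ) (Nat.le_succ e)) m n)
    rw [Nat.succ_eq_add_one, pow_succ, relIndex_multSub_mul hu, h.index_multSub_prime hϖ] at h1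
    rw [pow_succ, ← h1]
    exact mul_ne_zero (pow_pos residueCard_pos _).ne' ih

variable {m n : ℕ} {T : Matrix (Fin m) (Fin m) (IntRing O L)} (hT : IsUnit T)
  (hT1 : T ∈ skewSub (sigmaInt σ) 1 m) (C : Matrix (Fin n) (Fin n) (IntRing O L))
include hT hT1

lemma primCount_pow_succ {ϖ : O} (hϖ : Irreducible ϖ) {e : ℕ} (he : 1 ≤ e) :
    primCount (sigmaInt σ) T C (algebraMap O (IntRing O L) ϖ ^ (e + 1)) * residueCard O ^ (n ^ 2) =
    primCount (sigmaInt σ) T C (algebraMap O (IntRing O L) ϖ ^ e) *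
      residueCard O ^ (2 * (m * n)) := by
  have hfin := h.finite_quotient_multSub hϖ m n (e + 1)
  have hu : algebraMap O (IntRing O L) ϖ ^ e ∈ nonZeroDivisors (IntRing O L) := by
    rw [← map_pow]; exact h.algebraMap_mem_nonZeroDivisors (pow_ne_zero _ hϖ.ne_zero)
  have hsϖ : ∀ i, sigmaInt σ (algebraMap O (IntRing O L) ϖ ^ i) =
      algebraMap O (IntRing O L) ϖ ^ i := fun i => by rw [map_pow, sigmaInt_algebraMap]
  have hidx := relIndex_skewSub_mul (sigmaInt σ) (t := algebraMap O (IntRing O L) ϖ) hu (hsϖ e) n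
  rw [h.relIndex_skewSub_prime hϖ, ← pow_succ] at hidx
  have hidx' := relIndex_multSub_mul (t := algebraMap O (IntRing O L) ϖ) hu m n
  rw [h.index_multSub_prime hϖ, ← pow_succ] at hidx'
  have key := classCount_lift (sigmaInt σ) h.sigmaInt_sigmaInt hT hT1 C
    (t := algebraMap O (IntRing O L) ϖ ^ e) (t' := algebraMap O (IntRing O L) ϖ ^ (e + 1))
    (r := algebraMap O (IntRing O L) ϖ ^ (e - 1))
    (Ideal.pow_mem_of_mem _ (h.algebraMap_mem_jacobson hϖ.not_isUnit) e (by omega))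
    (pow_dvd_pow _ (Nat.le_succ e)) (hsϖ _) (hsϖ _)
    (by rw [hsϖ, ← pow_add, ← pow_add]; congr 1; omega)
    (by rw [hidx]; exact (pow_pos residueCard_pos _).ne')
  rw [hidx, hidx'] at key
  exact key

/-- The counts modulo `ϖ ^ e` with `e ≥ 1`, suitably normalized, do not depend on `e`. -/
lemma normalized_primCount {ϖ : O} (hϖ : Irreducible ϖ) {e : ℕ} (he : 1 ≤ e) :
    (residueCard O : ℝ) ^ ((e : ℤ) * (-2 * (m : ℤ) * (n : ℤ) + (n : ℤ) ^ 2)) *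
      primCount (sigmaInt σ) T C (algebraMap O (IntRing O L) ϖ ^ e) =
    (residueCard O : ℝ) ^ (-2 * (m : ℤ) * (n : ℤ) + (n : ℤ) ^ 2) *
      primCount (sigmaInt σ) T C (algebraMap O (IntRing O L) ϖ) := by
  have hq : (residueCard O : ℝ) ≠ 0 := by exact_mod_cast residueCard_pos.ne'
  induction e, he using Nat.le_induction with
  | base => simp
  | succ e he ih =>
    rw [← ih]
    have h1 := h.primCount_pow_succ hT hT1 C hϖ he
    have h2 : (primCount (sigmaInt σ) T C (algebraMap O (IntRing O L) ϖ ^ (e + 1)) : ℝ) *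
      (residueCard O : ℝ) ^ (n ^ 2) = primCount (sigmaInt σ) T C
        (algebraMap O (IntRing O L) ϖ ^ e) * (residueCard O : ℝ) ^ (2 * (m * n)) := by
      exact_mod_cast h1
    have h3 : (residueCard O : ℝ) ^ (((e + 1 : ℕ) : ℤ) * (-2 * (m : ℤ) * (n : ℤ) + (n : ℤ) ^ 2)) *
        (residueCard O : ℝ) ^ (2 * (m * n)) =
        (residueCard O : ℝ) ^ ((e : ℤ) * (-2 * (m : ℤ) * (n : ℤ) + (n : ℤ) ^ 2)) *
        (residueCard O : ℝ) ^ (n ^ 2) := by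
      rw [← zpow_natCast, ← zpow_natCast, ← zpow_add₀ hq, ← zpow_add₀ hq]
      congr 1
      push_cast; ring
    apply mul_right_cancel₀ (pow_ne_zero (2 * (m * n)) hq)
    rw [mul_right_comm, h3, mul_right_comm, mul_assoc, h2]
    ring

/-- In the ramified case, passing from the modulus `θ` to the modulus `b = N(θ)`. -/
lemma primCount_eisenstein (ha : a ∈ IsLocalRing.maximalIdeal O) (hb : Irreducible b) :
    primCount (sigmaInt σ) T C (algebraMap O (IntRing O L) b) * residueCard O ^ (n ^ 2) =
    primCount (sigmaInt σ) T C h.gen *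
      residueCard O ^ (m * n + ∑ i ∈ Finset.range n, i) := by
  have hq := residueCard_pos (O := O)
  have hfin := h.finite_quotient_multSub hb m n 1
  rw [pow_one] at hfin
  have hdvd : h.gen ∣ algebraMap O (IntRing O L) b := by
    refine ⟨sigmaInt σ h.gen, ?_⟩
    rw [h.sigmaInt_gen]; linear_combination h.gen_sq
  have i1 := AddSubgroup.relIndex_mul_relIndex _ _ _ (skewSub_le (sigmaInt σ) hdvd n)
    (skewSub_le (sigmaInt σ) (one_dvd h.gen) n)
  rw [h.relIndex_skewSub_prime hb, h.relIndex_skewSub_gen ha hb] at i1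
  have i2 := AddSubgroup.relIndex_mul_index (multSub_le hdvd m n)
  rw [h.index_multSub_prime hb, h.index_multSub_gen ha hb] at i2
  have i3 : (multSub (algebraMap O (IntRing O L) b) m n).relIndex (multSub h.gen m n) =
      residueCard O ^ (m * n) := by
    refine Nat.eq_of_mul_eq_mul_right (pow_pos hq (m * n)) ?_
    rw [i2, ← pow_add, two_mul]
  have hjac : h.gen ∈ Ideal.jacobson (⊥ : Ideal (IntRing O L)) := by
    change h.gen ∈ primeQ O L
    rw [h.primeQ_eq_span_of_eisenstein ha hb]
    exact Ideal.mem_span_singleton_self _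
  have key := classCount_lift (sigmaInt σ) h.sigmaInt_sigmaInt hT hT1 C
    (t := h.gen) (t' := algebraMap O (IntRing O L) b) (r := 1) hjac hdvd
    (sigmaInt_algebraMap _ _) (map_one _)
    (by rw [h.sigmaInt_gen]; linear_combination -h.gen_sq)
    (by
      intro h0
      rw [h0, zero_mul] at i1
      exact (pow_pos hq _).ne i1)
  rw [i3] at key
  unfold primCount
  rw [← i1, ← mul_assoc, key, pow_add, mul_assoc]

end IsQuadGen

end Powers

/-! ### Solutions over the residue rings -/

section Residue

set_option linter.unusedSectionVars false

variable {O K L : Type*} [CommRing O] [IsDomain O] [IsDiscreteValuationRing O] [Field K]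
  [Algebra O K] [IsFractionRing O K]
  [CommRing L] [Algebra K L] [Algebra O L] [IsScalarTower O K L]

lemma conjT_mul_mul_mem_skewSub {R : Type*} [CommRing R] (s : R →+* R) (hs : ∀ x, s (s x) = x)
    {m n : ℕ} {T : Matrix (Fin m) (Fin m) R} (hT : T ∈ skewSub s 1 m)
    (X : Matrix (Fin m) (Fin n) R) : conjT s X * T * X ∈ skewSub s 1 n := by
  obtain ⟨Z, rfl⟩ := hT
  refine ⟨conjT s X * Z * X, ?_⟩
  change (1 : R) • _ - conjT s ((1 : R) • _) = conjT s X * ((1 : R) • Z - conjT s ((1 : R) • Z)) * X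
  simp only [one_smul]
  rw [Matrix.mul_sub, Matrix.sub_mul, conjT_mul, conjT_mul, conjT_conjT s hs]
  simp only [Matrix.mul_assoc]

lemma conjT_mul_mul_skew {R : Type*} [CommRing R] (s : R →+* R) (hs : ∀ x, s (s x) = x)
    {m n : ℕ} {T : Matrix (Fin m) (Fin m) R} (hT : T ∈ skewSub s 1 m)
    (X : Matrix (Fin m) (Fin n) R) :
    (∀ i j, s ((conjT s X * T * X) j i) = -(conjT s X * T * X) i j) ∧
      ∀ i, ∃ z, (conjT s X * T * X) i i = z - s z := by
  have h1 := (mem_skewSub_iff s hs (one_dvd (s 1)) _).1 (conjT_mul_mul_mem_skewSub s hs hT X)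
  simp only [one_mul] at h1
  exact ⟨h1.1, h1.2.2⟩

/-- For the modulus `t` of the lattice containing `C`, the right-hand side of `X^* T X = C` plays no
role. -/
lemma formDefect_mem_iff {R : Type*} [CommRing R] (s : R →+* R) {m n : ℕ}
    (T : Matrix (Fin m) (Fin m) R) {t : R} {C : Matrix (Fin n) (Fin n) R} (hC : C ∈ skewSub s t n)
    (X : Matrix (Fin m) (Fin n) R) :
    formDefect s T C X ∈ skewSub s t n ↔ conjT s X * T * X ∈ skewSub s t n := by
  rw [formDefect, sub_mem_comm_iff, ← neg_mem_iff, neg_sub, sub_eq_add_neg,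
    add_mem_cancel_right (neg_mem hC)]

/-- The columns of the image of a matrix under a ring homomorphism. -/
def columnsHom {R A : Type*} [CommRing R] [CommRing A] (f : R →+* A) (m n : ℕ) :
    Matrix (Fin m) (Fin n) R →+ (Fin n → Fin m → A) where
  toFun X j i := f (X i j)
  map_zero' := by ext; simp
  map_add' X Y := by ext; simp

lemma columnsHom_surjective {R A : Type*} [CommRing R] [CommRing A] {f : R →+* A}
    (hf : Function.Surjective f) (m n : ℕ) : Function.Surjective (columnsHom f m n) := by
  intro v
  choose g hg using hf
  exact ⟨Matrix.of fun i j => g (v j i), by ext j i; exact hg _⟩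

lemma columnsHom_eq_zero_iff {R A : Type*} [CommRing R] [CommRing A] {f : R →+* A} {t : R}
    (hker : ∀ x, f x = 0 ↔ t ∣ x) {m n : ℕ} (X : Matrix (Fin m) (Fin n) R) :
    columnsHom f m n X = 0 ↔ X ∈ multSub t m n := by
  constructor
  · intro hX
    have h1 : ∀ i j, ∃ y, X i j = t * y := fun i j =>
      (hker _).1 (congrFun (congrFun hX j) i)
    choose Y hY using h1
    exact ⟨Y, by ext i j; exact (hY i j).symm⟩
  · rintro ⟨Y, rfl⟩
    ext j i
    exact (hker _).2 ⟨Y i j, rfl⟩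

namespace IsQuadGen

variable {σ : L ≃ₐ[K] L} {θ : L} {a b : O} (h : IsQuadGen σ θ a b)
include h

lemma isLocalHom_reduceGen (ha : a ∈ IsLocalRing.maximalIdeal O) (hb : Irreducible b) :
    IsLocalHom (h.reduceGen hb) := by
  refine ⟨fun x hx => ?_⟩
  rw [h.isUnit_iff_of_eisenstein ha hb, ← IsLocalRing.residue_eq_zero_iff, ← h.reduceGen_eq hb]
  exact hx.ne_zero

lemma reduceGen_gen (hb : Irreducible b) : h.reduceGen hb h.gen = 0 := h.lift_gen _ _ _

lemma reduceGen_sigmaInt (ha : a ∈ IsLocalRing.maximalIdeal O) (hb : Irreducible b)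
    (x : IntRing O L) : h.reduceGen hb (sigmaInt σ x) = h.reduceGen hb x := by
  rw [h.eq_coord x]
  simp only [map_add, map_mul, sigmaInt_algebraMap, h.sigmaInt_gen, map_sub, h.reduceGen_gen,
    h.reduceGen_algebraMap, (IsLocalRing.residue_eq_zero_iff a).2 ha, sub_zero, mul_zero]

/-- In the ramified case the form becomes alternating over the residue field, and the primitive
solutions become symplectic frames. -/
lemma primCount_gen [Finite (IsLocalRing.ResidueField O)] (ha : a ∈ IsLocalRing.maximalIdeal O)
    (hb : Irreducible b) {m n : ℕ}
    {T : Matrix (Fin m) (Fin m) (IntRing O L)} (hT : IsUnit T)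
    (hT1 : T ∈ skewSub (sigmaInt σ) 1 m) {C : Matrix (Fin n) (Fin n) (IntRing O L)}
    (hC : C ∈ skewSub (sigmaInt σ) h.gen n) :
    (primCount (sigmaInt σ) T C h.gen : ℝ) =
      ∏ i ∈ Finset.range n, ((residueCard O : ℝ) ^ (m - i) - (residueCard O : ℝ) ^ i) := by
  have hloc := h.isLocalHom_reduceGen ha hb
  have hsurj := h.reduceGen_surjective hb
  have hker := h.reduceGen_eq_zero_iff ha hb
  have hred : ∀ {l n : ℕ} (X : Matrix (Fin m) (Fin l) (IntRing O L))
      (Y : Matrix (Fin m) (Fin n) (IntRing O L)) i j,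
      h.reduceGen hb ((conjT (sigmaInt σ) X * T * Y) i j) =
      columnsHom (h.reduceGen hb) m l X i ⬝ᵥ
        T.map (h.reduceGen hb) *ᵥ columnsHom (h.reduceGen hb) m n Y j := by
    intro l n X Y i j
    rw [Matrix.mul_assoc]
    simp only [Matrix.mul_apply, map_sum, map_mul, dotProduct, Matrix.mulVec, Matrix.map_apply,
      conjT, Matrix.transpose_apply, h.reduceGen_sigmaInt ha hb]
    rfl
  have halt : ∀ x, x ⬝ᵥ T.map (h.reduceGen hb) *ᵥ x = 0 := by
    intro x
    obtain ⟨X, hX⟩ := columnsHom_surjective hsurj m 1 (fun _ => x)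
    have h1 := hred X X 0 0
    rw [hX] at h1
    rw [← h1]
    obtain ⟨Z, hZ⟩ := conjT_mul_mul_mem_skewSub (sigmaInt σ) h.sigmaInt_sigmaInt hT1 X
    rw [← hZ]
    change h.reduceGen hb ((1 : IntRing O L) * Z 0 0 - sigmaInt σ (1 * Z 0 0)) = 0
    rw [map_sub, h.reduceGen_sigmaInt ha hb, sub_self]
  have hTu : IsUnit (T.map (h.reduceGen hb)) := hT.map (h.reduceGen hb).mapMatrix
  rw [primCount, classCount_eq_card (columnsHom (h.reduceGen hb) m n)
    (columnsHom_surjective hsurj m n) (columnsHom_eq_zero_iff hker) _ (fun v =>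
      LinearIndependent (IsLocalRing.ResidueField O) v ∧
        ∀ i j, v i ⬝ᵥ T.map (h.reduceGen hb) *ᵥ v j = 0)]
  · exact card_symplectic_frames _ hTu halt n
  · intro X
    change _ ∧ _ ↔ _
    rw [← isPrimitiveMatrix_map_iff (h.reduceGen hb) hsurj, isPrimitiveMatrix_iff_linearIndependent,
      formDefect_mem_iff _ _ hC]
    refine and_congr Iff.rfl ?_
    have hdvd : h.gen ∣ sigmaInt σ h.gen := by
      obtain ⟨w, -, hw⟩ := h.exists_sigmaInt_gen_eq ha hb
      exact ⟨w, hw⟩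
    have hmem := conjT_mul_mul_skew (sigmaInt σ) h.sigmaInt_sigmaInt hT1 X
    rw [mem_skewSub_iff _ h.sigmaInt_sigmaInt hdvd]
    have hdiag : ∀ i, ∃ z : IntRing O L, (conjT (R := IntRing O L) (sigmaInt σ) X * T * X) i i =
        h.gen * z - sigmaInt σ (h.gen * z) := fun i => by
      obtain ⟨z, hz⟩ := hmem.2 i
      refine ⟨algebraMap O _ (h.coord z).2, ?_⟩
      rw [hz, h.sub_sigmaInt, map_mul, sigmaInt_algebraMap, delta]
      ring
    have hskew := hmem.1
    have hzero : ∀ i j, columnsHom (h.reduceGen hb) m n X i ⬝ᵥ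
        T.map (h.reduceGen hb) *ᵥ columnsHom (h.reduceGen hb) m n X j = 0 ↔
        h.gen ∣ (conjT (R := IntRing O L) (sigmaInt σ) X * T * X) i j := fun i j => by
      rw [← hred, hker]
    simp only [hzero]
    generalize conjT (R := IntRing O L) (sigmaInt σ) X * T * X = Y at hskew hdiag hzero
    constructor
    · rintro ⟨-, h2, -⟩ i j
      rcases lt_trichotomy i j with hij | rfl | hij
      · exact h2 i j hij
      · exact (hzero i i).1 (halt _)
      · obtain ⟨c, hc⟩ := h2 j i hij
        rw [← dvd_neg, ← hskew i j, hc, map_mul]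
        exact Dvd.dvd.mul_right hdvd _
    · exact fun h0 => ⟨hskew, fun i j _ => h0 i j, hdiag⟩

/-! #### The unramified case -/

section Unramified

variable (hD : IsUnit (a ^ 2 - 4 * b))
include hD

lemma isUnit_delta_int : IsUnit h.delta := by
  have h1 : h.delta * h.delta = algebraMap O _ (a ^ 2 - 4 * b) := Subtype.ext h.delta_sq
  have h2 := hD.map (algebraMap O (IntRing O L))
  rw [← h1] at h2
  exact isUnit_of_mul_isUnit_left h2

lemma delta_smul_one_mem (m : ℕ) :
    h.delta • (1 : Matrix (Fin m) (Fin m) (IntRing O L)) ∈ skewSub (sigmaInt σ) 1 m := by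
  refine ⟨h.gen • 1, ?_⟩
  refine Matrix.ext fun i j => ?_
  change (1 : IntRing O L) * (h.gen * (1 : Matrix _ _ (IntRing O L)) i j) -
    sigmaInt σ (1 * (h.gen * (1 : Matrix _ _ (IntRing O L)) j i)) =
    h.delta * (1 : Matrix _ _ (IntRing O L)) i j
  rw [delta, Matrix.one_apply, Matrix.one_apply]
  by_cases hij : i = j
  · subst hij; simp
  · simp [hij, Ne.symm hij]

lemma isUnit_delta_smul_one (m : ℕ) :
    IsUnit (h.delta • (1 : Matrix (Fin m) (Fin m) (IntRing O L))) := by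
  obtain ⟨u, hu⟩ := h.isUnit_delta_int hD
  rw [← hu]
  exact (isUnit_one (M := Matrix (Fin m) (Fin m) (IntRing O L))).smul u

/-- In the unramified case the equation modulo a prime element says that the columns are orthogonal
to each other and isotropic for the standard hermitian form. -/
lemma mem_skewSub_prime_iff {ϖ : O} (hϖ : Irreducible ϖ) {m n : ℕ}
    (X : Matrix (Fin m) (Fin n) (IntRing O L)) :
    conjT (sigmaInt σ) X * (h.delta • (1 : Matrix (Fin m) (Fin m) (IntRing O L))) * X ∈
      skewSub (sigmaInt σ) (algebraMap O (IntRing O L) ϖ) n ↔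
    ∀ i j, algebraMap O (IntRing O L) ϖ ∣ ∑ l, sigmaInt σ (X l i) * X l j := by
  have hmem := conjT_mul_mul_skew (sigmaInt σ) h.sigmaInt_sigmaInt (h.delta_smul_one_mem hD m) X
  set Y := conjT (sigmaInt σ) X * (h.delta • (1 : Matrix (Fin m) (Fin m) (IntRing O L))) * X with hY
  have hentry : ∀ i j, Y i j = h.delta * ∑ l, sigmaInt σ (X l i) * X l j := by
    intro i j
    rw [hY, Matrix.mul_smul, Matrix.smul_mul, Matrix.mul_one, Matrix.smul_apply, smul_eq_mul,
      Matrix.mul_apply]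
    rfl
  have hdvd : ∀ i j, algebraMap O (IntRing O L) ϖ ∣ ∑ l, sigmaInt σ (X l i) * X l j ↔
      algebraMap O (IntRing O L) ϖ ∣ Y i j := fun i j => by
    rw [hentry, (h.isUnit_delta_int hD).dvd_mul_left]
  simp only [hdvd]
  have hself : sigmaInt σ (algebraMap O (IntRing O L) ϖ) = algebraMap O (IntRing O L) ϖ :=
    sigmaInt_algebraMap σ ϖ
  rw [mem_skewSub_iff _ h.sigmaInt_sigmaInt (by rw [hself])]
  constructor
  · rintro ⟨h1, h2, h3⟩ i j
    rcases lt_trichotomy i j with hij | rfl | hij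
    · exact h2 i j hij
    · obtain ⟨z, hz⟩ := h3 i
      rw [hz, map_mul, hself, ← mul_sub]
      exact Dvd.intro _ rfl
    · obtain ⟨c, hc⟩ := h2 j i hij
      have := h1 i j
      rw [hc, map_mul, hself] at this
      rw [← dvd_neg, ← this]
      exact Dvd.intro _ rfl
  · intro h0
    refine ⟨hmem.1, fun i j _ => h0 i j, fun i => ?_⟩
    obtain ⟨z, hz⟩ := hmem.2 i
    rw [h.sub_sigmaInt] at hz
    have h1 := h0 i i
    rw [hz, (h.isUnit_delta_int hD).dvd_mul_right, h.dvd_iff hϖ] at h1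
    have h2 := h.coord_eq (h.coord z).2 0
    rw [map_zero, zero_mul, add_zero] at h2
    rw [h2] at h1
    have h3 := h1.1
    rw [hϖ.maximalIdeal_eq, Ideal.mem_span_singleton] at h3
    obtain ⟨w, hw⟩ := h3
    dsimp only at hw
    refine ⟨algebraMap O _ w * h.gen, ?_⟩
    rw [hz, hw, map_mul, map_mul, map_mul, hself, sigmaInt_algebraMap, delta]
    ring

/-- The reductions at the two places over `𝔭` of a split extension, given by a root `r` of
`t ^ 2 - a t + b` in the residue field. -/
lemma exists_split_reduction {r : IsLocalRing.ResidueField O}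
    (hr : r * r = IsLocalRing.residue O a * r - IsLocalRing.residue O b) {ϖ : O}
    (hϖ : Irreducible ϖ) :
    ∃ f : IntRing O L →+* IsLocalRing.ResidueField O, Function.Surjective (f.prod
      (f.comp (sigmaInt σ))) ∧ IsLocalHom (f.prod (f.comp (sigmaInt σ))) ∧
      ∀ x, f.prod (f.comp (sigmaInt σ)) x = 0 ↔ algebraMap O (IntRing O L) ϖ ∣ x := by
  let φ := IsLocalRing.residue O
  let f := h.lift φ r hr
  have hf1 : ∀ x, f x = φ (h.coord x).1 + φ (h.coord x).2 * r := fun x => rfl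
  have hf2 : ∀ x, f (sigmaInt σ x) = φ (h.coord x).1 + φ (h.coord x).2 * (φ a - r) := fun x => by
    conv_lhs => rw [h.eq_coord x]
    simp only [map_add, map_mul, sigmaInt_algebraMap, h.sigmaInt_gen, map_sub]
    rw [h.lift_algebraMap, h.lift_algebraMap, h.lift_algebraMap, h.lift_gen]
  have hne : φ a - r - r ≠ 0 := by
    intro h0
    have h1 : φ (a ^ 2 - 4 * b) ≠ 0 := (hD.map φ).ne_zero
    apply h1
    simp only [map_sub, map_mul, map_pow, map_ofNat]
    linear_combination (φ a - r - r) * h0 + (-4) * hr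
  refine ⟨f, ?_, ⟨fun x hx => ?_⟩, fun x => ?_⟩
  · rintro ⟨y, z⟩
    obtain ⟨v, hv⟩ := IsLocalRing.residue_surjective ((z - y) / (φ a - r - r))
    obtain ⟨u, hu⟩ := IsLocalRing.residue_surjective (y - (z - y) / (φ a - r - r) * r)
    refine ⟨algebraMap O _ u + algebraMap O _ v * h.gen, Prod.ext ?_ ?_⟩
    · change f _ = y
      rw [hf1, h.coord_eq]
      change φ u + φ v * r = y
      rw [hu, hv]; ring
    · change f (sigmaInt σ _) = z
      rw [hf2, h.coord_eq]
      change φ u + φ v * (φ a - r) = z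
      rw [hu, hv]; field_simp; ring
  · rw [Prod.isUnit_iff] at hx
    refine h.isUnit_of_norm (h.mul_sigmaInt x) ?_
    have h1 : IsUnit (f (x * sigmaInt σ x)) := by
      rw [map_mul]; exact hx.1.mul hx.2
    rw [h.mul_sigmaInt, h.lift_algebraMap] at h1
    exact isUnit_of_map_unit _ _ h1
  · rw [h.dvd_iff hϖ, ← IsLocalRing.residue_eq_zero_iff, ← IsLocalRing.residue_eq_zero_iff,
      Prod.ext_iff]
    change f x = 0 ∧ f (sigmaInt σ x) = 0 ↔ φ _ = 0 ∧ φ _ = 0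
    rw [hf1, hf2]
    constructor
    · rintro ⟨h1, h2⟩
      have h3 : φ (h.coord x).2 = 0 := by
        have : φ (h.coord x).2 * (φ a - r - r) = 0 := by linear_combination h2 - h1
        exact (mul_eq_zero.1 this).resolve_right hne
      exact ⟨by simpa [h3] using h1, h3⟩
    · rintro ⟨h1, h2⟩
      simp [h1, h2]

/-- In the split case a primitive solution is a pair of frames over the residue field, its reductions at
the two places, and the equation says that the two frames are orthogonal to each other. -/
lemma primCount_split [Finite (IsLocalRing.ResidueField O)] {r : IsLocalRing.ResidueField O}
    (hr : r * r = IsLocalRing.residue O a * r - IsLocalRing.residue O b) {ϖ : O}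
    (hϖ : Irreducible ϖ) (m : ℕ) {n : ℕ} {C : Matrix (Fin n) (Fin n) (IntRing O L)}
    (hC : C ∈ skewSub (sigmaInt σ) (algebraMap O (IntRing O L) ϖ) n) :
    (primCount (sigmaInt σ) (h.delta • (1 : Matrix (Fin m) (Fin m) (IntRing O L))) C
      (algebraMap O (IntRing O L) ϖ) : ℝ) =
    (∏ i ∈ Finset.range n, ((residueCard O : ℝ) ^ m - (residueCard O : ℝ) ^ i)) *
      ∏ i ∈ Finset.range n, ((residueCard O : ℝ) ^ (m - n) - (residueCard O : ℝ) ^ i) := by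
  obtain ⟨f, hsurj, hloc, hker⟩ := h.exists_split_reduction hD hr hϖ
  set F := f.prod (f.comp (sigmaInt σ)) with hF
  let e : {v : Fin n → Fin m → IsLocalRing.ResidueField O × IsLocalRing.ResidueField O //
      LinearIndependent (IsLocalRing.ResidueField O) (fun i j => (v i j).1) ∧
      LinearIndependent (IsLocalRing.ResidueField O) (fun i j => (v i j).2) ∧
      ∀ i j, (fun l => (v i l).1) ⬝ᵥ (fun l => (v j l).2) = 0} ≃
      {p : (Fin n → Fin m → IsLocalRing.ResidueField O) ×
        (Fin n → Fin m → IsLocalRing.ResidueField O) //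
        LinearIndependent (IsLocalRing.ResidueField O) p.1 ∧
        LinearIndependent (IsLocalRing.ResidueField O) p.2 ∧ ∀ i j, p.1 i ⬝ᵥ p.2 j = 0} :=
    { toFun := fun v => ⟨(fun i j => (v.1 i j).1, fun i j => (v.1 i j).2), v.2⟩
      invFun := fun p => ⟨fun i j => (p.1.1 i j, p.1.2 i j), p.2⟩
      left_inv := fun v => rfl
      right_inv := fun p => rfl }
  refine Eq.trans ?_ (card_orthogonal_frames (k := IsLocalRing.ResidueField O) (m := m) n)
  rw [← Nat.card_congr e, primCount]
  congr 1
  refine classCount_eq_card (columnsHom F m n) (columnsHom_surjective hsurj m n)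
    (columnsHom_eq_zero_iff hker) _ (fun v =>
      LinearIndependent (IsLocalRing.ResidueField O) (fun i j => (v i j).1) ∧
      LinearIndependent (IsLocalRing.ResidueField O) (fun i j => (v i j).2) ∧
      ∀ i j, (fun l => (v i l).1) ⬝ᵥ (fun l => (v j l).2) = 0) ?_
  intro X
  change _ ∧ _ ↔ _
  rw [← isPrimitiveMatrix_map_iff F hsurj, isPrimitiveMatrix_prod_iff,
    isPrimitiveMatrix_iff_linearIndependent, isPrimitiveMatrix_iff_linearIndependent,
    formDefect_mem_iff _ _ hC, h.mem_skewSub_prime_iff hD hϖ, and_assoc]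
  refine and_congr Iff.rfl (and_congr Iff.rfl ?_)
  have key : ∀ i j, (algebraMap O (IntRing O L) ϖ ∣ ∑ l, sigmaInt σ (X l i) * X l j) ↔
      (∑ l, f (sigmaInt σ (X l i)) * f (X l j) = 0 ∧
        ∑ l, f (X l i) * f (sigmaInt σ (X l j)) = 0) := by
    intro i j
    rw [← hker, Prod.ext_iff]
    change f _ = 0 ∧ f (sigmaInt σ _) = 0 ↔ _
    simp only [map_sum, map_mul, h.sigmaInt_sigmaInt]
  simp only [key]
  change _ ↔ ∀ i j, ∑ l, f (X l i) * f (sigmaInt σ (X l j)) = 0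
  constructor
  · exact fun h1 i j => (h1 i j).2
  · refine fun h1 i j => ⟨?_, h1 i j⟩
    rw [← h1 j i]
    exact Finset.sum_congr rfl fun l _ => mul_comm _ _

/-- In the inert case `O_E / 𝔭 O_E` is a field with `q ^ 2` elements, and the primitive solutions become
totally isotropic frames of the standard hermitian form over it. -/
lemma primCount_inert [Finite (IsLocalRing.ResidueField O)] {ϖ : O} (hϖ : Irreducible ϖ)
    (hroot : ∀ r : IsLocalRing.ResidueField O,
      r * r ≠ IsLocalRing.residue O a * r - IsLocalRing.residue O b)
    (m : ℕ) {n : ℕ} {C : Matrix (Fin n) (Fin n) (IntRing O L)}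
    (hC : C ∈ skewSub (sigmaInt σ) (algebraMap O (IntRing O L) ϖ) n) :
    (primCount (sigmaInt σ) (h.delta • (1 : Matrix (Fin m) (Fin m) (IntRing O L))) C
      (algebraMap O (IntRing O L) ϖ) : ℝ) =
    ∏ i ∈ Finset.range n, (((residueCard O : ℝ) ^ (2 * (m - i)) +
        (residueCard O - 1) * (-(residueCard O : ℝ)) ^ m) / residueCard O -
        (residueCard O : ℝ) ^ (2 * i)) := by
  set p := algebraMap O (IntRing O L) ϖ with hp
  -- an element outside `𝔭 O_E` has unit norm, since the norm form has no zero modulo `𝔭`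
  have hunit : ∀ x : IntRing O L, ¬ p ∣ x → IsUnit x := by
    intro x hx
    refine h.isUnit_of_norm (h.mul_sigmaInt x) ?_
    by_contra hc
    have hc' := (IsLocalRing.residue_eq_zero_iff _).2 (show _ ∈ IsLocalRing.maximalIdeal O from hc)
    simp only [map_add, map_mul, map_pow] at hc'
    apply hx
    rw [h.dvd_iff hϖ, ← IsLocalRing.residue_eq_zero_iff, ← IsLocalRing.residue_eq_zero_iff]
    by_cases hv : IsLocalRing.residue O (h.coord x).2 = 0
    · rw [hv] at hc' ⊢
      simpa using hc'
    · exfalso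
      apply hroot (-(IsLocalRing.residue O (h.coord x).1 / IsLocalRing.residue O (h.coord x).2))
      field_simp
      linear_combination hc'
  have hpu : ¬ IsUnit p := by
    intro hu
    have := (h.dvd_iff hϖ 1).1 (hu.dvd)
    have h1 := h.coord_eq 1 0
    rw [map_zero, zero_mul, add_zero, map_one] at h1
    rw [h1] at this
    exact this.1 isUnit_one
  have hmax : (Ideal.span {p}).IsMaximal := by
    rw [Ideal.isMaximal_iff]
    constructor
    · rw [Ideal.mem_span_singleton]
      exact fun h1 => hpu (isUnit_of_dvd_one h1)
    · intro J x _ hx hxJ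
      rw [Ideal.mem_span_singleton] at hx
      have := Ideal.eq_top_of_isUnit_mem J hxJ (hunit x hx)
      rw [this]; trivial
  let κ := IntRing O L ⧸ Ideal.span {p}
  let _ : Field κ := Ideal.Quotient.field (Ideal.span {p})
  let π : IntRing O L →+* κ := Ideal.Quotient.mk (Ideal.span {p})
  have hsurj : Function.Surjective π := Ideal.Quotient.mk_surjective
  have hker : ∀ x, π x = 0 ↔ p ∣ x := fun x => by
    rw [Ideal.Quotient.eq_zero_iff_mem, Ideal.mem_span_singleton]
  have hloc : IsLocalHom π := ⟨fun x hx => hunit x fun hd => hx.ne_zero ((hker x).2 hd)⟩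
  have hsp : ∀ x, π x = 0 → π (sigmaInt σ x) = 0 := by
    intro x hx
    rw [hker] at hx ⊢
    obtain ⟨y, rfl⟩ := hx
    rw [map_mul, hp, sigmaInt_algebraMap]
    exact Dvd.intro _ rfl
  let s0 : κ →+* κ := Ideal.Quotient.lift (Ideal.span {p}) (π.comp (sigmaInt σ)) (fun x hx =>
    hsp x (Ideal.Quotient.eq_zero_iff_mem.2 hx))
  have hs0 : ∀ x, s0 (π x) = π (sigmaInt σ x) := fun x => rfl
  have hs00 : ∀ x, s0 (s0 x) = x := by
    intro x
    obtain ⟨x, rfl⟩ := hsurj x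
    rw [hs0, hs0, h.sigmaInt_sigmaInt]
  let s : κ ≃+* κ := RingEquiv.ofRingHom s0 s0 (RingHom.ext hs00) (RingHom.ext hs00)
  have hs : ∀ x, s (π x) = π (sigmaInt σ x) := fun x => rfl
  have hcard : Nat.card κ = residueCard O ^ 2 := by
    have := index_multSub p π.toAddMonoidHom hsurj hker 1 1
    rw [h.index_multSub_prime hϖ] at this
    simpa using this.symm
  have hfin : Finite κ := Nat.finite_of_card_ne_zero (by
    rw [hcard]; exact (pow_pos residueCard_pos _).ne')
  have hs1 : ∃ x, s x ≠ x := by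
    refine ⟨π h.gen, fun h0 => ?_⟩
    rw [hs] at h0
    have h1 : π h.delta = 0 := by rw [delta, map_sub, h0, sub_self]
    exact ((h.isUnit_delta_int hD).map π).ne_zero h1
  refine Eq.trans ?_ (card_hermitian_frames_of_involution s hs00 hs1 hcard m n)
  rw [primCount]
  congr 1
  refine classCount_eq_card (columnsHom π m n) (columnsHom_surjective hsurj m n)
    (columnsHom_eq_zero_iff hker) _ (fun v => LinearIndependent κ v ∧
      ∀ i j, (s ∘ v i) ⬝ᵥ v j = 0) ?_
  intro X
  change _ ∧ _ ↔ _
  rw [← isPrimitiveMatrix_map_iff π hsurj, isPrimitiveMatrix_iff_linearIndependent,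
    formDefect_mem_iff _ _ hC, h.mem_skewSub_prime_iff hD hϖ]
  refine and_congr Iff.rfl (forall₂_congr fun i j => ?_)
  rw [← hp, ← hker, map_sum]
  simp only [map_mul, ← hs]
  rfl

end Unramified

end IsQuadGen

end Residue

/-! ### Semi-integral hermitian matrices and skew-hermitian matrices over `O_E` -/

section Transfer

set_option linter.unusedSectionVars false

variable {O K L : Type*} [CommRing O] [IsDomain O] [IsDiscreteValuationRing O] [Field K]
  [Algebra O K] [IsFractionRing O K]
  [CommRing L] [Algebra K L] [Algebra O L] [IsScalarTower O K L]

namespace IsQuadGen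

variable {σ : L ≃ₐ[K] L} {θ : L} {a b : O} (h : IsQuadGen σ θ a b)

/-- `C` is the matrix over `L` with `(θ - σ θ) C = Y`. -/
def IsScaled (_ : IsQuadGen σ θ a b) {m n : ℕ} (C : Matrix (Fin m) (Fin n) L)
    (Y : Matrix (Fin m) (Fin n) (IntRing O L)) : Prop :=
  ∀ i j, (θ - σ θ) * C i j = (Y i j : L)

include h

lemma sigma_algebraMap (r : O) : σ (algebraMap O L r) = algebraMap O L r := by
  rw [IsScalarTower.algebraMap_apply O K L, AlgEquiv.commutes]

/-- `tr (C B)` is the trace of an element of the inverse different if `C = W + W^*` with `W` over the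
inverse different. -/
lemma mem_semiIntHer_of_isScaled {n : ℕ} {C : Matrix (Fin n) (Fin n) L}
    {Y : Matrix (Fin n) (Fin n) (IntRing O L)} (hY : Y ∈ skewSub (sigmaInt σ) 1 n)
    (hCY : h.IsScaled C Y) : C ∈ semiIntHer O σ n := by
  have hδ := h.isUnit_delta
  have hY1 := (mem_skewSub_iff (sigmaInt σ) h.sigmaInt_sigmaInt (one_dvd _) _).1 hY
  have hherm : ∀ i j, σ (C j i) = C i j := by
    intro i j
    apply hδ.mul_left_cancel
    have h1 := congrArg σ (hCY j i)
    rw [map_mul, h.sigma_delta] at h1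
    have h2 : σ (Y j i : L) = -(Y i j : L) := congrArg (algebraMap (IntRing O L) L) (hY1.1 i j)
    rw [h2] at h1
    rw [hCY i j]
    linear_combination -h1
  refine ⟨Matrix.ext fun i j => hherm i j, fun B hB hBi => ?_⟩
  have hB' : ∀ i j, σ (B j i) = B i j := fun i j => congrFun (congrFun hB i) j
  obtain ⟨Z, rfl⟩ := hY
  obtain ⟨d, hd⟩ := hδ.exists_right_inv
  have hC : ∀ i j, C i j = d * (Z i j : L) + σ (d * (Z j i : L)) := by
    intro i j
    apply hδ.mul_left_cancel
    have h1 : (θ - σ θ) * C i j = (Z i j : L) - σ (Z j i : L) := by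
      rw [hCY i j]
      change (((1 : IntRing O L) * Z i j - sigmaInt σ (1 * Z j i) : IntRing O L) : L) = _
      rw [one_mul, one_mul]; rfl
    have h2 := congrArg σ hd
    rw [map_mul, h.sigma_delta, map_one] at h2
    rw [h1, map_mul]
    linear_combination (-(Z i j : L)) * hd + σ (Z j i : L) * h2
  set x : L := ∑ i, ∑ j, d * (Z i j : L) * B j i with hx
  have hxint : x * (θ - σ θ) ∈ integralClosure O L := by
    have : x * (θ - σ θ) = ∑ i, ∑ j, (Z i j : L) * B j i := by
      rw [hx, Finset.sum_mul]
      refine Finset.sum_congr rfl fun i _ => ?_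
      rw [Finset.sum_mul]
      refine Finset.sum_congr rfl fun j _ => ?_
      linear_combination (Z i j : L) * B j i * hd
    rw [this]
    exact sum_mem fun i _ => sum_mem fun j _ => mul_mem (Z i j).2 (hBi j i)
  have htr : Matrix.trace (C * B) = x + σ x := by
    have h1 : σ x = ∑ i, ∑ j, σ (d * (Z j i : L)) * B j i := by
      rw [hx, Finset.sum_comm, map_sum]
      refine Finset.sum_congr rfl fun i _ => ?_
      rw [map_sum]
      refine Finset.sum_congr rfl fun j _ => ?_
      rw [map_mul, hB']
    rw [h1, hx, ← Finset.sum_add_distrib, Matrix.trace]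
    refine Finset.sum_congr rfl fun i _ => ?_
    rw [Matrix.diag_apply, Matrix.mul_apply, ← Finset.sum_add_distrib]
    refine Finset.sum_congr rfl fun j _ => ?_
    rw [hC, add_mul]
  rw [htr]
  refine ⟨?_, ?_⟩
  · exact h.mem_range_of_sigma_eq (by rw [map_add, h.involutive, add_comm])
  · have := (h.mul_delta_mem_iff x).1 hxint 1 (one_mem _)
    rwa [mul_one] at this

/-- Testing a semi-integral matrix on the hermitian matrices with at most two nonzero entries shows that
its diagonal is in `O` and its other entries are in the inverse different. -/
lemma exists_isScaled_of_mem_semiIntHer {n : ℕ} {C : Matrix (Fin n) (Fin n) L}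
    (hC : C ∈ semiIntHer O σ n) : ∃ Y ∈ skewSub (sigmaInt (O := O) σ) 1 n, h.IsScaled C Y := by
  have hnt := h.nontrivial
  obtain ⟨hH, htr⟩ := hC
  have hherm : ∀ i j, σ (C j i) = C i j := fun i j => congrFun (congrFun hH i) j
  have hdiag : ∀ i, ∃ c : O, algebraMap O L c = C i i := by
    intro i
    have h1 := htr (Matrix.single i i 1) ?_ ?_
    · rw [Matrix.trace_mul_single, MulOpposite.op_one, one_smul] at h1
      obtain ⟨u, hu⟩ := h1.1
      rw [← hu] at h1 ⊢
      obtain ⟨c, rfl⟩ := mem_range_of_algebraMap_mem h1.2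
      exact ⟨c, IsScalarTower.algebraMap_apply O K L c⟩
    · refine Matrix.ext fun k l => ?_
      change σ (Matrix.single i i (1 : L) l k) = _
      rw [Matrix.single_apply, Matrix.single_apply]
      simp only [and_comm (a := i = l)]
      split_ifs <;> simp
    · intro k l
      rw [Matrix.single_apply]
      split_ifs
      · exact one_mem _
      · exact zero_mem _
  have hoff : ∀ i j, i ≠ j → C i j * (θ - σ θ) ∈ integralClosure O L := by
    intro i j hij
    rw [h.mul_delta_mem_iff]
    intro y hy
    have h1 := (htr (Matrix.single j i y + Matrix.single i j (σ y)) ?_ ?_).2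
    · rw [Matrix.mul_add, Matrix.trace_add, Matrix.trace_mul_single, Matrix.trace_mul_single] at h1
      convert h1 using 1
      rw [map_mul, hherm j i, op_smul_eq_mul, op_smul_eq_mul]
    · refine Matrix.ext fun k l => ?_
      change σ ((Matrix.single j i y + Matrix.single i j (σ y)) l k) = _
      simp only [Matrix.add_apply, Matrix.single_apply, map_add, apply_ite σ, map_zero,
        h.involutive]
      rw [add_comm]
      simp only [and_comm (a := j = l), and_comm (a := i = l)]
    · intro k l
      rw [Matrix.add_apply, Matrix.single_apply, Matrix.single_apply]
      refine add_mem ?_ ?_ <;> split_ifs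
      exacts [hy, zero_mem _, sigma_mem_integralClosure σ hy, zero_mem _]
  have hall : ∀ i j, (θ - σ θ) * C i j ∈ integralClosure O L := by
    intro i j
    by_cases hij : i = j
    · subst hij
      obtain ⟨c, hc⟩ := hdiag i
      rw [← hc]
      exact mul_mem (sub_mem h.theta_mem (sigma_mem_integralClosure σ h.theta_mem))
        (algebraMap_mem_integralClosure c)
    · rw [mul_comm]; exact hoff i j hij
  refine ⟨Matrix.of fun i j => ⟨_, hall i j⟩, ?_, fun i j => rfl⟩
  rw [mem_skewSub_iff _ h.sigmaInt_sigmaInt (one_dvd _)]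
  refine ⟨fun i j => ?_, fun i j _ => one_dvd _, fun i => ?_⟩
  · refine Subtype.ext ?_
    change σ ((θ - σ θ) * C j i) = -((θ - σ θ) * C i j)
    rw [map_mul, h.sigma_delta, hherm]; ring
  · obtain ⟨c, hc⟩ := hdiag i
    refine ⟨algebraMap O _ c * h.gen, ?_⟩
    rw [one_mul, map_mul, sigmaInt_algebraMap, ← mul_sub]
    refine Subtype.ext ?_
    change (θ - σ θ) * C i i = algebraMap O L c * (θ - σ θ)
    rw [hc, mul_comm]

lemma isScaled_injective {m n : ℕ} {C : Matrix (Fin m) (Fin n) L}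
    {Y Y' : Matrix (Fin m) (Fin n) (IntRing O L)} (hY : h.IsScaled C Y) (hY' : h.IsScaled C Y') :
    Y = Y' :=
  Matrix.ext fun i j => Subtype.ext ((hY i j).symm.trans (hY' i j))

omit h in
lemma primeP_pow_eq {ϖ : O} (hϖ : Irreducible ϖ) (e : ℕ) : primeP O ^ e = Ideal.span {ϖ ^ e} := by
  rw [primeP, hϖ.maximalIdeal_eq, Ideal.span_singleton_pow]

lemma exists_isScaled_of_mem_smul {ϖ : O} (hϖ : Irreducible ϖ) (e : ℕ) {n : ℕ}
    {C : Matrix (Fin n) (Fin n) L} (hC : C ∈ primeP O ^ e • semiIntHer O σ n) :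
    ∃ Y ∈ skewSub (sigmaInt σ) (algebraMap O (IntRing O L) ϖ ^ e) n, h.IsScaled C Y := by
  rw [primeP_pow_eq hϖ, Submodule.ideal_span_singleton_smul,
    Submodule.mem_smul_pointwise_iff_exists] at hC
  obtain ⟨C0, hC0, rfl⟩ := hC
  obtain ⟨Y, ⟨Z, rfl⟩, hCY⟩ := h.exists_isScaled_of_mem_semiIntHer hC0
  refine ⟨_, ⟨Z, rfl⟩, fun i j => ?_⟩
  have h1 := hCY i j
  change _ = (((1 : IntRing O L) * Z i j - sigmaInt σ (1 * Z j i) : IntRing O L) : L) at h1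
  change (θ - σ θ) * (ϖ ^ e • C0 i j) = ((algebraMap O (IntRing O L) ϖ ^ e * Z i j -
    sigmaInt σ (algebraMap O (IntRing O L) ϖ ^ e * Z j i) : IntRing O L) : L)
  rw [map_mul, ← map_pow, sigmaInt_algebraMap, ← mul_sub]
  rw [one_mul, one_mul] at h1
  rw [Algebra.smul_def, mul_left_comm, h1]
  rfl

lemma mem_smul_iff {ϖ : O} (hϖ : Irreducible ϖ) (e : ℕ) {n : ℕ} {C : Matrix (Fin n) (Fin n) L}
    {Y : Matrix (Fin n) (Fin n) (IntRing O L)} (hCY : h.IsScaled C Y) :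
    C ∈ primeP O ^ e • semiIntHer O σ n ↔
      Y ∈ skewSub (sigmaInt σ) (algebraMap O (IntRing O L) ϖ ^ e) n := by
  constructor
  · intro hC
    obtain ⟨Y', hY', hCY'⟩ := h.exists_isScaled_of_mem_smul hϖ e hC
    rwa [h.isScaled_injective hCY hCY']
  · rintro ⟨Z, rfl⟩
    rw [primeP_pow_eq hϖ, Submodule.ideal_span_singleton_smul,
      Submodule.mem_smul_pointwise_iff_exists]
    obtain ⟨d, hd⟩ := h.isUnit_delta.exists_right_inv
    let C0 : Matrix (Fin n) (Fin n) L :=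
      Matrix.of fun i j => d * ((Z i j - sigmaInt σ (Z j i) : IntRing O L) : L)
    have hC0 : ∀ i j, (θ - σ θ) * C0 i j = ((Z i j - sigmaInt σ (Z j i) : IntRing O L) : L) := by
      intro i j
      change (θ - σ θ) * (d * _) = _
      rw [← mul_assoc, hd, one_mul]
    refine ⟨C0, h.mem_semiIntHer_of_isScaled ⟨Z, rfl⟩ fun i j => ?_, ?_⟩
    · rw [hC0]
      change _ = (((1 : IntRing O L) * Z i j - sigmaInt σ (1 * Z j i) : IntRing O L) : L)
      rw [one_mul, one_mul]
    · refine Matrix.ext fun i j => ?_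
      apply h.isUnit_delta.mul_left_cancel
      rw [hCY i j]
      change (θ - σ θ) * (ϖ ^ e • C0 i j) = ((algebraMap O (IntRing O L) ϖ ^ e * Z i j -
        sigmaInt σ (algebraMap O (IntRing O L) ϖ ^ e * Z j i) : IntRing O L) : L)
      rw [map_mul, ← map_pow, sigmaInt_algebraMap, ← mul_sub, Algebra.smul_def, mul_left_comm, hC0]
      rfl

/-- The congruence defining `solSet` in terms of the skew-hermitian matrices `(θ - σ θ) A` and
`(θ - σ θ) B`. -/
lemma isScaled_actMat_sub {m n : ℕ} {A : Matrix (Fin m) (Fin m) L}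
    {T : Matrix (Fin m) (Fin m) (IntRing O L)} (hA : h.IsScaled A T)
    {B : Matrix (Fin n) (Fin n) L} {C : Matrix (Fin n) (Fin n) (IntRing O L)}
    (hB : h.IsScaled B C) (X : Matrix (Fin m) (Fin n) (IntRing O L)) :
    h.IsScaled (actMat σ A (X.map (algebraMap (IntRing O L) L)) - B)
      (formDefect (sigmaInt σ) T C X) := by
  intro i j
  rw [Matrix.sub_apply, mul_sub, hB i j]
  change _ = (((conjT (sigmaInt σ) X * T * X) i j - C i j : IntRing O L) : L)
  rw [AddSubgroupClass.coe_sub]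
  congr 1
  rw [actMat, Matrix.mul_apply, Matrix.mul_apply, Finset.mul_sum, AddSubmonoidClass.coe_finsetSum]
  refine Finset.sum_congr rfl fun l _ => ?_
  rw [Matrix.mul_apply, Matrix.mul_apply, Finset.sum_mul, Finset.mul_sum, Finset.sum_mul,
    AddSubmonoidClass.coe_finsetSum]
  refine Finset.sum_congr rfl fun r _ => ?_
  change (θ - σ θ) * (σ (X r i : L) * A r l * (X l j : L)) = σ (X r i : L) * (T r l : L) * (X l j : L)
  rw [← hA r l]; ring

lemma solCount_eq_primCount {ϖ : O} (hϖ : Irreducible ϖ) {m n : ℕ} {A : Matrix (Fin m) (Fin m) L}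
    {T : Matrix (Fin m) (Fin m) (IntRing O L)} (hA : h.IsScaled A T)
    {B : Matrix (Fin n) (Fin n) L} {C : Matrix (Fin n) (Fin n) (IntRing O L)}
    (hB : h.IsScaled B C) (e : ℕ) :
    solCount O σ A B (primMat O L m n) e =
      primCount (sigmaInt σ) T C (algebraMap O (IntRing O L) ϖ ^ e) := by
  have h1 : (primeP O ^ e • (⊤ : Submodule O (Matrix (Fin m) (Fin n) (IntRing O L)))).toAddSubgroup =
      multSub (algebraMap O (IntRing O L) ϖ ^ e) m n := by
    ext X
    rw [Submodule.mem_toAddSubgroup, primeP_pow_eq hϖ, Submodule.ideal_span_singleton_smul,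
      Submodule.mem_smul_pointwise_iff_exists, mem_multSub]
    simp only [Submodule.mem_top, true_and]
    refine exists_congr fun Y => ?_
    rw [← map_pow, algebraMap_smul]
  have h2 : solSet O σ A B (primMat O L m n) e =
      {X | IsPrimitiveMatrix X ∧ formDefect (sigmaInt σ) T C X ∈
        skewSub (sigmaInt σ) (algebraMap O (IntRing O L) ϖ ^ e) n} := by
    ext X
    change X ∈ primMat O L m n ∧ _ ↔ _ ∧ _
    rw [mem_primMat_iff, h.mem_smul_iff hϖ e (h.isScaled_actMat_sub hA hB X)]
  rw [primCount, ← h1, ← h2]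
  rfl

omit h in
lemma herStar_of_not_isRamifiedAlg (hram : ¬ IsRamifiedAlg O L) {n : ℕ}
    {B : Matrix (Fin n) (Fin n) L} (hB : B ∈ HerStar O σ n) :
    B ∈ primeP O ^ 1 • semiIntHer O σ n := by
  rw [HerStar, if_neg hram] at hB
  rw [pow_one]
  exact hB

/-- In the ramified case the matrices in `Her_{n,*}` are congruent to `0` for the modulus `θ`. -/
lemma exists_isScaled_of_mem_herStar (ha : a ∈ IsLocalRing.maximalIdeal O) (hb : Irreducible b)
    {n : ℕ} {B : Matrix (Fin n) (Fin n) L} (hB : B ∈ HerStar O σ n) :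
    ∃ C ∈ skewSub (sigmaInt σ) h.gen n, h.IsScaled B C := by
  rw [HerStar, if_pos (h.isRamifiedAlg_of_eisenstein ha hb)] at hB
  obtain ⟨hH, hoff, hdiag⟩ := hB
  have hherm : ∀ i j, σ (B j i) = B i j := fun i j => congrFun (congrFun hH i) j
  have hoff' : ∀ i j, i ≠ j → ∃ y : IntRing O L, (θ - σ θ) * B i j = ((h.gen * y : IntRing O L) : L)
      := by
    intro i j hij
    refine Submodule.smul_induction_on (hoff i j hij) (fun r hr x hx => ?_) ?_
    · rw [h.primeQ_eq_span_of_eisenstein ha hb, Ideal.mem_span_singleton] at hr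
      obtain ⟨y, rfl⟩ := hr
      rw [h.mem_invDifferent_iff] at hx
      refine ⟨y * ⟨_, hx⟩, ?_⟩
      rw [Algebra.smul_def]
      change (θ - σ θ) * ((h.gen : L) * (y : L) * x) = (h.gen : L) * ((y : L) * (x * (θ - σ θ)))
      ring
    · rintro x y ⟨u, hu⟩ ⟨v, hv⟩
      exact ⟨u + v, by rw [mul_add, hu, hv, mul_add]; rfl⟩
  have hall : ∀ i j, ∃ y : IntRing O L, (θ - σ θ) * B i j = (y : L) := by
    intro i j
    by_cases hij : i = j
    · subst hij
      obtain ⟨c, hc⟩ := hdiag i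
      exact ⟨h.delta * algebraMap O _ c, by rw [← hc]; rfl⟩
    · obtain ⟨y, hy⟩ := hoff' i j hij
      exact ⟨_, hy⟩
  choose Y hY using hall
  refine ⟨Matrix.of Y, ?_, hY⟩
  rw [mem_skewSub_iff _ h.sigmaInt_sigmaInt (by
    obtain ⟨w, -, hw⟩ := h.exists_sigmaInt_gen_eq ha hb
    exact ⟨w, hw⟩)]
  refine ⟨fun i j => ?_, fun i j hij => ?_, fun i => ?_⟩
  · refine Subtype.ext ?_
    change σ (Y j i : L) = -(Y i j : L)
    rw [← hY, ← hY, map_mul, h.sigma_delta, hherm]; ring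
  · obtain ⟨y, hy⟩ := hoff' i j hij.ne
    exact ⟨y, Subtype.ext ((hY i j).symm.trans hy)⟩
  · obtain ⟨c, hc⟩ := hdiag i
    refine ⟨algebraMap O _ c, ?_⟩
    rw [map_mul, sigmaInt_algebraMap, ← sub_mul]
    refine Subtype.ext ?_
    change (Y i i : L) = (θ - σ θ) * algebraMap O L c
    rw [← hY, hc]

end IsQuadGen

end Transfer

/-! ### Inert, ramified and split algebras in terms of the discriminant -/

section Trichotomy

set_option linter.unusedSectionVars false

variable {O K L : Type*} [CommRing O] [IsDomain O] [IsDiscreteValuationRing O] [Field K]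
  [Algebra O K] [IsFractionRing O K]
  [CommRing L] [Algebra K L] [Algebra O L] [IsScalarTower O K L]

namespace IsQuadGen

variable {σ : L ≃ₐ[K] L} {θ : L} {a b : O} (h : IsQuadGen σ θ a b)
include h

lemma coord_algebraMap (u : O) : h.coord (algebraMap O _ u) = (u, 0) := by
  have := h.coord_eq u 0
  rwa [map_zero, zero_mul, add_zero] at this

lemma gen_notMem_map_primeP (u : O) :
    h.gen - algebraMap O _ u ∉ (primeP O).map (algebraMap O (IntRing O L)) := by
  rw [h.mem_map_ideal_iff]
  have := h.coord_eq (-u) 1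
  rw [map_neg, map_one, one_mul, neg_add_eq_sub] at this
  rw [this]
  exact fun hc => hc.2 isUnit_one

/-- If the discriminant is a unit, then `O_E / 𝔭 O_E` is reduced. -/
lemma mem_map_primeP_of_sq_mem (hD : IsUnit (a ^ 2 - 4 * b)) {x : IntRing O L}
    (hx : x * x ∈ (primeP O).map (algebraMap O (IntRing O L))) :
    x ∈ (primeP O).map (algebraMap O (IntRing O L)) := by
  set u := (h.coord x).1 with hu
  set v := (h.coord x).2 with hv
  have h1 : x * x = algebraMap O _ (u ^ 2 - v ^ 2 * b) + algebraMap O _ (2 * u * v + v ^ 2 * a) *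
      h.gen := by
    conv_lhs => rw [h.eq_coord x]
    simp only [map_add, map_sub, map_mul, map_pow, map_ofNat]
    linear_combination (algebraMap O (IntRing O L) v) ^ 2 * h.gen_sq
  rw [h1, h.mem_map_ideal_iff, h.coord_eq] at hx
  obtain ⟨h2, h3⟩ := hx
  have hvm : v ∈ primeP O := by
    refine Ideal.IsPrime.mem_of_pow_mem inferInstance 4 ?_
    rw [← Ideal.unit_mul_mem_iff_mem _ hD]
    have : (a ^ 2 - 4 * b) * v ^ 4 = (2 * a * v ^ 2 - (2 * u * v + v ^ 2 * a)) *
        (2 * u * v + v ^ 2 * a) + 4 * v ^ 2 * (u ^ 2 - v ^ 2 * b) := by ring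
    rw [this]
    exact add_mem (Ideal.mul_mem_left _ _ h3) (Ideal.mul_mem_left _ _ h2)
  rw [h.mem_map_ideal_iff]
  refine ⟨Ideal.IsPrime.mem_of_pow_mem inferInstance 2 ?_, hvm⟩
  have : (h.coord x).1 ^ 2 = (u ^ 2 - v ^ 2 * b) + v * (v * b) := by rw [← hu]; ring
  rw [this]
  exact add_mem h2 (Ideal.mul_mem_right _ _ hvm)

lemma not_isRamifiedAlg (hD : IsUnit (a ^ 2 - 4 * b)) : ¬ IsRamifiedAlg O L := by
  rintro ⟨-, hJ⟩
  have h1 : primeQ O L ≤ (primeP O).map (algebraMap O (IntRing O L)) := fun x hx =>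
    h.mem_map_primeP_of_sq_mem hD (by rw [hJ, pow_two]; exact Ideal.mul_mem_mul hx hx)
  have h2 := Ideal.pow_right_mono h1 2
  rw [← hJ, ← Ideal.map_pow] at h2
  obtain ⟨ϖ, hϖ⟩ := IsDiscreteValuationRing.exists_irreducible O
  have hϖm : ϖ ∈ primeP O := hϖ.not_isUnit
  have h3 := h2 (Ideal.mem_map_of_mem _ hϖm)
  rw [h.mem_map_ideal_iff, h.coord_algebraMap, primeP_pow_eq hϖ, Ideal.mem_span_singleton] at h3
  obtain ⟨c, hc⟩ := h3.1
  refine hϖ.not_isUnit (IsUnit.of_mul_eq_one c (mul_left_cancel₀ hϖ.ne_zero ?_))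
  linear_combination -hc

/-- Otherwise `L` would be ramified, and `𝔭 O_E` would be the square of a proper ideal. -/
lemma isUnit_disc_of_isInertAlg [Finite (IsLocalRing.ResidueField O)] (hI : IsInertAlg O L) :
    IsUnit (a ^ 2 - 4 * b) := by
  by_contra hD
  obtain ⟨θ', a', b', h', ha, hb⟩ := h.exists_eisenstein hD
  have h1 := (h'.isRamifiedAlg_of_eisenstein ha hb).2
  have hprime := hI.2.isPrime
  refine h'.gen_notMem_map_primeP 0 ?_
  rw [map_zero, sub_zero]
  refine hprime.mem_of_pow_mem 2 ?_
  rw [h1]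
  refine Ideal.pow_mem_pow ?_ 2
  rw [h'.primeQ_eq_span_of_eisenstein ha hb]
  exact Ideal.mem_span_singleton_self _

/-- A root `r` would give zero divisors `θ - r` and `θ - (a - r)` modulo `𝔭 O_E`. -/
lemma not_root_of_isInertAlg (hI : IsInertAlg O L) (r : IsLocalRing.ResidueField O) :
    r * r ≠ IsLocalRing.residue O a * r - IsLocalRing.residue O b := by
  intro hr
  obtain ⟨r, rfl⟩ := IsLocalRing.residue_surjective r
  have hc : r * r - (a * r - b) ∈ primeP O := by
    rw [primeP, ← IsLocalRing.residue_eq_zero_iff]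
    simp only [map_sub, map_mul, hr, sub_self]
  have h1 : (h.gen - algebraMap O _ r) * (h.gen - algebraMap O _ (a - r)) ∈
      (primeP O).map (algebraMap O (IntRing O L)) := by
    have : (h.gen - algebraMap O (IntRing O L) r) * (h.gen - algebraMap O _ (a - r)) =
        algebraMap O _ (-(r * r - (a * r - b))) := by
      simp only [map_sub, map_mul, map_neg]
      linear_combination h.gen_sq
    rw [this]
    exact Ideal.mem_map_of_mem _ (neg_mem hc)
  rcases hI.2.isPrime.mem_or_mem h1 with h2 | h2 <;> exact h.gen_notMem_map_primeP _ h2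

/-- Otherwise `L` would be a field. -/
lemma isUnit_disc_of_isSplitAlg [Finite (IsLocalRing.ResidueField O)] (hS : IsSplitAlg K L) :
    IsUnit (a ^ 2 - 4 * b) := by
  by_contra hD
  obtain ⟨θ', a', b', h', ha, hb⟩ := h.exists_eisenstein hD
  obtain ⟨f⟩ := hS
  have hF := (h'.isField_of_eisenstein ha hb)
  let _ := hF.toField
  have h1 : f.symm (1, 0) * f.symm (0, 1) = 0 := by rw [← map_mul]; simp
  rcases mul_eq_zero.1 h1 with h2 | h2
  · have := f.symm.injective (h2.trans (map_zero _).symm)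
    simp at this
  · have := f.symm.injective (h2.trans (map_zero _).symm)
    simp at this

/-- One of the two components of `θ` is an integral root of `t ^ 2 - a t + b` in `K`. -/
lemma exists_root_of_isSplitAlg (hS : IsSplitAlg K L) : ∃ r : IsLocalRing.ResidueField O,
    r * r = IsLocalRing.residue O a * r - IsLocalRing.residue O b := by
  obtain ⟨f⟩ := hS
  have h1 := congrArg (fun x => (f x).1) h.sq
  simp only [map_mul, map_sub, IsScalarTower.algebraMap_apply O K L, AlgEquiv.commutes,
    Prod.fst_mul, Prod.fst_sub, Prod.algebraMap_apply, Algebra.algebraMap_self_apply] at h1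
  have h2 : IsIntegral O (f θ).1 := by
    refine ⟨Polynomial.X ^ 2 - Polynomial.C a * Polynomial.X + Polynomial.C b, ?_, ?_⟩
    · monicity!
    · simp only [Polynomial.eval₂_add, Polynomial.eval₂_sub, Polynomial.eval₂_mul,
        Polynomial.eval₂_C, Polynomial.eval₂_X, pow_two]
      linear_combination h1
  obtain ⟨r, hr⟩ := IsIntegrallyClosed.isIntegral_iff.1 h2
  rw [← hr, ← map_mul, ← map_mul, ← map_sub] at h1
  exact ⟨IsLocalRing.residue O r, by
    rw [← map_mul, IsFractionRing.injective O K h1, map_sub, map_mul]⟩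

/-! ### The discriminant and the matrix `Θ` in the ramified case -/

/-- The discriminant of a pair is the square of its determinant times the discriminant of `1, θ`. -/
lemma algebraMap_discr (x : Fin 2 → IntRing O L) :
    ∃ c : O, Algebra.discr K (fun i => (x i : L)) = algebraMap O K (c ^ 2 * (a ^ 2 - 4 * b)) := by
  have hnt := h.nontrivial
  have hd := h.delta_sq
  rw [h.conj] at hd
  obtain ⟨u, hu⟩ : ∃ u, u = h.coord (x 0) := ⟨_, rfl⟩
  obtain ⟨v, hv⟩ : ∃ v, v = h.coord (x 1) := ⟨_, rfl⟩
  refine ⟨u.1 * v.2 - u.2 * v.1, ?_⟩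
  apply (algebraMap K L).injective
  rw [← IsScalarTower.algebraMap_apply, map_mul, ← hd, Algebra.discr_def, Matrix.det_fin_two]
  simp only [Algebra.traceMatrix_apply, Algebra.traceForm_apply, map_sub, map_mul,
    h.algebraMap_trace]
  have h0 : (x 0 : L) = algebraMap O L u.1 + algebraMap O L u.2 * θ := by
    rw [hu]; exact congrArg Subtype.val (h.eq_coord (x 0))
  have h1 : (x 1 : L) = algebraMap O L v.1 + algebraMap O L v.2 * θ := by
    rw [hv]; exact congrArg Subtype.val (h.eq_coord (x 1))
  rw [h0, h1]
  simp only [map_add, map_mul, h.sigma_algebraMap, h.conj, map_pow, map_sub]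
  ring

lemma discrIdeal_eq : discrIdeal O K L = Ideal.span {a ^ 2 - 4 * b} := by
  have hnt := h.nontrivial
  apply le_antisymm
  · rw [discrIdeal, Ideal.span_le]
    rintro d ⟨x, hx⟩
    obtain ⟨c, hc⟩ := h.algebraMap_discr x
    rw [hc] at hx
    rw [IsFractionRing.injective O K hx]
    exact Ideal.mul_mem_left _ _ (Ideal.mem_span_singleton_self _)
  · rw [Ideal.span_le, Set.singleton_subset_iff]
    refine Ideal.subset_span ⟨![1, h.gen], ?_⟩
    apply (algebraMap K L).injective
    rw [← IsScalarTower.algebraMap_apply, ← h.delta_sq, Algebra.discr_def, Matrix.det_fin_two]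
    simp only [Algebra.traceMatrix_apply, Algebra.traceForm_apply, map_sub, map_mul,
      h.algebraMap_trace, Matrix.cons_val_zero, Matrix.cons_val_one]
    change _ = ((1 : L) * 1 + σ 1 * σ 1) * (θ * θ + σ θ * σ θ) -
      (1 * θ + σ 1 * σ θ) * (θ * 1 + σ θ * σ 1)
    rw [map_one]
    ring

lemma discrExp_eq {ϖ : O} (hϖ : Irreducible ϖ) (u : Oˣ) (f : ℕ)
    (hf : a ^ 2 - 4 * b = u * ϖ ^ f) : discrExp O K L = f := by
  have hval : IsDiscreteValuationRing.addVal O (a ^ 2 - 4 * b) = f :=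
    IsDiscreteValuationRing.addVal_def _ u hϖ f hf
  refine le_antisymm (Nat.sInf_le ⟨_, ?_, hval⟩) (le_csInf ⟨f, _, ?_, hval⟩ ?_)
  · rw [h.discrIdeal_eq]; exact Ideal.mem_span_singleton_self _
  · rw [h.discrIdeal_eq]; exact Ideal.mem_span_singleton_self _
  · rintro g ⟨x, hx, hg⟩
    rw [h.discrIdeal_eq, Ideal.mem_span_singleton] at hx
    have := IsDiscreteValuationRing.addVal_le_iff_dvd.2 hx
    rw [hval, hg] at this
    exact_mod_cast this

end IsQuadGen

/-- The matrix with entry `c i` at `(i, p i)` for an involution `p` of the indices, and zeros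
elsewhere, is invertible if all `c i` are. -/
lemma Matrix.isUnit_of_involutive {R : Type*} [CommRing R] {m : ℕ} (p : Fin m → Fin m)
    (hp : ∀ i, p (p i) = i) (c d : Fin m → R) (hcd : ∀ i, c i * d i = 1) :
    IsUnit (Matrix.of fun i j => if j = p i then c i else 0) := by
  refine IsUnit.of_mul_eq_one (Matrix.of fun i j => if j = p i then d j else 0) ?_
  refine Matrix.ext fun i j => ?_
  rw [Matrix.mul_apply, Finset.sum_eq_single (p i)]
  · rw [Matrix.of_apply, Matrix.of_apply, if_pos rfl, hp, Matrix.one_apply]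
    by_cases hij : i = j
    · rw [if_pos hij.symm, if_pos hij, ← hij, hcd]
    · rw [if_neg (Ne.symm hij), if_neg hij, mul_zero]
  · intro l _ hl
    rw [Matrix.of_apply, if_neg hl, zero_mul]
  · exact fun hc => absurd (Finset.mem_univ _) hc

namespace IsQuadGen

variable {σ : L ≃ₐ[K] L} {θ : L} {a b : O} (h : IsQuadGen σ θ a b)
include h

/-- If `θ` is a prime element of `O_E` and `𝔣` is the order of the discriminant, then
`(θ - σ θ) θ ^ (-𝔣)` is a unit, because its square is. -/
lemma exists_unit_delta (ha : a ∈ IsLocalRing.maximalIdeal O) (hb : Irreducible b) {y : Lˣ}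
    (hy : (y : L) = θ) : ∃ κ : IntRing O L, IsUnit κ ∧
      (κ : L) = (θ - σ θ) * ((y ^ (-(discrExp O K L : ℤ)) : Lˣ) : L) := by
  obtain ⟨f, u, hf⟩ := IsDiscreteValuationRing.eq_unit_mul_pow_irreducible h.disc hb
  rw [h.discrExp_eq hb u f hf]
  obtain ⟨w, hw, hw'⟩ := h.exists_sigmaInt_gen_eq ha hb
  have hw'' : σ θ = θ * w := congrArg Subtype.val hw'
  have hbb : algebraMap O L b = θ ^ 2 * w := by
    have := h.sq
    have h2 := h.conj
    rw [hw''] at h2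
    linear_combination this - θ * h2
  set z : L := ((y ^ (-(f : ℤ)) : Lˣ) : L) with hz
  have hzθ : z * θ ^ f = 1 := by
    rw [hz, ← hy, ← Units.val_pow_eq_pow_val, ← Units.val_mul, zpow_neg, zpow_natCast,
      inv_mul_cancel, Units.val_one]
  have hsq : ((θ - σ θ) * z) ^ 2 = ((algebraMap O _ (u : O) * w ^ f : IntRing O L) : L) := by
    have h1 := h.delta_sq
    rw [hf, map_mul, map_pow, hbb] at h1
    have h2 : ((algebraMap O _ (u : O) * w ^ f : IntRing O L) : L) =
      algebraMap O L u * (w : L) ^ f := rfl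
    rw [h2]
    calc ((θ - σ θ) * z) ^ 2 = ((θ - σ θ) * (θ - σ θ)) * z ^ 2 := by ring
      _ = algebraMap O L u * (w : L) ^ f * (z * θ ^ f) ^ 2 := by rw [h1]; ring
      _ = _ := by rw [hzθ, one_pow, mul_one]
  have hint : (θ - σ θ) * z ∈ integralClosure O L := by
    refine IsIntegral.of_pow two_pos ?_
    rw [hsq]
    exact Subtype.prop _
  refine ⟨⟨_, hint⟩, ?_, rfl⟩
  have h3 : (⟨_, hint⟩ : IntRing O L) ^ 2 = algebraMap O _ (u : O) * w ^ f := Subtype.ext hsq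
  rw [← isUnit_pow_iff two_ne_zero, h3]
  exact (u.isUnit.map _).mul (hw.pow f)

/-- In the ramified case `(θ - σ θ) Θ` is an invertible skew-hermitian matrix over `O_E`. -/
lemma exists_isScaled_thetaMat (ha : a ∈ IsLocalRing.maximalIdeal O) (hb : Irreducible b) {y : Lˣ}
    (hy : (y : L) = θ) (k : ℕ) : ∃ T ∈ skewSub (sigmaInt (O := O) σ) 1 (2 * k), IsUnit T ∧
      h.IsScaled (thetaMat O σ y k) T := by
  obtain ⟨κ, hκ, hκ'⟩ := h.exists_unit_delta ha hb hy
  obtain ⟨κ', hκκ'⟩ := hκ.exists_right_inv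
  have hσκ : sigmaInt σ κ * sigmaInt σ κ' = 1 := by rw [← map_mul, hκκ', map_one]
  let p : Fin (2 * k) → Fin (2 * k) := fun i =>
    ⟨if (i : ℕ) % 2 = 0 then i + 1 else i - 1, by split_ifs <;> omega⟩
  have hp : ∀ i j : Fin (2 * k), j = p i ↔
      (j : ℕ) = if (i : ℕ) % 2 = 0 then (i : ℕ) + 1 else i - 1 := fun i j => Fin.ext_iff
  let c : Fin (2 * k) → IntRing O L := fun i => if (i : ℕ) % 2 = 0 then κ else -sigmaInt σ κ
  let d : Fin (2 * k) → IntRing O L := fun i => if (i : ℕ) % 2 = 0 then κ' else -sigmaInt σ κ'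
  have hentry : ∀ i j : Fin (2 * k), (if j = p i then c i else 0) =
      if (i : ℕ) % 2 = 0 ∧ (j : ℕ) = i + 1 then κ
      else if (j : ℕ) % 2 = 0 ∧ (i : ℕ) = j + 1 then -sigmaInt σ κ else 0 := by
    intro i j
    simp only [hp, c]
    split_ifs <;> first | rfl | omega
  refine ⟨Matrix.of fun i j => if j = p i then c i else 0, ?_,
    Matrix.isUnit_of_involutive p (fun i => ?_) c d (fun i => ?_), fun i j => ?_⟩
  · refine ⟨Matrix.of fun i j => if (i : ℕ) % 2 = 0 ∧ (j : ℕ) = i + 1 then κ else 0, ?_⟩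
    refine Matrix.ext fun i j => ?_
    rw [Matrix.of_apply, hentry]
    change (1 : IntRing O L) * (if (i : ℕ) % 2 = 0 ∧ (j : ℕ) = i + 1 then κ else 0) -
      sigmaInt σ (1 * if (j : ℕ) % 2 = 0 ∧ (i : ℕ) = j + 1 then κ else 0) = _
    rw [one_mul, one_mul]
    split_ifs <;> first | omega | simp
  · rw [eq_comm, hp]
    simp only [p]
    split_ifs <;> omega
  · simp only [c, d]
    split_ifs
    · exact hκκ'
    · rw [neg_mul_neg, hσκ]
  · rw [Matrix.of_apply, hentry, thetaMat, if_pos (h.isRamifiedAlg_of_eisenstein ha hb),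
      Matrix.of_apply]
    split_ifs
    · exact hκ'.symm
    · change _ = -σ (κ : L)
      rw [hκ', map_mul, h.sigma_delta]; ring
    · rw [mul_zero]; rfl

lemma isScaled_one (m : ℕ) : h.IsScaled (1 : Matrix (Fin m) (Fin m) L)
    (h.delta • (1 : Matrix (Fin m) (Fin m) (IntRing O L))) := by
  intro i j
  change (θ - σ θ) * _ = (θ - σ θ) * (((1 : Matrix (Fin m) (Fin m) (IntRing O L)) i j :
    IntRing O L) : L)
  rw [Matrix.one_apply, Matrix.one_apply]
  split_ifs <;> rfl

end IsQuadGen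

end Trichotomy

/-! ### The normalized counts as products -/

section Products

variable {q : ℝ} (hq : 0 < q)
include hq

lemma normalized_inert_prod (k n : ℕ) (hnk : n ≤ 2 * k) :
    q ^ (-2 * ((2 * k : ℕ) : ℤ) * (n : ℤ) + (n : ℤ) ^ 2) *
      ∏ i ∈ Finset.range n, ((q ^ (2 * (2 * k - i)) + (q - 1) * (-q) ^ (2 * k)) / q - q ^ (2 * i)) =
    ∏ i ∈ Finset.range (2 * n), (1 - (-1) ^ i * q ^ (-(2 * (k : ℤ)) + (i : ℤ))) := by
  induction n with
  | zero => simp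
  | succ n ih =>
    have hq0 := hq.ne'
    rw [show 2 * (n + 1) = 2 * n + 1 + 1 by ring, Finset.prod_range_succ, Finset.prod_range_succ,
      Finset.prod_range_succ, ← ih (by omega)]
    have e1 : q ^ (-2 * ((2 * k : ℕ) : ℤ) * ((n + 1 : ℕ) : ℤ) + ((n + 1 : ℕ) : ℤ) ^ 2) =
        q ^ (-2 * ((2 * k : ℕ) : ℤ) * (n : ℤ) + (n : ℤ) ^ 2) *
          ((q ^ k) ^ 4)⁻¹ * (q ^ n) ^ 2 * q := by
      rw [← zpow_natCast q k, ← zpow_natCast q n, ← zpow_natCast, ← zpow_natCast, ← zpow_mul,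
        ← zpow_mul, ← zpow_neg, ← zpow_add₀ hq0, ← zpow_add₀ hq0, ← zpow_add_one₀ hq0]
      congr 1
      push_cast; ring
    have e2 : q ^ (2 * (2 * k - n)) = (q ^ k) ^ 4 / (q ^ n) ^ 2 := by
      rw [eq_div_iff (by positivity), ← pow_mul, ← pow_mul, ← pow_add]
      congr 1; omega
    have e3 : q ^ (-(2 * (k : ℤ)) + ((2 * n : ℕ) : ℤ)) = (q ^ n) ^ 2 / (q ^ k) ^ 2 := by
      rw [zpow_add₀ hq0, zpow_neg, zpow_natCast, mul_comm 2 n, pow_mul,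
        mul_comm (2 : ℤ), zpow_mul, zpow_natCast, inv_mul_eq_div]
      norm_cast
    have e4 : q ^ (-(2 * (k : ℤ)) + ((2 * n + 1 : ℕ) : ℤ)) = (q ^ n) ^ 2 / (q ^ k) ^ 2 * q := by
      rw [← e3, ← zpow_add_one₀ hq0]; push_cast; rw [add_assoc]
    have e5 : q ^ (2 * n) = (q ^ n) ^ 2 := by rw [← pow_mul, mul_comm]
    have e6 : (-q) ^ (2 * k) = (q ^ k) ^ 2 := by
      rw [(even_two_mul k).neg_pow, ← pow_mul, mul_comm]
    have e7 : (-1 : ℝ) ^ (2 * n) = 1 := (even_two_mul n).neg_one_pow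
    rw [e1, e2, e3, e4, e5, e6, pow_succ (-1 : ℝ), e7]
    have hk : q ^ k ≠ 0 := by positivity
    have hn : q ^ n ≠ 0 := by positivity
    field_simp
    ring

lemma normalized_ramified_prod (k n : ℕ) (hnk : n ≤ 2 * k) :
    q ^ (-2 * ((2 * k : ℕ) : ℤ) * (n : ℤ)) * q ^ (2 * k * n + ∑ i ∈ Finset.range n, i) *
      ∏ i ∈ Finset.range n, (q ^ (2 * k - i) - q ^ i) =
    ∏ i ∈ Finset.range n, (1 - q ^ (-(2 * (k : ℤ)) + 2 * (i : ℤ))) := by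
  induction n with
  | zero => simp
  | succ n ih =>
    have hq0 := hq.ne'
    rw [Finset.prod_range_succ, Finset.prod_range_succ, Finset.sum_range_succ, ← ih (by omega)]
    have e1 : q ^ (-2 * ((2 * k : ℕ) : ℤ) * ((n + 1 : ℕ) : ℤ)) =
        q ^ (-2 * ((2 * k : ℕ) : ℤ) * (n : ℤ)) * ((q ^ k) ^ 4)⁻¹ := by
      rw [← zpow_natCast q k, ← zpow_natCast, ← zpow_mul, ← zpow_neg, ← zpow_add₀ hq0]
      congr 1
      push_cast; ring
    have e2 : q ^ (2 * k - n) = (q ^ k) ^ 2 / q ^ n := by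
      rw [eq_div_iff (by positivity), ← pow_mul, ← pow_add]
      congr 1; omega
    have e3 : q ^ (-(2 * (k : ℤ)) + 2 * (n : ℤ)) = (q ^ n) ^ 2 / (q ^ k) ^ 2 := by
      rw [zpow_add₀ hq0, zpow_neg, mul_comm (2 : ℤ), zpow_mul, zpow_natCast, mul_comm (2 : ℤ),
        zpow_mul, zpow_natCast, inv_mul_eq_div]
      norm_cast
    have e4 : q ^ (2 * k * (n + 1) + (∑ i ∈ Finset.range n, i + n)) =
        q ^ (2 * k * n + ∑ i ∈ Finset.range n, i) * (q ^ k) ^ 2 * q ^ n := by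
      rw [← pow_mul, ← pow_add, ← pow_add]
      congr 1; ring
    rw [e1, e2, e3, e4]
    have hk : q ^ k ≠ 0 := by positivity
    have hn : q ^ n ≠ 0 := by positivity
    field_simp

lemma prod_pow_sub_pow (d n : ℕ) : ∏ i ∈ Finset.range n, (q ^ d - q ^ i) =
    q ^ (d * n) * ∏ i ∈ Finset.range n, (1 - q ^ (-(d : ℤ) + (i : ℤ))) := by
  have hq0 := hq.ne'
  rw [pow_mul]
  conv_rhs => rw [← Finset.card_range n, ← Finset.prod_const, Finset.card_range,
    ← Finset.prod_mul_distrib]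
  refine Finset.prod_congr rfl fun i _ => ?_
  rw [mul_sub, mul_one, ← zpow_natCast q d, ← zpow_add₀ hq0, add_neg_cancel_left, zpow_natCast,
    zpow_natCast]

lemma normalized_split_prod (k n : ℕ) (hnk : n ≤ 2 * k) :
    q ^ (-2 * ((2 * k : ℕ) : ℤ) * (n : ℤ) + (n : ℤ) ^ 2) *
      ((∏ i ∈ Finset.range n, (q ^ (2 * k) - q ^ i)) *
        ∏ i ∈ Finset.range n, (q ^ (2 * k - n) - q ^ i)) =
    ∏ i ∈ Finset.range (2 * n), (1 - q ^ (-(2 * (k : ℤ)) + (i : ℤ))) := by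
  have hq0 := hq.ne'
  rw [two_mul n, Finset.prod_range_add, prod_pow_sub_pow hq, prod_pow_sub_pow hq]
  have e1 : q ^ (-2 * ((2 * k : ℕ) : ℤ) * (n : ℤ) + (n : ℤ) ^ 2) * q ^ (2 * k * n) *
      q ^ ((2 * k - n) * n) = 1 := by
    rw [← zpow_natCast, ← zpow_natCast, ← zpow_add₀ hq0, ← zpow_add₀ hq0, ← zpow_zero q]
    congr 1
    push_cast [Nat.cast_sub hnk]
    ring
  have e2 : ∀ i ∈ Finset.range n, 1 - q ^ (-((2 * k - n : ℕ) : ℤ) + (i : ℤ)) =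
      1 - q ^ (-(2 * (k : ℤ)) + ((n + i : ℕ) : ℤ)) := fun i _ => by
    congr 2
    push_cast [Nat.cast_sub hnk]
    ring
  rw [Finset.prod_congr rfl e2]
  push_cast at e1 ⊢
  linear_combination (∏ i ∈ Finset.range n, (1 - q ^ (-(2 * (k : ℤ)) + (i : ℤ)))) *
    (∏ i ∈ Finset.range n, (1 - q ^ (-(2 * (k : ℤ)) + ((n : ℤ) + (i : ℤ))))) * e1

end Products

/-! ### The densities -/

section Density

set_option linter.unusedSectionVars false

variable {O K L : Type*} [CommRing O] [IsDomain O] [IsDiscreteValuationRing O] [Field K]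
  [Algebra O K] [IsFractionRing O K]
  [CommRing L] [Algebra K L] [Algebra O L] [IsScalarTower O K L]
  [Finite (IsLocalRing.ResidueField O)]

lemma tendsto_primDensity_of_eventually_const {σ : L ≃ₐ[K] L} {m n : ℕ}
    {A : Matrix (Fin m) (Fin m) L} {B : Matrix (Fin n) (Fin n) L} {c : ℝ}
    (hc : ∀ e, 1 ≤ e → densitySeq O σ A B (primMat O L m n) e = c) :
    Tendsto (densitySeq O σ A B (primMat O L m n)) atTop (𝓝 (primDensity O σ A B)) ∧
      primDensity O σ A B = c := by
  have h1 : Tendsto (densitySeq O σ A B (primMat O L m n)) atTop (𝓝 c) :=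
    tendsto_const_nhds.congr' (eventually_atTop.2 ⟨1, fun e he => (hc e he).symm⟩)
  have h2 : primDensity O σ A B = c := h1.limUnder_eq
  exact ⟨by rwa [h2], h2⟩

namespace IsQuadGen

variable {σ : L ≃ₐ[K] L} {θ : L} {a b : O} (h : IsQuadGen σ θ a b)
include h

lemma densitySeq_eq {ϖ : O} (hϖ : Irreducible ϖ) {m n : ℕ} {A : Matrix (Fin m) (Fin m) L}
    {T : Matrix (Fin m) (Fin m) (IntRing O L)} (hT : IsUnit T)
    (hT1 : T ∈ skewSub (sigmaInt σ) 1 m) (hA : h.IsScaled A T)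
    {B : Matrix (Fin n) (Fin n) L} {C : Matrix (Fin n) (Fin n) (IntRing O L)}
    (hB : h.IsScaled B C) {e : ℕ} (he : 1 ≤ e) :
    densitySeq O σ A B (primMat O L m n) e =
      (residueCard O : ℝ) ^ (-2 * (m : ℤ) * (n : ℤ) + (n : ℤ) ^ 2) *
        primCount (sigmaInt σ) T C (algebraMap O (IntRing O L) ϖ) := by
  rw [densitySeq, h.solCount_eq_primCount hϖ hA hB, h.normalized_primCount hT hT1 C hϖ he]

/-- If the discriminant is a unit, then `Θ = 1` and `(θ - σ θ) B` vanishes modulo a prime element. -/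
lemma densitySeq_eq_of_isUnit (hD : IsUnit (a ^ 2 - 4 * b)) {ϖ : O} (hϖ : Irreducible ϖ) (y : Lˣ)
    {n : ℕ} (k : ℕ) {B : Matrix (Fin n) (Fin n) L} (hB : B ∈ HerStar O σ n) :
    ∃ C ∈ skewSub (sigmaInt σ) (algebraMap O (IntRing O L) ϖ) n, ∀ e, 1 ≤ e →
    densitySeq O σ (thetaMat O σ y k) B (primMat O L (2 * k) n) e =
      (residueCard O : ℝ) ^ (-2 * ((2 * k : ℕ) : ℤ) * (n : ℤ) + (n : ℤ) ^ 2) *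
        primCount (sigmaInt σ) (h.delta • (1 : Matrix (Fin (2 * k)) (Fin (2 * k)) (IntRing O L))) C
          (algebraMap O (IntRing O L) ϖ) := by
  have hram := h.not_isRamifiedAlg hD
  obtain ⟨C, hC, hBC⟩ := h.exists_isScaled_of_mem_smul hϖ 1 (herStar_of_not_isRamifiedAlg hram hB)
  rw [pow_one] at hC
  refine ⟨C, hC, fun e he => ?_⟩
  rw [thetaMat, if_neg hram]
  exact h.densitySeq_eq hϖ (h.isUnit_delta_smul_one hD _) (h.delta_smul_one_mem hD _)
    (h.isScaled_one _) hBC he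

lemma densitySeq_inert (hD : IsUnit (a ^ 2 - 4 * b))
    (hroot : ∀ r : IsLocalRing.ResidueField O,
      r * r ≠ IsLocalRing.residue O a * r - IsLocalRing.residue O b) (y : Lˣ)
    {n k : ℕ} (hnk : n ≤ 2 * k) {B : Matrix (Fin n) (Fin n) L} (hB : B ∈ HerStar O σ n)
    (e : ℕ) (he : 1 ≤ e) :
    densitySeq O σ (thetaMat O σ y k) B (primMat O L (2 * k) n) e =
      ∏ i ∈ Finset.range (2 * n),
        (1 - (-1) ^ i * (residueCard O : ℝ) ^ (-(2 * (k : ℤ)) + (i : ℤ))) := by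
  obtain ⟨ϖ, hϖ⟩ := IsDiscreteValuationRing.exists_irreducible O
  obtain ⟨C, hC, hBC⟩ := h.densitySeq_eq_of_isUnit hD hϖ y k hB
  rw [hBC e he, h.primCount_inert hD hϖ hroot _ hC,
    normalized_inert_prod (by exact_mod_cast residueCard_pos) k n hnk]

lemma densitySeq_split (hD : IsUnit (a ^ 2 - 4 * b)) {r : IsLocalRing.ResidueField O}
    (hr : r * r = IsLocalRing.residue O a * r - IsLocalRing.residue O b) (y : Lˣ)
    {n k : ℕ} (hnk : n ≤ 2 * k) {B : Matrix (Fin n) (Fin n) L} (hB : B ∈ HerStar O σ n)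
    (e : ℕ) (he : 1 ≤ e) :
    densitySeq O σ (thetaMat O σ y k) B (primMat O L (2 * k) n) e =
      ∏ i ∈ Finset.range (2 * n), (1 - (residueCard O : ℝ) ^ (-(2 * (k : ℤ)) + (i : ℤ))) := by
  obtain ⟨ϖ, hϖ⟩ := IsDiscreteValuationRing.exists_irreducible O
  obtain ⟨C, hC, hBC⟩ := h.densitySeq_eq_of_isUnit hD hϖ y k hB
  rw [hBC e he, h.primCount_split hD hr hϖ _ hC,
    normalized_split_prod (by exact_mod_cast residueCard_pos) k n hnk]

lemma densitySeq_ramified (ha : a ∈ IsLocalRing.maximalIdeal O) (hb : Irreducible b) {y : Lˣ}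
    (hy : (y : L) = θ) {n k : ℕ} (hnk : n ≤ 2 * k) {B : Matrix (Fin n) (Fin n) L}
    (hB : B ∈ HerStar O σ n) (e : ℕ) (he : 1 ≤ e) :
    densitySeq O σ (thetaMat O σ y k) B (primMat O L (2 * k) n) e =
      ∏ i ∈ Finset.range n, (1 - (residueCard O : ℝ) ^ (-(2 * (k : ℤ)) + 2 * (i : ℤ))) := by
  obtain ⟨T, hT1, hT, hA⟩ := h.exists_isScaled_thetaMat ha hb hy k
  obtain ⟨C, hC, hBC⟩ := h.exists_isScaled_of_mem_herStar ha hb hB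
  have hq : (0 : ℝ) < residueCard O := by exact_mod_cast residueCard_pos
  have h1 := h.primCount_eisenstein hT hT1 C ha hb
  have h2 : (primCount (sigmaInt σ) T C (algebraMap O (IntRing O L) b) : ℝ) *
      (residueCard O : ℝ) ^ (n ^ 2) = primCount (sigmaInt σ) T C h.gen *
        (residueCard O : ℝ) ^ (2 * k * n + ∑ i ∈ Finset.range n, i) := by exact_mod_cast h1
  rw [h.primCount_gen ha hb hT hT1 hC] at h2
  rw [h.densitySeq_eq hb hT hT1 hA hBC he, ← normalized_ramified_prod hq k n hnk, mul_assoc _ _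
    (∏ i ∈ Finset.range n, _), mul_comm _ (∏ i ∈ Finset.range n, _), ← h2, zpow_add₀ hq.ne']
  have h3 : (residueCard O : ℝ) ^ ((n : ℤ) ^ 2) = (residueCard O : ℝ) ^ (n ^ 2) := by norm_cast
  rw [h3]; ring

end IsQuadGen

end Density

/-! ### The algebra `E_v` -/

section LocalAlgebra

variable (F E : Type*) [Field F] [NumberField F] [Field E] [Algebra F E]
  (v : IsDedekindDomain.HeightOneSpectrum (𝓞 F))

/-- Every class of the residue field of `F_v` contains an integer of `F`. -/
instance finite_residueField_adicCompletionIntegers :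
    Finite (IsLocalRing.ResidueField (LocO F v)) := by
  have : Finite (𝓞 F ⧸ v.asIdeal) := v.asIdeal.finiteQuotientOfFreeOfNeBot v.ne_bot
  have hmem : ∀ x : LocO F v, x ∈ IsLocalRing.maximalIdeal (LocO F v) ↔
      Valued.v (x : LocF F v) < 1 := fun x => by
    rw [IsLocalRing.mem_maximalIdeal, mem_nonunits_iff,
      IsDedekindDomain.HeightOneSpectrum.adicCompletionIntegers.isUnit_iff_valued_eq_one]
    exact ⟨fun hx => lt_of_le_of_ne x.2 hx, fun hx => hx.ne⟩
  have hcoe : ∀ r : 𝓞 F, ((algebraMap (𝓞 F) (LocO F v) r : LocO F v) : LocF F v) =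
      algebraMap F (LocF F v) (algebraMap (𝓞 F) F r) := fun r => rfl
  have hval : ∀ y : F, Valued.v (algebraMap F (LocF F v) y) = v.valuation F y := fun y =>
    IsDedekindDomain.HeightOneSpectrum.valuedAdicCompletion_eq_valuation' v y
  let g : 𝓞 F ⧸ v.asIdeal →+* IsLocalRing.ResidueField (LocO F v) :=
    Ideal.Quotient.lift v.asIdeal ((IsLocalRing.residue _).comp (algebraMap (𝓞 F) (LocO F v)))
      fun r hr => by
        rw [RingHom.comp_apply, IsLocalRing.residue_eq_zero_iff, hmem, hcoe, hval]
        exact (v.valuation_lt_one_iff_mem r).2 hr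
  refine Finite.of_surjective g fun z => ?_
  obtain ⟨x, rfl⟩ := IsLocalRing.residue_surjective z
  have hopen : {y : LocF F v | Valued.v (y - x) < 1} ∈ 𝓝 (x : LocF F v) := by
    rw [Valued.mem_nhds]
    exact ⟨1, fun y hy => (Valuation.restrict_lt_one_iff _).1 hy⟩
  obtain ⟨y, hy⟩ := (IsDedekindDomain.HeightOneSpectrum.denseRange_algebraMap
    F v).exists_mem_open isOpen_interior ⟨_, mem_interior_iff_mem_nhds.2 hopen⟩
  have hyx : Valued.v (algebraMap F (LocF F v) y - x) < 1 :=
    interior_subset (s := {y : LocF F v | Valued.v (y - x) < 1}) hy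
  have hy1 : v.valuation F y ≤ 1 := by
    rw [← hval, ← sub_add_cancel (algebraMap F (LocF F v) y) (x : LocF F v)]
    exact (Valuation.map_add _ _ _).trans (max_le hyx.le x.2)
  obtain ⟨r, hr⟩ := IsDedekindDomain.HeightOneSpectrum.exists_valuation_sub_lt_of_integer
    (v := v) hy1 1
  refine ⟨Ideal.Quotient.mk _ r, ?_⟩
  change IsLocalRing.residue _ (algebraMap (𝓞 F) (LocO F v) r) = _
  rw [← sub_eq_zero, ← map_sub, IsLocalRing.residue_eq_zero_iff, hmem]
  change Valued.v (algebraMap F (LocF F v) (algebraMap (𝓞 F) F r) - (x : LocF F v)) < 1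
  rw [← sub_add_sub_cancel _ (algebraMap F (LocF F v) y) (x : LocF F v), ← map_sub]
  refine (Valuation.map_add _ _ _).trans_lt (max_lt ?_ hyx)
  rw [hval]
  exact hr

/-- A quadratic extension with nontrivial automorphism `ρ` has a basis `1, ω` with `ω ^ 2` in the
base field and `ρ ω = -ω`. -/
lemma exists_basis_sqrt [Algebra.IsQuadraticExtension F E] (ρ : E ≃ₐ[F] E)
    (hρ : ρ ≠ AlgEquiv.refl) : ∃ (ω : E) (d : F) (β : Module.Basis (Fin 2) F E), d ≠ 0 ∧
      ω * ω = algebraMap F E d ∧ ρ ω = -ω ∧ β 0 = 1 ∧ β 1 = ω := by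
  have h2 : (2 : F) ≠ 0 := two_ne_zero
  have hbasis : ∀ y : E, ρ y ≠ y → ∃ β : Module.Basis (Fin 2) F E, β 0 = 1 ∧ β 1 = y := by
    intro y hy
    have hli : LinearIndependent F ![1, y] := by
      rw [LinearIndependent.pair_iff]
      intro s t hst
      have ht : t = 0 := by
        by_contra ht
        apply hy
        have h1 : y = algebraMap F E (-(s / t)) := by
          have ht' : algebraMap F E t ≠ 0 := by simpa using ht
          rw [Algebra.smul_def, Algebra.smul_def] at hst
          rw [map_neg, map_div₀]
          field_simp
          linear_combination hst
        rw [h1, AlgEquiv.commutes]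
      subst ht
      rw [zero_smul, add_zero, Algebra.smul_def, mul_one] at hst
      exact ⟨by simpa using hst, rfl⟩
    refine ⟨basisOfLinearIndependentOfCardEqFinrank hli ?_, ?_, ?_⟩
    · rw [Algebra.IsQuadraticExtension.finrank_eq_two]; rfl
    · simp
    · simp
  obtain ⟨y, hy⟩ : ∃ y, ρ y ≠ y := by
    by_contra! hc
    exact hρ (AlgEquiv.ext hc)
  obtain ⟨β, hβ0, hβ1⟩ := hbasis y hy
  have hsq := β.sum_repr (y * y)
  rw [Fin.sum_univ_two, hβ0, hβ1, Algebra.smul_def, Algebra.smul_def, mul_one] at hsq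
  set s := β.repr (y * y) 0
  set t := β.repr (y * y) 1
  -- complete the square
  set ω : E := 2 * y - algebraMap F E t with hω
  have hωω : ω * ω = algebraMap F E (4 * s + t ^ 2) := by
    rw [hω]
    simp only [map_add, map_mul, map_pow, map_ofNat]
    linear_combination -4 * hsq
  have hρ2 : ρ ω ≠ ω := by
    intro hc
    rw [hω, map_sub, map_mul, map_ofNat, AlgEquiv.commutes, sub_left_inj] at hc
    have h2E := (algebraMap F E).injective.ne h2
    rw [map_ofNat, map_zero] at h2E
    exact hy (mul_left_cancel₀ h2E hc)
  have hρω : ρ ω = -ω := by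
    have h1 := congrArg ρ hωω
    rw [map_mul, AlgEquiv.commutes, ← hωω] at h1
    exact (mul_self_eq_mul_self_iff.1 h1).resolve_left hρ2
  obtain ⟨γ, hγ0, hγ1⟩ := hbasis ω hρ2
  refine ⟨ω, _, γ, fun hd => hρ2 ?_, hωω, hρω, hγ0, hγ1⟩
  rw [hd, map_zero, mul_self_eq_zero] at hωω
  rw [hωω, map_zero]

lemma exists_isQuadGen_locE [Algebra.IsQuadraticExtension F E] (ρ : E ≃ₐ[F] E)
    (hρ : ρ ≠ AlgEquiv.refl) :
    ∃ (θ : LocE F E v) (a b : LocO F v), IsQuadGen (locConj F v ρ) θ a b := by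
  obtain ⟨ω, d, β, hd, hωω, hρω, hβ0, hβ1⟩ := exists_basis_sqrt F E ρ hρ
  let β' := Algebra.TensorProduct.basis (LocF F v) β
  have hβ'0 : β' 0 = 1 := by rw [Algebra.TensorProduct.basis_apply, hβ0]; rfl
  have hβ'1 : β' 1 = 1 ⊗ₜ ω := by rw [Algebra.TensorProduct.basis_apply, hβ1]
  have hinj := (algebraMap F (LocF F v)).injective
  refine exists_isQuadGen (locConj F v ρ) (1 ⊗ₜ ω) (algebraMap F (LocF F v) d) ?_ ?_ ?_ ?_
    (fun x => ⟨β'.repr x 0, β'.repr x 1, ?_⟩) (fun s t hst => ?_)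
  · have := hinj.ne (two_ne_zero (α := F))
    rwa [map_ofNat, map_zero] at this
  · have := hinj.ne hd
    rwa [map_zero] at this
  · rw [Algebra.TensorProduct.tmul_mul_tmul, hωω, mul_one, Algebra.TensorProduct.algebraMap_apply,
      Algebra.algebraMap_self_apply, Algebra.algebraMap_eq_smul_one, Algebra.algebraMap_eq_smul_one,
      TensorProduct.smul_tmul]
  · change (1 : LocF F v) ⊗ₜ[F] ρ ω = _
    rw [hρω, TensorProduct.tmul_neg]
  · have := β'.sum_repr x
    rw [Fin.sum_univ_two, hβ'0, hβ'1, Algebra.smul_def, Algebra.smul_def, mul_one] at this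
    exact this.symm
  · have hli := Fintype.linearIndependent_iff.1 β'.linearIndependent ![s, t] (by
      rw [Fin.sum_univ_two, hβ'0, hβ'1]
      simp only [Matrix.cons_val_zero, Matrix.cons_val_one]
      rw [Algebra.smul_def, Algebra.smul_def, mul_one, hst])
    exact ⟨hli 0, hli 1⟩

end LocalAlgebra

/-! ### The primitive densities -/

theorem mainTheorem9
    (F E : Type*) [Field F] [NumberField F] [NumberField.IsTotallyReal F]
    [Field E] [NumberField E] [NumberField.IsTotallyComplex E]
    [Algebra F E] [Algebra.IsQuadraticExtension F E]
    (ρ : E ≃ₐ[F] E) (hρ : ρ ≠ AlgEquiv.refl)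
    (v : IsDedekindDomain.HeightOneSpectrum (𝓞 F))
    (ϖ : LocO F v) (hϖ : Irreducible ϖ)
    (ϖE : (LocE F E v)ˣ)
    (hϖE : IsRamifiedAlg (LocO F v) (LocE F E v) →
      Algebra.norm (LocF F v) (ϖE : LocE F E v) = (ϖ : LocF F v))
    (n k : ℕ) (hnk : n ≤ 2 * k)
    (B : Matrix (Fin n) (Fin n) (LocE F E v))
    (hB : B ∈ HerStarND (LocO F v) (locConj F v ρ) n) :
    Tendsto
      (densitySeq (LocO F v) (locConj F v ρ)
        (thetaMat (LocO F v) (locConj F v ρ) ϖE k) B (primMat (LocO F v) (LocE F E v) (2 * k) n))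
      atTop
      (𝓝 (primDensity (LocO F v) (locConj F v ρ)
        (thetaMat (LocO F v) (locConj F v ρ) ϖE k) B)) ∧
    (IsInertAlg (LocO F v) (LocE F E v) →
      primDensity (LocO F v) (locConj F v ρ) (thetaMat (LocO F v) (locConj F v ρ) ϖE k) B =
        ∏ i ∈ Finset.range (2 * n),
          (1 - (-1) ^ i * (residueCard (LocO F v) : ℝ) ^ (-(2 * (k : ℤ)) + (i : ℤ)))) ∧
    (IsRamifiedAlg (LocO F v) (LocE F E v) →
      primDensity (LocO F v) (locConj F v ρ) (thetaMat (LocO F v) (locConj F v ρ) ϖE k) B =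
        ∏ i ∈ Finset.range n,
          (1 - (residueCard (LocO F v) : ℝ) ^ (-(2 * (k : ℤ)) + 2 * (i : ℤ)))) ∧
    (IsSplitAlg (LocF F v) (LocE F E v) →
      primDensity (LocO F v) (locConj F v ρ) (thetaMat (LocO F v) (locConj F v ρ) ϖE k) B =
        ∏ i ∈ Finset.range (2 * n),
          (1 - (residueCard (LocO F v) : ℝ) ^ (-(2 * (k : ℤ)) + (i : ℤ)))) := by
  obtain ⟨θ, a, b, h⟩ := exists_isQuadGen_locE F E v ρ hρ
  by_cases hD : IsUnit (a ^ 2 - 4 * b)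
  · have hram := h.not_isRamifiedAlg hD
    by_cases hroot : ∃ r : IsLocalRing.ResidueField (LocO F v),
        r * r = IsLocalRing.residue _ a * r - IsLocalRing.residue _ b
    · obtain ⟨r, hr⟩ := hroot
      obtain ⟨hlim, heq⟩ := tendsto_primDensity_of_eventually_const
        (h.densitySeq_split hD hr ϖE hnk hB.1)
      exact ⟨hlim, fun hI => absurd hr (h.not_root_of_isInertAlg hI r),
        fun hR => absurd hR hram, fun _ => heq⟩
    · obtain ⟨hlim, heq⟩ := tendsto_primDensity_of_eventually_const
        (h.densitySeq_inert hD (fun r hr => hroot ⟨r, hr⟩) ϖE hnk hB.1)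
      exact ⟨hlim, fun _ => heq, fun hR => absurd hR hram,
        fun hS => absurd (h.exists_root_of_isSplitAlg hS) hroot⟩
  · obtain ⟨θ', a', b', h', ha', hb'⟩ := h.exists_eisenstein hD
    have hN := hϖE (h'.isRamifiedAlg_of_eisenstein ha' hb')
    -- `ϖ_E` itself generates the ring of integers
    obtain ⟨a'', ha'', h''⟩ := h'.isQuadGen_of_norm_eq ha' hb' hϖ hN
    obtain ⟨hlim, heq⟩ := tendsto_primDensity_of_eventually_const
      (h''.densitySeq_ramified ha'' hϖ rfl hnk hB.1)
    exact ⟨hlim, fun hI => absurd (h.isUnit_disc_of_isInertAlg hI) hD, fun _ => heq,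
      fun hS => absurd (h.isUnit_disc_of_isSplitAlg hS) hD⟩
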